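/- \textbf{Setting.} Let $n\ge 1$, write $x=(x_1,\dots,x_n)\in\mathbb R^n$, $a^+=\max(a,0)$, $a^-=\min(a,0)$, $\mathbb R^n_+=\{x_1>0\}$, $B_r^+(x^0)=\{x: x_1>0,\ |x-x^0|<r\}$, $\partial B_r^+(x^0)=\{x: x_1>0,\ |x-x^0|=r\}$, and let $dS$ be surface measure and $\nu=(x-x^0)/r$ the outer normal on $\partial B_r^+(x^0)$. Let $\Omega\subset\{x_1\ge 0\}$ be connected and relatively open in $\{x_1\ge 0\}$; $\partial\Omega$ denotes its boundary relative to $\{x_1\ge0\}$. A function $u$ is a \emph{variational solution} in $\Omega$ of $$\mathrm{div}(x_1\nabla u)=0 \text{ in }\{u>0\},\qquad \mathrm{div}\Big(\frac1{x_1}\nabla u\Big)=0\text{ in }\{u<0\},\qquad x_1|\nabla u^+|^2=\frac1{x_1}|\nabla u^-|^2\text{ on }\partial\{u>0\}$$ if the following hold. (i) $u\in W^{1,2}(\Omega\cap\{x_1>0\})$, $\int_\Omega \big(x_1|\nabla u^+|^2+\frac1{x_1}|\nabla u^-|^2\big)dx<\infty$ and $\int_\Omega \big(x_1(u^+)^2+\frac1{x_1}(u^-)^2\big)dx<\infty$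 (with weak gradients). (ii) $u\in C^0(\Omega\cap\{x_1>0\})\cap C^2(\Omega\cap\{u\ne0\}\cap\{x_1>0\})$. (iii) For every $x^0\in\Omega$ with $x^0_1=0$: $x_1u\,\partial_1u\to0$ as $x\to x^0$, $x\in\Omega\cap\{u>0\}\cap\{x_1>0\}$, and $u\,\frac{\partial_1u}{x_1}\to0$ as $x\to x^0$, $x\in\Omega\cap\{u<0\}\cap\{x_1>0\}$. (iv) For every $\phi\in C^1_0(\Omega,\mathbb R^n)$ ($C^1$ up to $\{x_1=0\}$, with compact support in $\Omega$) such that $\phi_1=0$ on $\{x_1=0\}$, $$\int_{\Omega}\Big[\Big( x_1|\nabla u^+|^2+\frac{1}{x_1}|\nabla u^-|^2\Big)\mathrm{div}\,\phi - 2x_1\nabla u^+D\phi\nabla u^+ -\frac{2}{x_1}\nabla u^- D\phi\nabla u^- +\Big( |\nabla u^+|^2 - \frac{1}{x_1^2}|\nabla u^-|^2\Big)\phi_1\Big]dx=0 .$$ \textbf{Theorem (Weiss-type monotonicity formula).} Let $u$ be a variational solution in $\Omega$, let $x^0\in\Omega$ with $x^0_1=0$, let $\delta=\mathrm{dist}(x^0,\partial\Omega)/2$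 ($=\infty$ if $\partial\Omega=\emptyset$), and let $\beta>0$. For $r\in(0,\delta)$ set $$I(r)=\int_{B_r^+(x^0)}\Big(x_1|\nabla u^+|^2+\frac1{x_1}|\nabla u^-|^2\Big)dx,\quad J_+(r)=\int_{\partial B_r^+(x^0)}x_1(u^+)^2dS,\quad J_-(r)=\int_{\partial B_r^+(x^0)}\frac1{x_1}(u^-)^2dS,$$ $$M(r)=r^{-2\beta-n+1}I(r)-\beta r^{-2\beta-n}J_+(r)-(\beta+1)r^{-2\beta-n}J_-(r).$$ Then $J_\pm(r)$ are finite for every $r\in(0,\delta)$, and for a.e. $r\in(0,\delta)$ the function $M$ is differentiable at $r$ with $$M'(r)=2r^{-2\beta-n+1}\int_{\partial B_r^+(x^0)}\Big[x_1\Big(\langle\nabla u^+,\nu\rangle-\frac{\beta}{r}u^+\Big)^2+\frac1{x_1}\Big(\langle\nabla u^-,\nu\rangle-\frac{\beta+1}{r}u^-\Big)^2\Big]dS,$$ where the integral on the right is finite. In particular, $M$ is nondecreasing on $(0,\delta)$. -/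

import Mathlib

open MeasureTheory Set Filter Topology
open scoped ENNReal ContDiff RealInnerProductSpace

noncomputable section

namespace AxisFB

/-- `ℝⁿ` with the Euclidean norm. The distinguished first coordinate `x₁` is `x 0`. -/
abbrev Eu (n : ℕ) := EuclideanSpace ℝ (Fin n)

variable {n : ℕ}

/-! ### Half-spaces and domains -/

/-- The closed half-space `{x₁ ≥ 0}`. -/
def closedHalf (n : ℕ) [NeZero n] : Set (Eu n) := {x | 0 ≤ x 0}

/-- The open half-space `ℝⁿ₊ = {x₁ > 0}`. -/
def openHalf (n : ℕ) [NeZero n] : Set (Eu n) := {x | 0 < x 0}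

/-- `Ω` is a connected, relatively open subset of the closed half-space `{x₁ ≥ 0}`. -/
structure IsHalfSpaceDomain [NeZero n] (Ω : Set (Eu n)) : Prop where
  relOpen : ∃ O : Set (Eu n), IsOpen O ∧ Ω = O ∩ closedHalf n
  connected : IsConnected Ω

/-- The part of `Ω` off the axis, `Ω ∩ {x₁ > 0}`. -/
def offAxis [NeZero n] (Ω : Set (Eu n)) : Set (Eu n) := Ω ∩ openHalf n

/-- The boundary of `Ω` relative to the closed half-space `{x₁ ≥ 0}`
(points of `Ω` on `{x₁ = 0}` do not belong to it if `Ω` is relatively open). -/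
def relBoundary [NeZero n] (Ω : Set (Eu n)) : Set (Eu n) :=
  closure Ω ∩ closure (closedHalf n \ Ω)

/-- `δ = dist(x⁰, ∂Ω) / 2`, which is `∞` if the (relative) boundary is empty. -/
def delta [NeZero n] (Ω : Set (Eu n)) (x₀ : Eu n) : ℝ≥0∞ :=
  Metric.infEDist x₀ (relBoundary Ω) / 2

/-- The interval `(0, δ)` of admissible radii. -/
def radii [NeZero n] (Ω : Set (Eu n)) (x₀ : Eu n) : Set ℝ :=
  {r | 0 < r ∧ ENNReal.ofReal r < delta Ω x₀}

/-- `B⁺_r(x⁰) = {x : x₁ > 0, |x - x⁰| < r}`. -/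
def halfBall [NeZero n] (x₀ : Eu n) (r : ℝ) : Set (Eu n) :=
  Metric.ball x₀ r ∩ openHalf n

/-- Surface measure `dS` on the sphere `∂B_r(x⁰)`, as a measure on `ℝⁿ`: the surface measure of
the unit sphere, transported by `y ↦ x⁰ + r y` and scaled by `r^(n-1)`. The integral over
`∂B⁺_r(x⁰)` is the integral over `{x₁ > 0}` with respect to it. -/
def sphereMeasure (x₀ : Eu n) (r : ℝ) : Measure (Eu n) :=
  ENNReal.ofReal (r ^ (n - 1)) •
    (volume : Measure (Eu n)).toSphere.map
      (fun y : Metric.sphere (0 : Eu n) 1 => x₀ + r • (y : Eu n))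

/-! ### Weak gradients and function spaces -/

/-- `G` is a weak gradient of `v` on the open set `U`. -/
structure HasWeakGrad (U : Set (Eu n)) (v : Eu n → ℝ) (G : Eu n → Eu n) : Prop where
  locInt : LocallyIntegrableOn v U
  locInt_grad : LocallyIntegrableOn G U
  integral_eq : ∀ ψ : Eu n → ℝ, ContDiff ℝ ∞ ψ → HasCompactSupport ψ → tsupport ψ ⊆ U →
    ∀ i : Fin n, ∫ x in U, v x * fderiv ℝ ψ x (EuclideanSpace.single i 1)
      = - ∫ x in U, G x i * ψ x

open Classical in
/-- The weak gradient `∇v` on `U` (a representative; it is unique up to null sets of `U`). -/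
def weakGrad (U : Set (Eu n)) (v : Eu n → ℝ) : Eu n → Eu n :=
  if h : ∃ G, HasWeakGrad U v G then h.choose else 0

theorem weakGrad_spec {U : Set (Eu n)} {v : Eu n → ℝ} (h : ∃ G, HasWeakGrad U v G) :
    HasWeakGrad U v (weakGrad U v) := by
  rw [weakGrad, dif_pos h]
  exact h.choose_spec

/-- `v⁺ = max(v, 0)`. -/
def pos (v : Eu n → ℝ) : Eu n → ℝ := fun x => max (v x) 0

/-- `v⁻ = min(v, 0)` (note the sign convention: `v = v⁺ + v⁻`). -/
def neg (v : Eu n → ℝ) : Eu n → ℝ := fun x => min (v x) 0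

/-- `v ∈ W^{1,2}(U)`. -/
def MemW12 (U : Set (Eu n)) (v : Eu n → ℝ) : Prop :=
  MemLp v 2 (volume.restrict U) ∧
    ∃ G, HasWeakGrad U v G ∧ MemLp G 2 (volume.restrict U)

/-- `v ∈ V^{1,2}(U)`: `v ∈ W^{1,2}(U)` and
`∫_U x₁ |∇v⁺|² + |∇v⁻|² / x₁ < ∞`, `∫_U x₁ (v⁺)² + (v⁻)² / x₁ < ∞`. -/
structure MemV12 [NeZero n] (U : Set (Eu n)) (v : Eu n → ℝ) : Prop where
  memW12 : MemW12 U v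
  grad_integrable : IntegrableOn
    (fun x => x 0 * ‖weakGrad U (pos v) x‖ ^ 2 + 1 / x 0 * ‖weakGrad U (neg v) x‖ ^ 2) U
  integrable : IntegrableOn (fun x => x 0 * pos v x ^ 2 + 1 / x 0 * neg v x ^ 2) U

/-! ### Variational solutions -/

/-- The divergence of a vector field. -/
def diverg (φ : Eu n → Eu n) (x : Eu n) : ℝ :=
  ∑ i : Fin n, fderiv ℝ φ x (EuclideanSpace.single i 1) i

/-- The first classical partial derivative `∂₁u`. -/
def partialOne [NeZero n] (u : Eu n → ℝ) (x : Eu n) : ℝ :=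
  fderiv ℝ u x (EuclideanSpace.single 0 1)

/-- Admissible domain variations: `φ ∈ C¹₀(Ω, ℝⁿ)` (`C¹` up to `{x₁ = 0}`, compactly supported in
the relatively open set `Ω`) with `φ₁ = 0` on `{x₁ = 0}`. -/
structure IsVariation [NeZero n] (Ω : Set (Eu n)) (φ : Eu n → Eu n) : Prop where
  contDiff : ContDiff ℝ 1 φ
  compact : HasCompactSupport φ
  supp : tsupport φ ∩ closedHalf n ⊆ Ω
  tangential : ∀ x : Eu n, x 0 = 0 → φ x 0 = 0

/-- The integrand of the first domain variation, in direction `φ`, of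
`E(v) = ∫_Ω x₁ |∇v⁺|² + |∇v⁻|² / x₁`, with `P = ∇u⁺` and `N = ∇u⁻`. -/
def variationIntegrand [NeZero n] (P N : Eu n → Eu n) (φ : Eu n → Eu n) (x : Eu n) : ℝ :=
  (x 0 * ‖P x‖ ^ 2 + 1 / x 0 * ‖N x‖ ^ 2) * diverg φ x
    - 2 * x 0 * ⟪P x, fderiv ℝ φ x (P x)⟫
    - 2 / x 0 * ⟪N x, fderiv ℝ φ x (N x)⟫
    + (‖P x‖ ^ 2 - 1 / x 0 ^ 2 * ‖N x‖ ^ 2) * φ x 0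

/-- `u` is a variational solution in `Ω` of the two-phase problem
`div (x₁ ∇u) = 0` in `{u > 0}`, `div (x₁⁻¹ ∇u) = 0` in `{u < 0}`,
`x₁ |∇u⁺|² = x₁⁻¹ |∇u⁻|²` on `∂{u > 0}`. -/
structure IsVariationalSolution [NeZero n] (Ω : Set (Eu n)) (u : Eu n → ℝ) : Prop where
  memV12 : MemV12 (offAxis Ω) u
  continuousOn : ContinuousOn u (offAxis Ω)
  contDiffOn : ContDiffOn ℝ 2 u (offAxis Ω ∩ {x | u x ≠ 0})
  axis_pos : ∀ x₀ ∈ Ω, x₀ 0 = 0 →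
    Tendsto (fun x => x 0 * u x * partialOne u x) (𝓝[offAxis Ω ∩ {x | 0 < u x}] x₀) (𝓝 0)
  axis_neg : ∀ x₀ ∈ Ω, x₀ 0 = 0 →
    Tendsto (fun x => u x * (partialOne u x / x 0)) (𝓝[offAxis Ω ∩ {x | u x < 0}] x₀) (𝓝 0)
  stationary : ∀ φ : Eu n → Eu n, IsVariation Ω φ →
    ∫ x in offAxis Ω, variationIntegrand
      (weakGrad (offAxis Ω) (pos u)) (weakGrad (offAxis Ω) (neg u)) φ x = 0

/-! ### The quantities in the monotonicity formula -/

/-- `I(r) = ∫_{B⁺_r(x⁰)} x₁ |∇u⁺|² + |∇u⁻|² / x₁ dx`. -/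
def energyI [NeZero n] (Ω : Set (Eu n)) (u : Eu n → ℝ) (x₀ : Eu n) (r : ℝ) : ℝ :=
  ∫ x in halfBall x₀ r, (x 0 * ‖weakGrad (offAxis Ω) (pos u) x‖ ^ 2
    + 1 / x 0 * ‖weakGrad (offAxis Ω) (neg u) x‖ ^ 2)

/-- `J₊(r) = ∫_{∂B⁺_r(x⁰)} x₁ (u⁺)² dS`. -/
def Jpos [NeZero n] (u : Eu n → ℝ) (x₀ : Eu n) (r : ℝ) : ℝ :=
  ∫ x in openHalf n, x 0 * pos u x ^ 2 ∂(sphereMeasure x₀ r)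

/-- `J₋(r) = ∫_{∂B⁺_r(x⁰)} (u⁻)² / x₁ dS`. -/
def Jneg [NeZero n] (u : Eu n → ℝ) (x₀ : Eu n) (r : ℝ) : ℝ :=
  ∫ x in openHalf n, 1 / x 0 * neg u x ^ 2 ∂(sphereMeasure x₀ r)

/-- `M(r) = r^{-2β-n+1} I(r) - β r^{-2β-n} J₊(r) - (β+1) r^{-2β-n} J₋(r)`. -/
def weissM [NeZero n] (Ω : Set (Eu n)) (u : Eu n → ℝ) (x₀ : Eu n) (β r : ℝ) : ℝ :=
  r ^ (-2 * β - (n : ℝ) + 1) * energyI Ω u x₀ r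
    - β * r ^ (-2 * β - (n : ℝ)) * Jpos u x₀ r
    - (β + 1) * r ^ (-2 * β - (n : ℝ)) * Jneg u x₀ r

/-- The outer unit normal `ν` of `B_r(x⁰)` at a point `x` of its boundary. -/
def normal (x₀ : Eu n) (r : ℝ) (x : Eu n) : Eu n := r⁻¹ • (x - x₀)

/-- `x₁ (⟨∇u⁺, ν⟩ - (β/r) u⁺)² + (1/x₁) (⟨∇u⁻, ν⟩ - ((β+1)/r) u⁻)²`. -/
def weissIntegrand [NeZero n] (Ω : Set (Eu n)) (u : Eu n → ℝ) (x₀ : Eu n) (β r : ℝ)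
    (x : Eu n) : ℝ :=
  x 0 * (⟪weakGrad (offAxis Ω) (pos u) x, normal x₀ r x⟫ - β / r * pos u x) ^ 2
    + 1 / x 0 * (⟪weakGrad (offAxis Ω) (neg u) x, normal x₀ r x⟫ - (β + 1) / r * neg u x) ^ 2

end AxisFB

end

noncomputable section

namespace AxisFB

variable {n : ℕ}

/-! ### Polar coordinates -/

/-! Each phase `v` (`u⁺` with weight exponent `σ = 1`, `-u⁻` with `σ = -1`) enters `M` through its
energy `I_σ`, its boundary mass `J_σ`, and a degree `b_σ = β + (1 - σ)/2`, that is `β` or `β + 1`.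
Write `ν` for the radial direction and `∫∂` for integrals over the half-sphere of radius `r`. Three
identities carry the formula.

Energy: `I_σ = ∫∂ x₁^σ v ∂_ν v`, because `div (x₁^σ ∇v) = 0` in the phase
(`IsPhase.ae_bulk_gradDen`). Mass: `r J_σ` is the integral over the half-ball of `div (x₁^σ v² (x -
x₀))`, so `r J_σ' = (n + σ - 1) J_σ + 2r ∫∂ x₁^σ v ∂_ν v` for a.e. `r` (`IsPhase.bulk_massDen`).
Rellich: summed over both phases, `r I' = Σ (n - 2 + σ) I_σ + 2r Σ ∫∂ x₁^σ (∂_ν v)²`. It is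
stationarity under the radial field `Z(|x - x₀|)(x - x₀)`, admissible because `x₀` lies on the axis
(`IsVariationalSolution.ae_rellich`).

Since `-2β - n + 1 + (n - 2 + σ) = -2 b_σ` and `-2β - n + (n + σ - 1) = -2 b_σ`, inserting these in
`M'` leaves `2 r^(-2β-n+1) Σ ∫∂ x₁^σ (∂_ν v - (b_σ/r) v)²`.

The identities are proved weakly: testing with all radial functions whose derivative is `g(|x -
x₀|)` gives an equality of bulk and surface integrals for a.e. radius (`ae_bulk_eq_surf`). Three
difficulties remain. The equation in each phase is not assumed; it is extracted from stationarity
(`wlap_eq_zero_of_stationary`). The free boundary has no regularity; it is crossed by replacing `v`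
with truncations that vanish where `v` is small. At the axis a cutoff layer of width `1/k` costs a
factor `k` on a volume of order `1/k`, so its contribution vanishes as soon as the normal component
of the field tends to `0` (`integral_divergence`). For the energy identity this is condition (iii);
for the mass identity it follows once `x₁^σ v²` is bounded near the axis (`bounded_near_axis_one`,
`sq_le_sq_near_axis`). That bound also makes `J±` finite and continuous at every radius. Hence `M`
is built from powers and bulk integrals, so it is locally absolutely continuous, and `M' ≥ 0` a.e.
gives monotonicity. -/

theorem measurableEmbedding_sphereMap (x₀ : Eu n) {r : ℝ} (hr : r ≠ 0) :
    MeasurableEmbedding (fun y : Metric.sphere (0 : Eu n) 1 => x₀ + r • (y : Eu n)) := by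
  refine Continuous.measurableEmbedding (by fun_prop) ?_
  intro a b hab
  have : r • (a : Eu n) = r • (b : Eu n) := add_left_cancel hab
  exact Subtype.ext (smul_right_injective _ hr this)

theorem integrable_sphereMeasure_iff (x₀ : Eu n) {r : ℝ} (hr : 0 < r) (f : Eu n → ℝ) :
    Integrable f (sphereMeasure x₀ r) ↔
      Integrable (fun y : Metric.sphere (0 : Eu n) 1 => f (x₀ + r • (y : Eu n)))
        (volume : Measure (Eu n)).toSphere := by
  rw [sphereMeasure, integrable_smul_measure (by positivity) ENNReal.ofReal_ne_top,
    (measurableEmbedding_sphereMap x₀ hr.ne').integrable_map_iff]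
  rfl

theorem integral_sphereMeasure (x₀ : Eu n) {r : ℝ} (hr : 0 < r) (f : Eu n → ℝ) :
    ∫ x, f x ∂(sphereMeasure x₀ r) = r ^ (n - 1) *
      ∫ y : Metric.sphere (0 : Eu n) 1, f (x₀ + r • (y : Eu n))
        ∂(volume : Measure (Eu n)).toSphere := by
  rw [sphereMeasure, integral_smul_measure,
    (measurableEmbedding_sphereMap x₀ hr.ne').integral_map, ENNReal.toReal_ofReal (by positivity),
    smul_eq_mul]

/-- Off the origin, Lebesgue measure is the product of the unit-sphere measure and `r^(n-1) dr`, so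
this is Fubini after translation by `x₀`. The factor `r^(n-1)` is the one built into
`sphereMeasure`. -/
theorem polar_coordinates [NeZero n] (x₀ : Eu n) {f : Eu n → ℝ} (hf : Integrable f) :
    (∀ᵐ r : ℝ, 0 < r → Integrable f (sphereMeasure x₀ r)) ∧
    IntegrableOn (fun r => ∫ x, f x ∂(sphereMeasure x₀ r)) (Ioi 0) ∧
    ∫ x, f x = ∫ r in Ioi 0, ∫ x, f x ∂(sphereMeasure x₀ r) := by
  have hmp := (volume : Measure (Eu n)).measurePreserving_homeomorphUnitSphereProd
  have hemb := Homeomorph.measurableEmbedding (homeomorphUnitSphereProd (Eu n))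
  have hdim : Module.finrank ℝ (Eu n) = n := by simp
  rw [hdim] at hmp
  set G : Metric.sphere (0 : Eu n) 1 × Ioi (0 : ℝ) → ℝ := fun p => f (x₀ + p.2.1 • (p.1 : Eu n))
    with hG
  have hGc : ∀ z : ({0}ᶜ : Set (Eu n)), G (homeomorphUnitSphereProd (Eu n) z) = f (x₀ + z) := by
    rintro ⟨z, hz⟩
    have : ‖z‖ ≠ 0 := norm_ne_zero_iff.2 hz
    simp [hG, homeomorphUnitSphereProd, smul_smul, this]
  have hf' : Integrable (fun z => f (x₀ + z)) := hf.comp_add_left x₀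
  have hfs : Integrable (fun z : ({0}ᶜ : Set (Eu n)) => f (x₀ + z))
      (Measure.comap (↑) (volume : Measure (Eu n))) := by
    have h1 : IntegrableOn (fun z => f (x₀ + z)) ({0}ᶜ : Set (Eu n)) := hf'.integrableOn
    exact (integrableOn_iff_comap_subtypeVal (measurableSet_singleton _).compl).1 h1
  have hGint : Integrable G ((volume : Measure (Eu n)).toSphere.prod
      (Measure.volumeIoiPow (n - 1))) := by
    rw [← hmp.integrable_comp_emb hemb]
    exact hfs.congr (Eventually.of_forall fun z => (hGc z).symm)
  have hmeas : Measurable (fun r : Ioi (0 : ℝ) => ENNReal.ofReal (r.1 ^ (n - 1))) := by fun_prop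
  have hval : ∫ x, f x = ∫ p, G p ∂((volume : Measure (Eu n)).toSphere.prod
      (Measure.volumeIoiPow (n - 1))) := by
    rw [← hmp.integral_comp hemb, ← integral_add_left_eq_self _ x₀]
    trans ∫ z in ({0}ᶜ : Set (Eu n)), f (x₀ + z)
    · rw [restrict_compl_singleton]
    rw [← integral_subtype_comap (measurableSet_singleton _).compl]
    exact integral_congr_ae (Eventually.of_forall fun z => (hGc z).symm)
  have hae : ∀ᵐ r ∂(Measure.volumeIoiPow (n - 1)),
      Integrable (fun y => G (y, r)) (volume : Measure (Eu n)).toSphere := hGint.prod_left_ae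
  have hr1 : ∀ r : Ioi (0 : ℝ), (ENNReal.ofReal (r.1 ^ (n - 1))).toReal = r.1 ^ (n - 1) :=
    fun r => ENNReal.toReal_ofReal (pow_nonneg r.2.out.le _)
  have hS : ∀ r : Ioi (0 : ℝ), r.1 ^ (n - 1) * ∫ y, G (y, r) ∂(volume : Measure (Eu n)).toSphere
      = ∫ x, f x ∂(sphereMeasure x₀ r.1) := fun r =>
    (integral_sphereMeasure x₀ r.2 f).symm
  have hfin : ∀ᵐ r : Ioi (0 : ℝ) ∂(Measure.comap Subtype.val volume),
      ENNReal.ofReal (r.1 ^ (n - 1)) < ⊤ := Eventually.of_forall fun _ => ENNReal.ofReal_lt_top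
  refine ⟨?_, ?_, ?_⟩
  -- The density `r^(n-1)` is nonzero on the open half-line, so a null set for `r^(n-1) dr` is
  -- Lebesgue null there.
  · rw [Measure.volumeIoiPow, ae_withDensity_iff hmeas] at hae
    refine (ae_restrict_iff' (measurableSet_Ioi (a := (0 : ℝ)))).1 ?_
    rw [ae_restrict_iff_subtype measurableSet_Ioi]
    filter_upwards [hae] with r hr
    rw [integrable_sphereMeasure_iff x₀ r.2]
    refine hr ?_
    have : 0 < r.1 := r.2
    positivity
  · have h2 := hGint.integral_prod_right
    rw [Measure.volumeIoiPow, integrable_withDensity_iff_integrable_smul' hmeas hfin] at h2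
    rw [integrableOn_iff_comap_subtypeVal measurableSet_Ioi]
    refine h2.congr (Eventually.of_forall fun r => ?_)
    simp only [Function.comp, hr1, smul_eq_mul, hS]
  · rw [hval, integral_prod_symm _ hGint, Measure.volumeIoiPow,
      integral_withDensity_eq_integral_toReal_smul₀ hmeas.aemeasurable hfin,
      ← integral_subtype_comap measurableSet_Ioi]
    refine integral_congr_ae (Eventually.of_forall fun r => ?_)
    simp only [hr1, smul_eq_mul, hS]

/-! ### Half-balls, half-spheres, and bulk integrals as functions of the radius -/

theorem measurableSet_openHalf [NeZero n] : MeasurableSet (openHalf n) :=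
  measurableSet_lt measurable_const (by fun_prop)

theorem isOpen_openHalf [NeZero n] : IsOpen (openHalf n) :=
  isOpen_lt continuous_const (by fun_prop)

theorem measurableSet_halfBall [NeZero n] (x₀ : Eu n) (r : ℝ) : MeasurableSet (halfBall x₀ r) :=
  Metric.isOpen_ball.measurableSet.inter measurableSet_openHalf

theorem halfBall_mono [NeZero n] (x₀ : Eu n) {r s : ℝ} (h : r ≤ s) :
    halfBall x₀ r ⊆ halfBall x₀ s :=
  inter_subset_inter_left _ (Metric.ball_subset_ball h)

theorem ae_norm_eq_sphereMeasure (x₀ : Eu n) {r : ℝ} (hr : 0 < r) :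
    ∀ᵐ x ∂(sphereMeasure x₀ r), ‖x - x₀‖ = r := by
  refine Measure.ae_smul_measure ?_ _
  rw [(measurableEmbedding_sphereMap x₀ hr.ne').ae_map_iff]
  refine Eventually.of_forall fun y => ?_
  simp [norm_smul, abs_of_pos hr]

/-- The surface integral of `f` over `∂B⁺_r(x₀)`. -/
def surf [NeZero n] (x₀ : Eu n) (f : Eu n → ℝ) (r : ℝ) : ℝ :=
  ∫ x in openHalf n, f x ∂(sphereMeasure x₀ r)

/-- The volume integral of `f` over `B⁺_r(x₀)`. -/
def bulk [NeZero n] (x₀ : Eu n) (f : Eu n → ℝ) (r : ℝ) : ℝ :=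
  ∫ x in halfBall x₀ r, f x

theorem indicator_halfBall_ae_of_lt [NeZero n] (x₀ : Eu n) (f : Eu n → ℝ) {r R : ℝ}
    (hr : 0 < r) (hR : r < R) :
    (halfBall x₀ R).indicator f =ᵐ[sphereMeasure x₀ r] (openHalf n).indicator f := by
  filter_upwards [ae_norm_eq_sphereMeasure x₀ hr] with x hx
  have : x ∈ Metric.ball x₀ R := by rw [mem_ball_iff_norm, hx]; exact hR
  by_cases h : x ∈ openHalf n <;> simp [indicator, halfBall, h, this]

theorem integral_indicator_halfBall [NeZero n] (x₀ : Eu n) (f : Eu n → ℝ) {r R : ℝ}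
    (hr : 0 < r) :
    ∫ x, (halfBall x₀ R).indicator f x ∂(sphereMeasure x₀ r) =
      (Iio R).indicator (surf x₀ f) r := by
  by_cases hR : r < R
  · rw [integral_congr_ae (indicator_halfBall_ae_of_lt x₀ f hr hR),
      integral_indicator measurableSet_openHalf]
    simp [indicator, hR, surf]
  · have : (halfBall x₀ R).indicator f =ᵐ[sphereMeasure x₀ r] 0 := by
      filter_upwards [ae_norm_eq_sphereMeasure x₀ hr] with x hx
      have : x ∉ Metric.ball x₀ R := by rw [mem_ball_iff_norm, hx]; exact hR
      simp [indicator, halfBall, this]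
    rw [integral_congr_ae this]
    simp [indicator, hR]

theorem half_polar_coordinates [NeZero n] (x₀ : Eu n) {f : Eu n → ℝ} {R : ℝ}
    (hf : IntegrableOn f (halfBall x₀ R)) :
    (∀ᵐ r : ℝ, r ∈ Ioo 0 R → IntegrableOn f (openHalf n) (sphereMeasure x₀ r)) ∧
    IntegrableOn (surf x₀ f) (Ioo 0 R) ∧ bulk x₀ f R = ∫ r in Ioo 0 R, surf x₀ f r := by
  have hg : Integrable ((halfBall x₀ R).indicator f) :=
    (integrable_indicator_iff (measurableSet_halfBall x₀ R)).2 hf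
  obtain ⟨h1, h2, h3⟩ := polar_coordinates x₀ hg
  refine ⟨?_, ?_, ?_⟩
  · filter_upwards [h1] with r hr hrR
    have := (hr hrR.1).congr (indicator_halfBall_ae_of_lt x₀ f hrR.1 hrR.2)
    exact (integrable_indicator_iff measurableSet_openHalf).1 this
  · refine (h2.mono_set Ioo_subset_Ioi_self).congr_fun (fun r hr => ?_) measurableSet_Ioo
    simp only [integral_indicator_halfBall x₀ f hr.1]
    exact indicator_of_mem (show r ∈ Iio R from hr.2) _
  · rw [bulk, ← integral_indicator (measurableSet_halfBall x₀ R), h3,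
      setIntegral_congr_fun measurableSet_Ioi
        (fun r hr => integral_indicator_halfBall x₀ f (R := R) hr),
      setIntegral_indicator measurableSet_Iio]
    rfl

theorem bulk_eq_intervalIntegral [NeZero n] (x₀ : Eu n) {f : Eu n → ℝ} {r : ℝ} (hr : 0 ≤ r)
    (hf : IntegrableOn f (halfBall x₀ r)) : bulk x₀ f r = ∫ t in (0 : ℝ)..r, surf x₀ f t := by
  rw [(half_polar_coordinates x₀ hf).2.2, intervalIntegral.integral_of_le hr,
    integral_Ioc_eq_integral_Ioo]

theorem intervalIntegrable_surf [NeZero n] (x₀ : Eu n) {f : Eu n → ℝ} {r : ℝ} (hr : 0 ≤ r)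
    (hf : IntegrableOn f (halfBall x₀ r)) : IntervalIntegrable (surf x₀ f) volume 0 r := by
  rw [intervalIntegrable_iff_integrableOn_Ioo_of_le hr]
  exact (half_polar_coordinates x₀ hf).2.1

theorem ae_hasDerivAt_bulk [NeZero n] (x₀ : Eu n) {f : Eu n → ℝ} {R : ℝ}
    (hf : IntegrableOn f (halfBall x₀ R)) :
    ∀ᵐ r : ℝ, r ∈ Ioo 0 R → HasDerivAt (bulk x₀ f) (surf x₀ f r) r := by
  rcases le_or_gt R 0 with hR | hR
  · simp [Ioo_eq_empty_of_le hR]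
  filter_upwards [(intervalIntegrable_surf x₀ hR.le hf).ae_hasDerivAt_integral] with r h hr
  rw [uIcc_of_le hR.le] at h
  refine (h ⟨hr.1.le, hr.2.le⟩ 0 ⟨le_rfl, hR.le⟩).congr_of_eventuallyEq ?_
  filter_upwards [Ioo_mem_nhds hr.1 hr.2] with t ht
  exact bulk_eq_intervalIntegral x₀ ht.1.le (hf.mono_set (halfBall_mono x₀ ht.2.le))

theorem absolutelyContinuousOnInterval_congr {f g : ℝ → ℝ} {a b : ℝ}
    (hf : AbsolutelyContinuousOnInterval f a b) (h : EqOn f g (uIcc a b)) :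
    AbsolutelyContinuousOnInterval g a b := by
  rw [absolutelyContinuousOnInterval_iff] at hf ⊢
  intro ε hε
  obtain ⟨d, hd, H⟩ := hf ε hε
  refine ⟨d, hd, fun E hE hlt => ?_⟩
  convert H E hE hlt using 1
  refine Finset.sum_congr rfl fun i hi => ?_
  have := hE.1 i hi
  rw [h this.1, h this.2]

theorem absolutelyContinuousOnInterval_bulk [NeZero n] (x₀ : Eu n) {f : Eu n → ℝ} {a b : ℝ}
    (ha : 0 < a) (hab : a ≤ b) (hf : IntegrableOn f (halfBall x₀ b)) :
    AbsolutelyContinuousOnInterval (bulk x₀ f) a b := by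
  have hb : 0 ≤ b := ha.le.trans hab
  have h := (intervalIntegrable_surf x₀ hb hf).absolutelyContinuousOnInterval_intervalIntegral
    (c := 0) left_mem_uIcc
  have hsub : uIcc a b ⊆ uIcc 0 b := by
    rw [uIcc_of_le hab, uIcc_of_le hb]
    exact Icc_subset_Icc_left ha.le
  refine absolutelyContinuousOnInterval_congr (h.mono hsub) fun t ht => ?_
  rw [uIcc_of_le hab] at ht
  exact (bulk_eq_intervalIntegral x₀ (ha.le.trans ht.1)
    (hf.mono_set (halfBall_mono x₀ ht.2))).symm

/-! ### Admissible radii -/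

section radii

variable [NeZero n] {Ω : Set (Eu n)} {x₀ : Eu n}

theorem radii_of_le {r R : ℝ} (hR : R ∈ radii Ω x₀) (hr : 0 < r) (h : r ≤ R) : r ∈ radii Ω x₀ :=
  ⟨hr, (ENNReal.ofReal_le_ofReal h).trans_lt hR.2⟩

theorem isOpen_radii : IsOpen (radii Ω x₀) :=
  (isOpen_lt continuous_const continuous_id).inter
    (isOpen_lt ENNReal.continuous_ofReal continuous_const)

theorem exists_rat_radii {r : ℝ} (hr : r ∈ radii Ω x₀) :
    ∃ q : ℚ, (q : ℝ) ∈ radii Ω x₀ ∧ r < q := by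
  obtain ⟨ε, hε, h⟩ := Metric.isOpen_iff.1 isOpen_radii r hr
  obtain ⟨q, hq1, hq2⟩ := exists_rat_btwn (show r < r + ε by linarith)
  exact ⟨q, h (by rw [Metric.mem_ball, Real.dist_eq, abs_of_pos (by linarith)]; linarith), hq1⟩

theorem exists_radii_gt {r : ℝ} (hr : r ∈ radii Ω x₀) : ∃ R ∈ radii Ω x₀, r < R := by
  obtain ⟨q, h1, h2⟩ := exists_rat_radii hr
  exact ⟨q, h1, h2⟩

/-- The exceptional set may depend on `R`; rational `R` already exhaust the admissible radii, which
leaves a countable union of null sets. -/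
theorem ae_radii_of_forall_Ioo {p : ℝ → Prop}
    (h : ∀ R ∈ radii Ω x₀, ∀ᵐ r : ℝ, r ∈ Ioo 0 R → p r) :
    ∀ᵐ r : ℝ, r ∈ radii Ω x₀ → p r := by
  have h1 : ∀ q : ℚ, ∀ᵐ r : ℝ, (q : ℝ) ∈ radii Ω x₀ → r ∈ Ioo (0 : ℝ) q → p r := fun q => by
    by_cases hq : (q : ℝ) ∈ radii Ω x₀
    · simpa [hq] using h q hq
    · simp [hq]
  filter_upwards [ae_all_iff.2 h1] with r hr hrr
  obtain ⟨q, hq, hlt⟩ := exists_rat_radii hrr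
  exact hr q hq ⟨hrr.1, hlt⟩

/-- The truncated ball is convex, hence connected. If it contained a point outside `Ω`, the closures
of `Ω` and of its relative complement would be two closed sets covering it and both meeting it, so
it would contain a relative boundary point. Such a point lies within `r` of `x₀`, contradicting `r <
δ`. -/
theorem closedBall_inter_closedHalf_subset (hΩ : IsHalfSpaceDomain Ω) (hx₀ : x₀ ∈ Ω) {r : ℝ}
    (hr : r ∈ radii Ω x₀) : Metric.closedBall x₀ r ∩ closedHalf n ⊆ Ω := by
  obtain ⟨O, hO, rfl⟩ := hΩ.relOpen
  by_contra hsub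
  obtain ⟨z, ⟨hz1, hz2⟩, hz3⟩ := not_subset.1 hsub
  have hconv : Convex ℝ (Metric.closedBall x₀ r ∩ closedHalf n) :=
    (convex_closedBall x₀ r).inter <| by
      intro a ha b hb s t hs ht _
      simp only [closedHalf, mem_ofPred_eq, PiLp.add_apply, PiLp.smul_apply, smul_eq_mul] at *
      positivity
  have hx : x₀ ∈ Metric.closedBall x₀ r ∩ closedHalf n :=
    ⟨Metric.mem_closedBall_self hr.1.le, hx₀.2⟩
  have hnc : ¬ Disjoint (relBoundary (O ∩ closedHalf n)) (Metric.closedBall x₀ r) := by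
    intro hd
    have hcl : IsClosed (closedHalf n) := isClosed_le continuous_const (by fun_prop)
    have hpre := hconv.isPreconnected
    rw [isPreconnected_closed_iff] at hpre
    have := hpre (closure (O ∩ closedHalf n)) (closure (closedHalf n \ (O ∩ closedHalf n)))
      isClosed_closure isClosed_closure (fun y hy => by
        by_cases hyO : y ∈ O ∩ closedHalf n
        · exact Or.inl (subset_closure hyO)
        · exact Or.inr (subset_closure ⟨hy.2, hyO⟩))
      ⟨x₀, hx, subset_closure hx₀⟩ ⟨z, ⟨hz1, hz2⟩, subset_closure ⟨hz2, hz3⟩⟩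
    obtain ⟨y, hy1, hy2⟩ := this
    exact disjoint_left.1 hd hy2 hy1.1
  obtain ⟨y, hy1, hy2⟩ := not_disjoint_iff.1 hnc
  have h1 : Metric.infEDist x₀ (relBoundary (O ∩ closedHalf n)) ≤ ENNReal.ofReal r :=
    (Metric.infEDist_le_edist_of_mem hy1).trans (by
      rw [edist_dist, dist_comm]; exact ENNReal.ofReal_le_ofReal hy2)
  have h2 : delta (O ∩ closedHalf n) x₀ ≤ ENNReal.ofReal r :=
    ENNReal.half_le_self.trans h1
  exact absurd hr.2 (not_lt.2 h2)

theorem isOpen_offAxis (hΩ : IsHalfSpaceDomain Ω) : IsOpen (offAxis Ω) := by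
  obtain ⟨O, hO, rfl⟩ := hΩ.relOpen
  have : offAxis (O ∩ closedHalf n) = O ∩ openHalf n := by
    ext x
    simp only [offAxis, closedHalf, openHalf, mem_inter_iff, mem_ofPred_eq]
    exact ⟨fun h => ⟨h.1.1, h.2⟩, fun h => ⟨⟨h.1, h.2.le⟩, h.2⟩⟩
  rw [this]
  exact hO.inter isOpen_openHalf

theorem halfBall_subset_offAxis (hΩ : IsHalfSpaceDomain Ω) (hx₀ : x₀ ∈ Ω) {r : ℝ}
    (hr : r ∈ radii Ω x₀) : halfBall x₀ r ⊆ offAxis Ω := fun x hx =>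
  ⟨closedBall_inter_closedHalf_subset hΩ hx₀ hr ⟨Metric.ball_subset_closedBall hx.1,
    (le_of_lt hx.2 : 0 ≤ x 0)⟩, hx.2⟩

end radii

/-! ### Radial test functions -/

section radial

variable [NeZero n] {Ω : Set (Eu n)} {x₀ : Eu n}

theorem continuousOn_bulk {F : Eu n → ℝ} (hF : ∀ R ∈ radii Ω x₀, IntegrableOn F (halfBall x₀ R)) :
    ContinuousOn (bulk x₀ F) (radii Ω x₀) := by
  intro r hr
  obtain ⟨R, hR, hlt⟩ := exists_radii_gt hr
  have h0 : 0 < r / 2 := half_pos hr.1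
  have h1 : r / 2 ≤ R := by linarith
  have := (absolutelyContinuousOnInterval_bulk x₀ h0 h1 (hF R hR)).continuousOn
  rw [uIcc_of_le h1] at this
  exact (this.continuousAt (Icc_mem_nhds (by linarith) hlt)).continuousWithinAt

theorem locallyIntegrableOn_surf {F : Eu n → ℝ}
    (hF : ∀ R ∈ radii Ω x₀, IntegrableOn F (halfBall x₀ R)) :
    LocallyIntegrableOn (surf x₀ F) (radii Ω x₀) := by
  intro r hr
  obtain ⟨R, hR, hlt⟩ := exists_radii_gt hr
  exact ⟨Ioo 0 R, mem_nhdsWithin_of_mem_nhds (Ioo_mem_nhds hr.1 hlt),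
    (half_polar_coordinates x₀ (hF R hR)).2.1⟩

/-- The primitive of `g` that vanishes at infinity. -/
def tail (g : ℝ → ℝ) (t : ℝ) : ℝ := -∫ s in Ioi t, g s

theorem hasDerivAt_tail {g : ℝ → ℝ} (hg : Continuous g) (hgc : HasCompactSupport g) (t : ℝ) :
    HasDerivAt (tail g) (g t) t := by
  have hgi : Integrable g := hg.integrable_of_hasCompactSupport hgc
  have h : tail g = fun t => (∫ s in (0 : ℝ)..t, g s) + tail g 0 := by
    funext t
    have := intervalIntegral.integral_interval_add_Ioi (a := 0) (b := t)
      hgi.integrableOn hgi.integrableOn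
    simp only [tail]
    linarith
  rw [h]
  exact (intervalIntegral.integral_hasDerivAt_right (hg.intervalIntegrable _ _)
    hg.stronglyMeasurable.stronglyMeasurableAtFilter hg.continuousAt).add_const _

theorem tail_eq_zero {g : ℝ → ℝ} {R t : ℝ} (h : ∀ s, R ≤ s → g s = 0) (ht : R ≤ t) :
    tail g t = 0 := by
  rw [tail, setIntegral_eq_zero_of_forall_eq_zero, neg_zero]
  exact fun s hs => h s (ht.trans (le_of_lt hs))

theorem exists_radii_tsupport {g : ℝ → ℝ} (hgc : HasCompactSupport g)
    (hg : tsupport g ⊆ radii Ω x₀) (hne : (tsupport g).Nonempty) :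
    ∃ R ∈ radii Ω x₀, ∃ ε > 0, ∀ t, g t ≠ 0 → t ∈ Ioo ε R := by
  obtain ⟨m, hm, hmax⟩ := hgc.isCompact.exists_isMaxOn hne continuousOn_id
  obtain ⟨a, ha, hmin⟩ := hgc.isCompact.exists_isMinOn hne continuousOn_id
  obtain ⟨R, hR, hlt⟩ := exists_radii_gt (hg hm)
  refine ⟨R, hR, a / 2, half_pos (hg ha).1, fun t ht => ?_⟩
  have h1 : t ∈ tsupport g := subset_tsupport g ht
  have h2 : t ≤ m := hmax h1
  have h3 : a ≤ t := hmin h1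
  have := (hg ha).1
  exact ⟨by linarith, by linarith⟩

/-- Fubini on `{|x - x₀| < r}`: for fixed `x` the integral of `g` over the radii `r > |x - x₀|` is
`-tail g |x - x₀|`. -/
theorem integral_mul_bulk {F : Eu n → ℝ} {g : ℝ → ℝ} {R : ℝ} (hg : Continuous g)
    (hgc : HasCompactSupport g) (hgR : ∀ t, g t ≠ 0 → t ∈ Ioo 0 R)
    (hF : IntegrableOn F (halfBall x₀ R)) :
    ∫ r, g r * bulk x₀ F r = - ∫ x in halfBall x₀ R, tail g ‖x - x₀‖ * F x := by
  have hgi : Integrable g := hg.integrable_of_hasCompactSupport hgc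
  have hms : MeasurableSet {z : Eu n × ℝ | ‖z.1 - x₀‖ < z.2} :=
    measurableSet_lt (by fun_prop) (by fun_prop)
  have hint : Integrable (Function.uncurry fun (x : Eu n) (r : ℝ) =>
      F x * (Ioi ‖x - x₀‖).indicator g r) ((volume.restrict (halfBall x₀ R)).prod volume) := by
    refine ((Integrable.mul_prod hF hgi).indicator hms).congr (Eventually.of_forall fun z => ?_)
    by_cases h : ‖z.1 - x₀‖ < z.2 <;> simp [Function.uncurry, indicator, h]
  have hswap := integral_integral_swap hint
  have hl : ∀ x, ∫ r, F x * (Ioi ‖x - x₀‖).indicator g r = - (tail g ‖x - x₀‖ * F x) := fun x => by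
    rw [integral_const_mul, integral_indicator measurableSet_Ioi, tail]
    ring
  simp only [hl, integral_neg] at hswap
  rw [hswap]
  refine integral_congr_ae (Eventually.of_forall fun r => ?_)
  by_cases hr : g r = 0
  · have : ∀ x, F x * (Ioi ‖x - x₀‖).indicator g r = 0 := fun x => by
      simp [indicator, hr]
    simp [hr, this]
  have hrR := hgR r hr
  have : ∀ x, x ∈ halfBall x₀ R → F x * (Ioi ‖x - x₀‖).indicator g r =
      (Metric.ball x₀ r).indicator (fun x => g r * F x) x := fun x _ => by
    by_cases h : ‖x - x₀‖ < r
    · simp [indicator, dist_eq_norm, h, mul_comm]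
    · simp [indicator, dist_eq_norm, h]
  simp only
  rw [setIntegral_congr_fun (measurableSet_halfBall x₀ R) this,
    setIntegral_indicator Metric.isOpen_ball.measurableSet, integral_const_mul, bulk]
  have hset : halfBall x₀ R ∩ Metric.ball x₀ r = halfBall x₀ r := by
    ext x
    simp only [halfBall, mem_inter_iff]
    exact ⟨fun h => ⟨h.2, h.1.2⟩, fun h => ⟨⟨Metric.ball_subset_ball hrR.2.le h.1, h.2⟩, h.1⟩⟩
  rw [hset]

theorem surf_congr {F G : Eu n → ℝ} {r : ℝ} (hr : 0 < r)
    (h : ∀ x, ‖x - x₀‖ = r → 0 < x 0 → F x = G x) : surf x₀ F r = surf x₀ G r := by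
  refine integral_congr_ae ?_
  filter_upwards [ae_restrict_of_ae (ae_norm_eq_sphereMeasure x₀ hr),
    ae_restrict_mem measurableSet_openHalf] with x hx hx0
  exact h x hx hx0

theorem surf_radial_mul (F : Eu n → ℝ) (g : ℝ → ℝ) {r : ℝ} (hr : 0 < r) :
    surf x₀ (fun x => g ‖x - x₀‖ * F x) r = g r * surf x₀ F r := by
  rw [surf_congr (G := fun x => g r * F x) hr (fun x hx _ => by simp only [hx])]
  exact integral_const_mul _ _

omit [NeZero n] in
theorem tail_norm_eq_zero {g : ℝ → ℝ} {R : ℝ} (h : ∀ t, g t ≠ 0 → t < R) (x : Eu n)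
    (hx : R ≤ ‖x - x₀‖) : tail g ‖x - x₀‖ = 0 :=
  tail_eq_zero (fun s hs => by
    by_contra hne
    exact absurd (h s hne) (not_lt.2 hs)) hx

omit [NeZero n] in
theorem tsupport_tail_norm_subset {g : ℝ → ℝ} {R R' : ℝ} (h : ∀ t, g t ≠ 0 → t < R)
    (hR : R < R') : tsupport (fun x : Eu n => tail g ‖x - x₀‖) ⊆ Metric.ball x₀ R' := by
  refine (closure_minimal (t := Metric.closedBall x₀ R) (fun x hx => ?_)
    Metric.isClosed_closedBall).trans (Metric.closedBall_subset_ball hR)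
  rw [mem_closedBall_iff_norm]
  by_contra hne
  exact hx (tail_norm_eq_zero h x (not_le.1 hne).le)

/-- This converts a weak identity for radial test functions into one at almost every radius. By
`integral_mul_bulk` the term with `tail g` becomes `-∫ g · bulk F`; by polar coordinates the term
with `g` becomes `∫ g · surf H`. So `surf H - bulk F` annihilates every test function on the
admissible radii. In each application `F` collects the coefficients of `Z = tail g`, and `H` those
of its radial derivative `g`. -/
theorem ae_bulk_eq_surf (hΩ : IsHalfSpaceDomain Ω) (hx₀ : x₀ ∈ Ω) {F H : Eu n → ℝ}
    (hF : ∀ R ∈ radii Ω x₀, IntegrableOn F (halfBall x₀ R))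
    (hH : ∀ R ∈ radii Ω x₀, IntegrableOn H (halfBall x₀ R))
    (h : ∀ g : ℝ → ℝ, ContDiff ℝ ∞ g → HasCompactSupport g → tsupport g ⊆ radii Ω x₀ →
      ∀ R ∈ radii Ω x₀, tsupport (fun x : Eu n => tail g ‖x - x₀‖) ⊆ Metric.ball x₀ R →
      ∫ x in offAxis Ω, (tail g ‖x - x₀‖ * F x + g ‖x - x₀‖ * H x) = 0) :
    ∀ᵐ r : ℝ, r ∈ radii Ω x₀ → bulk x₀ F r = surf x₀ H r := by
  have hloc : LocallyIntegrableOn (fun r => surf x₀ H r - bulk x₀ F r) (radii Ω x₀) :=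
    (locallyIntegrableOn_surf hH).sub
      ((continuousOn_bulk hF).locallyIntegrableOn isOpen_radii.measurableSet)
  have key := isOpen_radii.ae_eq_zero_of_integral_contDiff_smul_eq_zero hloc (fun g hg hgc hgs => by
    rcases (tsupport g).eq_empty_or_nonempty with he | hne
    · have : g = 0 := tsupport_eq_empty_iff.1 he
      simp [this]
    obtain ⟨R, hR, ε, hε, hgR⟩ := exists_radii_tsupport hgc hgs hne
    have hgR0 : ∀ t, g t ≠ 0 → t ∈ Ioo 0 R := fun t ht => ⟨hε.trans (hgR t ht).1, (hgR t ht).2⟩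
    have hgz : ∀ s, R ≤ s → g s = 0 := fun s hs => by
      by_contra hne
      exact absurd (hgR s hne).2 (not_lt.2 hs)
    obtain ⟨C, hC⟩ := hgc.exists_bound_of_continuous hg.continuous
    have hgi : Integrable g := hg.continuous.integrable_of_hasCompactSupport hgc
    have hcont : Continuous (tail g) := continuous_iff_continuousAt.2 fun t =>
      (hasDerivAt_tail hg.continuous hgc t).continuousAt
    have htail : ∀ t, ‖tail g t‖ ≤ ∫ s, ‖g s‖ := fun t => by
      rw [tail, norm_neg]
      exact (norm_integral_le_integral_norm _).trans
        (setIntegral_le_integral hgi.norm (Eventually.of_forall fun _ => norm_nonneg _))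
    have hi1 : IntegrableOn (fun x => tail g ‖x - x₀‖ * F x) (halfBall x₀ R) :=
      (hF R hR).bdd_mul (c := ∫ s, ‖g s‖) (by
        have : Continuous fun x : Eu n => tail g ‖x - x₀‖ := by fun_prop
        exact this.aestronglyMeasurable) (Eventually.of_forall fun x => htail _)
    have hi2 : IntegrableOn (fun x => g ‖x - x₀‖ * H x) (halfBall x₀ R) :=
      (hH R hR).bdd_mul (c := C) (by
        have := hg.continuous
        have : Continuous fun x : Eu n => g ‖x - x₀‖ := by fun_prop
        exact this.aestronglyMeasurable) (Eventually.of_forall fun x => hC _)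
    have hsub := halfBall_subset_offAxis hΩ hx₀ hR
    -- The radial function is only known to be supported in the closed ball of radius `R`; a
    -- slightly larger radius provides an open ball.
    obtain ⟨R', hR', hlt⟩ := exists_radii_gt hR
    have h1 := h g hg hgc hgs R' hR'
      (tsupport_tail_norm_subset (fun t ht => (hgR t ht).2) hlt)
    rw [setIntegral_eq_of_subset_of_forall_sdiff_eq_zero
      (isOpen_offAxis hΩ).measurableSet hsub, integral_add hi1 hi2] at h1
    · have h2 := integral_mul_bulk hg.continuous hgc hgR0 (hF R hR)
      have h3 : ∫ x in halfBall x₀ R, g ‖x - x₀‖ * H x = ∫ r, g r * surf x₀ H r := by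
        have := (half_polar_coordinates x₀ hi2).2.2
        rw [bulk] at this
        rw [this, setIntegral_congr_fun measurableSet_Ioo
          (fun r hr => surf_radial_mul (x₀ := x₀) H g hr.1)]
        refine setIntegral_eq_integral_of_forall_compl_eq_zero fun r hr => ?_
        by_contra hne
        exact hr (hgR0 r (left_ne_zero_of_mul hne))
      have hi3 : Integrable fun r => g r * surf x₀ H r :=
        (integrableOn_iff_integrable_of_support_subset (s := Ioo 0 R) (fun r hr =>
          hgR0 r (left_ne_zero_of_mul hr))).1
          ((half_polar_coordinates x₀ (hH R hR)).2.1.bdd_mul (c := C)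
            hg.continuous.aestronglyMeasurable (Eventually.of_forall fun x => hC _))
      have hi4 : Integrable fun r => g r * bulk x₀ F r := by
        have hb : ContinuousOn (bulk x₀ F) (tsupport g) := (continuousOn_bulk hF).mono hgs
        refine (integrableOn_iff_integrable_of_support_subset (s := tsupport g) (fun r hr =>
          subset_tsupport g (left_ne_zero_of_mul hr))).1 ?_
        exact (hg.continuous.continuousOn.mul hb).integrableOn_compact hgc.isCompact
      simp only [smul_eq_mul, mul_sub]
      rw [integral_sub hi3 hi4, ← h3, h2]
      linarith
    · rintro x ⟨hx1, hx2⟩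
      have : R ≤ ‖x - x₀‖ := by
        by_contra hlt
        exact hx2 ⟨by rw [mem_ball_iff_norm]; exact not_le.1 hlt, hx1.2⟩
      rw [tail_eq_zero hgz this, hgz _ this]
      simp)
  filter_upwards [key] with r hr hrr
  linarith [hr hrr]

/-! ### Smoothness and gradient of the radial test functions -/

omit [NeZero n] in
theorem hasFDerivAt_norm_sub {x : Eu n} (hx : x ≠ x₀) :
    HasFDerivAt (fun x => ‖x - x₀‖) (‖x - x₀‖⁻¹ • innerSL ℝ (x - x₀)) x := by
  have hn : ‖x - x₀‖ ≠ 0 := norm_ne_zero_iff.2 (sub_ne_zero.2 hx)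
  have h1 : HasFDerivAt (fun x => x - x₀) (ContinuousLinearMap.id ℝ (Eu n)) x :=
    (hasFDerivAt_id x).sub_const x₀
  have h2 := h1.norm_sq.sqrt (pow_ne_zero 2 hn)
  simp only [Real.sqrt_sq (norm_nonneg _)] at h2
  refine h2.congr_fderiv ?_
  rw [ContinuousLinearMap.comp_id, ← Nat.cast_smul_eq_nsmul ℝ 2, smul_smul]
  congr 1
  field_simp
  simp

omit [NeZero n] in
-- Since `g` vanishes near `0`, its primitive is constant there, which removes the singularity of
-- the norm at the centre.
theorem tail_norm_eventuallyEq {g : ℝ → ℝ} (hg : Continuous g) (hgc : HasCompactSupport g)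
    (h0 : 0 ∉ tsupport g) :
    (fun x : Eu n => tail g ‖x - x₀‖) =ᶠ[𝓝 x₀] fun _ => tail g 0 := by
  obtain ⟨ε, hε, hball⟩ := Metric.isOpen_iff.1 (isClosed_tsupport g).isOpen_compl 0 h0
  filter_upwards [Metric.ball_mem_nhds x₀ hε] with x hx
  rw [mem_ball_iff_norm] at hx
  have hd : ∀ t ∈ Ioo (-ε) ε, HasDerivAt (tail g) 0 t := fun t ht => by
    have : g t = 0 := by
      refine image_eq_zero_of_notMem_tsupport (hball ?_)
      rwa [mem_ball_zero_iff, Real.norm_eq_abs, abs_lt]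
    exact this ▸ hasDerivAt_tail hg hgc t
  have hx' : ‖x - x₀‖ ∈ Ioo (-ε) ε := ⟨by linarith [norm_nonneg (x - x₀)], hx⟩
  exact (isOpen_Ioo.is_const_of_deriv_eq_zero (convex_Ioo (-ε) ε).isPreconnected
    (fun t ht => (hd t ht).differentiableAt.differentiableWithinAt)
    (fun t ht => (hd t ht).deriv) hx' ⟨by linarith, hε⟩)

omit [NeZero n] in
theorem hasFDerivAt_tail_norm {g : ℝ → ℝ} (hg : Continuous g) (hgc : HasCompactSupport g)
    (h0 : 0 ∉ tsupport g) (x : Eu n) :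
    HasFDerivAt (fun x => tail g ‖x - x₀‖)
      ((g ‖x - x₀‖ / ‖x - x₀‖) • innerSL ℝ (x - x₀)) x := by
  by_cases hx : x = x₀
  · subst hx
    have : HasFDerivAt (fun _ : Eu n => tail g 0) (0 : Eu n →L[ℝ] ℝ) x := hasFDerivAt_const _ _
    simpa using this.congr_of_eventuallyEq (tail_norm_eventuallyEq hg hgc h0)
  · have := (hasDerivAt_tail hg hgc ‖x - x₀‖).comp_hasFDerivAt x (hasFDerivAt_norm_sub hx)
    rwa [smul_smul, ← div_eq_mul_inv] at this

theorem contDiff_tail {g : ℝ → ℝ} (hg : Continuous g) (hgc : HasCompactSupport g) :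
    ContDiff ℝ 1 (tail g) := by
  rw [contDiff_one_iff_deriv]
  refine ⟨fun t => (hasDerivAt_tail hg hgc t).differentiableAt, ?_⟩
  rwa [funext fun t => (hasDerivAt_tail hg hgc t).deriv]

omit [NeZero n] in
theorem contDiff_tail_norm {g : ℝ → ℝ} (hg : Continuous g) (hgc : HasCompactSupport g)
    (h0 : 0 ∉ tsupport g) : ContDiff ℝ 1 (fun x : Eu n => tail g ‖x - x₀‖) := by
  rw [contDiff_iff_contDiffAt]
  intro x
  by_cases hx : x = x₀
  · subst hx
    exact contDiffAt_const.congr_of_eventuallyEq (tail_norm_eventuallyEq hg hgc h0)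
  · exact (contDiff_tail hg hgc).contDiffAt.comp x
      ((contDiffAt_norm ℝ (sub_ne_zero.2 hx)).comp x (contDiffAt_id.sub contDiffAt_const))

end radial

/-! ### Boxes and strips at the axis -/

section strip

variable [NeZero n]

/-- The box `(a, b) × ∏ (cᵢ - η, cᵢ + η)`. -/
def axisBox (c : Eu n) (η a b : ℝ) : Set (Eu n) :=
  {x | x 0 ∈ Ioo a b ∧ ∀ i, i ≠ 0 → |x i - c i| < η}

/-- What matters is that `A` does not depend on the interval `(a, b)`. This bounds thin strips at
the axis from above and measures the boxes used in `sq_le_sq_near_axis`. -/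
theorem exists_volume_axisBox (c : Eu n) {η : ℝ} (hη : 0 < η) :
    ∃ A : ℝ, 0 < A ∧ ∀ a b, a ≤ b → volume (axisBox c η a b) = ENNReal.ofReal ((b - a) * A) := by
  refine ⟨∏ _i ∈ Finset.univ.erase (0 : Fin n), (2 * η),
    Finset.prod_pos fun _ _ => by positivity, fun a b hab => ?_⟩
  have hset : axisBox c η a b = (WithLp.ofLp : Eu n → Fin n → ℝ) ⁻¹' (Set.pi univ fun i =>
      if i = 0 then Ioo a b else Ioo (c i - η) (c i + η)) := by
    ext x
    simp only [axisBox, mem_ofPred_eq, mem_preimage, Set.mem_pi, mem_univ, true_imp_iff]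
    constructor
    · rintro ⟨h1, h2⟩ i
      by_cases hi : i = 0
      · subst hi; simpa using h1
      · have := abs_lt.1 (h2 i hi)
        simp only [hi, if_false]
        exact ⟨by linarith [this.1], by linarith [this.2]⟩
    · intro h
      refine ⟨by simpa using h 0, fun i hi => ?_⟩
      have := h i
      simp only [hi, if_false] at this
      exact abs_lt.2 ⟨by linarith [this.1], by linarith [this.2]⟩
  rw [hset, (PiLp.volume_preserving_ofLp (Fin n)).measure_preimage
    (MeasurableSet.univ_pi fun i => by
      by_cases hi : i = 0 <;> simp [hi, measurableSet_Ioo]).nullMeasurableSet, volume_pi_pi,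
    ← Finset.mul_prod_erase _ _ (Finset.mem_univ (0 : Fin n)),
    ENNReal.ofReal_mul (sub_nonneg.2 hab), ENNReal.ofReal_prod_of_nonneg fun _ _ => by positivity]
  congr 1
  · simp
  · refine Finset.prod_congr rfl fun i hi => ?_
    rw [if_neg (Finset.ne_of_mem_erase hi), Real.volume_Ioo]
    congr 1
    ring

omit [NeZero n] in
theorem abs_apply_le_norm (x : Eu n) (i : Fin n) : |x i| ≤ ‖x‖ := by
  simpa using PiLp.norm_apply_le x i

theorem exists_volume_strip_le (x₀ : Eu n) (R : ℝ) :
    ∃ A : ℝ, 0 < A ∧ ∀ s, 0 ≤ s →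
      volume (Metric.closedBall x₀ R ∩ {x | x 0 ∈ Ioo 0 s}) ≤ ENNReal.ofReal (s * A) := by
  obtain ⟨A, hA, h⟩ := exists_volume_axisBox x₀ (show 0 < |R| + 1 by positivity)
  refine ⟨A, hA, fun s hs => ?_⟩
  have := h 0 s hs
  rw [sub_zero] at this
  rw [← this]
  refine measure_mono fun x hx => ⟨hx.2, fun i _ => ?_⟩
  have h1 : ‖x - x₀‖ ≤ R := by simpa [dist_eq_norm] using hx.1
  have h2 := abs_apply_le_norm (x - x₀) i
  rw [PiLp.sub_apply] at h2
  linarith [le_abs_self R]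

/-- Compactness makes the conditions at single axis points uniform: points violating `p` with `x₁ →
0` would accumulate at an axis point of `K`. -/
theorem exists_forall_near_axis {Ω K : Set (Eu n)} (hK : IsCompact K) (hKΩ : K ⊆ Ω)
    {p : Eu n → Prop}
    (h : ∀ x ∈ K, x 0 = 0 → ∀ᶠ y in 𝓝[offAxis Ω] x, p y) :
    ∃ s > 0, ∀ y ∈ K, 0 < y 0 → y 0 < s → p y := by
  by_contra hcon
  push Not at hcon
  have hk : ∀ k : ℕ, ∃ y ∈ K, 0 < y 0 ∧ y 0 < 1 / ((k : ℝ) + 1) ∧ ¬ p y := fun k =>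
    hcon _ (by positivity)
  choose y hy1 hy2 hy3 hy4 using hk
  obtain ⟨z, hz, φ, hφ, hlim⟩ := hK.tendsto_subseq hy1
  have hlim0 : Tendsto (fun k => y (φ k) 0) atTop (𝓝 (z 0)) :=
    ((by fun_prop : Continuous fun x : Eu n => x 0).tendsto z).comp hlim
  have hz0 : z 0 = 0 := by
    refine tendsto_nhds_unique hlim0 (squeeze_zero (fun k => (hy2 _).le) (fun k => (hy3 _).le) ?_)
    exact (tendsto_one_div_add_atTop_nhds_zero_nat (𝕜 := ℝ)).comp hφ.tendsto_atTop
  have hlim' : Tendsto (y ∘ φ) atTop (𝓝[offAxis Ω] z) :=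
    tendsto_nhdsWithin_iff.2 ⟨hlim, Eventually.of_forall fun k => ⟨hKΩ (hy1 _), hy2 _⟩⟩
  obtain ⟨k, hk⟩ := (hlim'.eventually (h z hz hz0)).exists
  exact hy4 _ hk

theorem isCompact_closedBall_inter_closedHalf (x₀ : Eu n) (R : ℝ) :
    IsCompact (Metric.closedBall x₀ R ∩ closedHalf n) :=
  (isCompact_closedBall x₀ R).inter_right (isClosed_le continuous_const (by fun_prop))

end strip

/-! ### The divergence theorem up to the axis -/

theorem integrable_of_continuousOn_of_support {U K : Set (Eu n)} (hK : IsCompact K) (hKU : K ⊆ U)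
    {f : Eu n → ℝ} (hf : ContinuousOn f U) (h : ∀ x, x ∉ K → f x = 0) : Integrable f :=
  (integrableOn_iff_integrable_of_support_subset (s := K) fun x hx => by
    by_contra hne; exact hx (h x hne)).1 ((hf.mono hKU).integrableOn_compact hK)

/-- The factor `f` need only be smooth on `U`: the test function `g` is supported in `K`, so neither
integrand sees the values of `f` outside `U`. -/
theorem integral_mul_fderiv_of_compact {U K : Set (Eu n)} (hU : IsOpen U) (hK : IsCompact K)
    (hKU : K ⊆ U) {f g : Eu n → ℝ} (hf : ContDiffOn ℝ 1 f U) (hg : ContDiff ℝ 1 g)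
    (h : ∀ x, x ∉ K → g x = 0) (e : Eu n) :
    ∫ x, f x * fderiv ℝ g x e = - ∫ x, fderiv ℝ f x e * g x := by
  have hts : tsupport g ⊆ K := closure_minimal (fun x hx => by
    by_contra hne; exact hx (h x hne)) hK.isClosed
  have hfd : ContinuousOn (fun x => fderiv ℝ f x e) U :=
    (hf.continuousOn_fderiv_of_isOpen hU le_rfl).clm_apply continuousOn_const
  have hgd : Continuous (fun x => fderiv ℝ g x e) :=
    (hg.continuous_fderiv one_ne_zero).clm_apply continuous_const
  have hgd0 : ∀ x, x ∉ K → fderiv ℝ g x e = 0 := fun x hx => by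
    have : fderiv ℝ g x = 0 := by
      have := support_fderiv_subset ℝ (f := g)
      by_contra hne
      exact hx (hts (this hne))
    simp [this]
  refine integral_mul_fderiv_eq_neg_fderiv_mul_of_integrable ?_ ?_ ?_ ?_ ?_
  · exact integrable_of_continuousOn_of_support hK hKU (hfd.mul hg.continuous.continuousOn)
      fun x hx => by simp [h x hx]
  · exact integrable_of_continuousOn_of_support hK hKU (hf.continuousOn.mul hgd.continuousOn)
      fun x hx => by simp [hgd0 x hx]
  · exact integrable_of_continuousOn_of_support hK hKU
      (hf.continuousOn.mul hg.continuous.continuousOn) fun x hx => by simp [h x hx]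
  · exact fun x hx => (hf.contDiffAt (hU.mem_nhds (hKU (hts hx)))).differentiableAt one_ne_zero
  · exact fun x _ => hg.differentiable one_ne_zero x

theorem exists_bound_deriv_smoothTransition : ∃ C, ∀ t, |deriv Real.smoothTransition t| ≤ C := by
  have hc : HasCompactSupport (deriv Real.smoothTransition) := by
    refine HasCompactSupport.of_support_subset_isCompact (isCompact_Icc (a := (0 : ℝ)) (b := 1))
      fun t ht => ?_
    by_contra hne
    rw [mem_Icc, not_and_or, not_le, not_le] at hne
    refine ht ?_
    rcases hne with h | h
    · have : Real.smoothTransition =ᶠ[𝓝 t] fun _ => 0 := by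
        filter_upwards [Iio_mem_nhds h] with s hs
        exact Real.smoothTransition.zero_of_nonpos (le_of_lt hs)
      rw [this.deriv_eq, deriv_const]
    · have : Real.smoothTransition =ᶠ[𝓝 t] fun _ => 1 := by
        filter_upwards [Ioi_mem_nhds h] with s hs
        exact Real.smoothTransition.one_of_one_le (le_of_lt hs)
      rw [this.deriv_eq, deriv_const]
  obtain ⟨C, hC⟩ := hc.exists_bound_of_continuous
    ((Real.smoothTransition.contDiff (n := 1)).continuous_deriv le_rfl)
  exact ⟨C, hC⟩

/-- The partial derivative `∂ᵢf`. -/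
abbrev pd (f : Eu n → ℝ) (i : Fin n) (x : Eu n) : ℝ := fderiv ℝ f x (EuclideanSpace.single i 1)

theorem pd_mul {f g : Eu n → ℝ} {x : Eu n} (hf : DifferentiableAt ℝ f x)
    (hg : DifferentiableAt ℝ g x) (i : Fin n) :
    pd (fun x => f x * g x) i x = f x * pd g i x + g x * pd f i x := by
  rw [pd, fderiv_fun_mul hf hg]
  simp

theorem hasFDerivAt_coord (i : Fin n) (x : Eu n) :
    HasFDerivAt (fun x : Eu n => x i) (EuclideanSpace.proj (𝕜 := ℝ) i : Eu n →L[ℝ] ℝ) x :=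
  (EuclideanSpace.proj (𝕜 := ℝ) i : Eu n →L[ℝ] ℝ).hasFDerivAt

theorem pd_coord (i j : Fin n) (x : Eu n) :
    pd (fun x : Eu n => x i) j x = if i = j then 1 else 0 := by
  rw [pd, (hasFDerivAt_coord i x).fderiv]
  simp

section divergence

variable [NeZero n] {Ω : Set (Eu n)} {x₀ : Eu n}

/-- A cutoff vanishing for `x₁ ≤ 1 / (k + 1)`. -/
def axisCutoff (k : ℕ) (x : Eu n) : ℝ := Real.smoothTransition (((k : ℝ) + 1) * x 0 - 1)

theorem contDiff_axisCutoff (k : ℕ) : ContDiff ℝ 1 (axisCutoff k : Eu n → ℝ) :=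
  (Real.smoothTransition.contDiff (n := 1)).comp
    ((contDiff_const.mul (contDiff_piLp_apply (p := 2))).sub contDiff_const)

theorem pd_axisCutoff (k : ℕ) (i : Fin n) (x : Eu n) :
    pd (axisCutoff k) i x = deriv Real.smoothTransition (((k : ℝ) + 1) * x 0 - 1) *
      (((k : ℝ) + 1) * (if i = 0 then 1 else 0)) := by
  have h2 := ((hasFDerivAt_coord (0 : Fin n) x).const_mul ((k : ℝ) + 1)).sub_const 1
  have h3 : HasDerivAt Real.smoothTransition
      (deriv Real.smoothTransition (((k : ℝ) + 1) * x 0 - 1)) (((k : ℝ) + 1) * x 0 - 1) :=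
    ((Real.smoothTransition.contDiff (n := 1)).differentiable one_ne_zero _).hasDerivAt
  have h4 : HasFDerivAt (axisCutoff k) _ x := h3.comp_hasFDerivAt x h2
  rw [pd, h4.fderiv]
  simp [eq_comm]

theorem axisCutoff_eq_zero {k : ℕ} {x : Eu n} (hx : x 0 ≤ 1 / ((k : ℝ) + 1)) :
    axisCutoff k x = 0 := by
  refine Real.smoothTransition.zero_of_nonpos ?_
  have : (0 : ℝ) < k + 1 := by positivity
  rw [le_div_iff₀ this] at hx
  linarith

theorem tendsto_axisCutoff {x : Eu n} (hx : 0 < x 0) :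
    Tendsto (fun k => axisCutoff k x) atTop (𝓝 1) := by
  obtain ⟨m, hm⟩ := exists_nat_gt (2 / x 0)
  refine tendsto_const_nhds.congr' ?_
  filter_upwards [eventually_ge_atTop m] with k hk
  refine (Real.smoothTransition.one_of_one_le ?_).symm
  rw [div_lt_iff₀ hx] at hm
  have : (m : ℝ) ≤ k := by exact_mod_cast hk
  nlinarith

/-- With the extra factor `axisCutoff k`, the test function has compact support off the axis and
integration by parts is legitimate. The cutoff depends on `x₁` alone, so its derivative meets only
`V 0`; that is the error on the right. -/
theorem integral_axisCutoff_mul (hΩ : IsHalfSpaceDomain Ω) {V : Fin n → Eu n → ℝ}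
    (hV : ∀ i, ContDiffOn ℝ 1 (V i) (offAxis Ω)) {Z : Eu n → ℝ} (hZ : ContDiff ℝ 1 Z)
    (hZc : HasCompactSupport Z) (hZΩ : tsupport Z ∩ closedHalf n ⊆ Ω) (k : ℕ) :
    ∫ x in offAxis Ω, axisCutoff k x * (Z x * ∑ i, pd (V i) i x + ∑ i, pd Z i x * V i x) =
      - ∫ x in offAxis Ω, Z x * (deriv Real.smoothTransition (((k : ℝ) + 1) * x 0 - 1) *
        ((k : ℝ) + 1)) * V 0 x := by
  have hk : (0 : ℝ) < k + 1 := by positivity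
  have hUo := isOpen_offAxis hΩ
  set K : Set (Eu n) := tsupport Z ∩ {x | 1 / ((k : ℝ) + 1) ≤ x 0} with hKdef
  have hK : IsCompact K :=
    hZc.isCompact.inter_right (isClosed_le continuous_const (by fun_prop))
  have hpos : ∀ x : Eu n, 1 / ((k : ℝ) + 1) ≤ x 0 → 0 < x 0 := fun x hx =>
    lt_of_lt_of_le (by positivity) hx
  have hKU : K ⊆ offAxis Ω := fun x hx => ⟨hZΩ ⟨hx.1, (hpos x hx.2).le⟩, hpos x hx.2⟩
  have hZ0 : ∀ x, x ∉ tsupport Z → Z x = 0 := fun x hx => image_eq_zero_of_notMem_tsupport hx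
  have hpZ0 : ∀ i x, x ∉ tsupport Z → pd Z i x = 0 := fun i x hx => by
    have : fderiv ℝ Z x = 0 := by
      by_contra hne
      exact hx (support_fderiv_subset ℝ hne)
    simp [pd, this]
  have hd0 : ∀ x : Eu n, ¬ (1 / ((k : ℝ) + 1) ≤ x 0) →
      deriv Real.smoothTransition (((k : ℝ) + 1) * x 0 - 1) = 0 := fun x hx => by
    rw [not_le, lt_div_iff₀ hk] at hx
    have : Real.smoothTransition =ᶠ[𝓝 (((k : ℝ) + 1) * x 0 - 1)] fun _ => 0 := by
      filter_upwards [Iio_mem_nhds (show ((k : ℝ) + 1) * x 0 - 1 < 0 by linarith)] with s hs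
      exact Real.smoothTransition.zero_of_nonpos (le_of_lt hs)
    rw [this.deriv_eq, deriv_const]
  have hc0 : ∀ x : Eu n, ¬ (1 / ((k : ℝ) + 1) ≤ x 0) → axisCutoff k x = 0 := fun x hx =>
    axisCutoff_eq_zero (not_le.1 hx).le
  have hηK : ∀ x, x ∉ K → axisCutoff k x * Z x = 0 := fun x hx => by
    rw [hKdef, mem_inter_iff, not_and_or] at hx
    rcases hx with h | h
    · simp [hZ0 x h]
    · simp [hc0 x h]
  have hη : ContDiff ℝ 1 (fun x : Eu n => axisCutoff k x * Z x) := (contDiff_axisCutoff k).mul hZ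
  have hcontp : ∀ i, ContinuousOn (pd (V i) i) (offAxis Ω) := fun i =>
    ((hV i).continuousOn_fderiv_of_isOpen hUo le_rfl).clm_apply continuousOn_const
  have hcontZ : ∀ i, Continuous (pd Z i) := fun i =>
    (hZ.continuous_fderiv one_ne_zero).clm_apply continuous_const
  have hcontη : ∀ i, Continuous (pd (fun x : Eu n => axisCutoff k x * Z x) i) := fun i =>
    (hη.continuous_fderiv one_ne_zero).clm_apply continuous_const
  have hpη : ∀ i x, pd (fun x : Eu n => axisCutoff k x * Z x) i x =
      axisCutoff k x * pd Z i x + Z x * pd (axisCutoff k) i x := fun i x => by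
    exact pd_mul ((contDiff_axisCutoff k).differentiable one_ne_zero x)
      (hZ.differentiable one_ne_zero x) i
  have hparts := fun i => integral_mul_fderiv_of_compact hUo hK hKU (hV i) hη hηK
    (EuclideanSpace.single i 1)
  have hint1 : ∀ i, Integrable fun x =>
      V i x * pd (fun x : Eu n => axisCutoff k x * Z x) i x := fun i =>
    integrable_of_continuousOn_of_support hK hKU
      ((hV i).continuousOn.mul (hcontη i).continuousOn) fun x hx => by
        rw [hpη, pd_axisCutoff]
        rw [hKdef, mem_inter_iff, not_and_or] at hx
        rcases hx with h | h
        · simp [hZ0 x h, hpZ0 i x h]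
        · simp [hc0 x h, hd0 x h]
  have hint2 : ∀ i, Integrable fun x => pd (V i) i x * (axisCutoff k x * Z x) := fun i =>
    integrable_of_continuousOn_of_support hK hKU
      ((hcontp i).mul hη.continuous.continuousOn) fun x hx => by rw [hηK x hx, mul_zero]
  have hsum : ∫ x, ((∑ i, V i x * pd (fun x : Eu n => axisCutoff k x * Z x) i x) +
      ∑ i, pd (V i) i x * (axisCutoff k x * Z x)) = 0 := by
    rw [integral_add (integrable_finsetSum _ fun i _ => hint1 i)
      (integrable_finsetSum _ fun i _ => hint2 i), integral_finsetSum _ fun i _ => hint1 i,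
      integral_finsetSum _ fun i _ => hint2 i, Finset.sum_congr rfl fun i _ => hparts i,
      Finset.sum_neg_distrib, neg_add_cancel]
  have hcst : Continuous (axisCutoff k : Eu n → ℝ) := (contDiff_axisCutoff k).continuous
  have hI1 : Integrable fun x =>
      axisCutoff k x * (Z x * ∑ i, pd (V i) i x + ∑ i, pd Z i x * V i x) :=
    integrable_of_continuousOn_of_support hK hKU
      (hcst.continuousOn.mul ((hZ.continuous.continuousOn.mul
        (continuousOn_finsetSum _ fun i _ => hcontp i)).add
        (continuousOn_finsetSum _ fun i _ => (hcontZ i).continuousOn.mul (hV i).continuousOn)))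
      fun x hx => by
        rw [hKdef, mem_inter_iff, not_and_or] at hx
        rcases hx with h | h
        · simp [hZ0 x h, hpZ0 _ x h]
        · simp [hc0 x h]
  have hI2 : Integrable fun x => Z x * (deriv Real.smoothTransition (((k : ℝ) + 1) * x 0 - 1) *
        ((k : ℝ) + 1)) * V 0 x :=
    integrable_of_continuousOn_of_support hK hKU
      (((hZ.continuous.mul (by
        have := (Real.smoothTransition.contDiff (n := 1)).continuous_deriv le_rfl
        fun_prop)).continuousOn).mul (hV 0).continuousOn)
      fun x hx => by
        rw [hKdef, mem_inter_iff, not_and_or] at hx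
        rcases hx with h | h
        · simp [hZ0 x h]
        · simp [hd0 x h]
  have hpt : ∀ x, ((∑ i, V i x * pd (fun x : Eu n => axisCutoff k x * Z x) i x) +
      ∑ i, pd (V i) i x * (axisCutoff k x * Z x)) =
      axisCutoff k x * (Z x * ∑ i, pd (V i) i x + ∑ i, pd Z i x * V i x) +
      Z x * (deriv Real.smoothTransition (((k : ℝ) + 1) * x 0 - 1) *
        ((k : ℝ) + 1)) * V 0 x := fun x => by
    have h1 : ∀ i, V i x * pd (fun x : Eu n => axisCutoff k x * Z x) i x =
        axisCutoff k x * (pd Z i x * V i x) + (if i = 0 then Z x *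
          (deriv Real.smoothTransition (((k : ℝ) + 1) * x 0 - 1) * ((k : ℝ) + 1)) * V 0 x
          else 0) := fun i => by
      rw [hpη, pd_axisCutoff]
      by_cases hi : i = 0
      · subst hi; simp; ring
      · simp [hi]; ring
    rw [Finset.sum_congr rfl fun i _ => h1 i, Finset.sum_add_distrib, ← Finset.mul_sum,
      ← Finset.sum_mul, Finset.sum_ite_eq' Finset.univ (0 : Fin n)]
    simp
    ring
  simp only [hpt] at hsum
  rw [integral_add hI1 hI2] at hsum
  rw [setIntegral_eq_integral_of_forall_compl_eq_zero, setIntegral_eq_integral_of_forall_compl_eq_zero]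
  · linarith
  · intro x hx
    have hx : x ∉ K := fun h => hx (hKU h)
    rw [hKdef, mem_inter_iff, not_and_or] at hx
    rcases hx with h | h
    · simp [hZ0 x h]
    · simp [hd0 x h]
  · intro x hx
    have hx : x ∉ K := fun h => hx (hKU h)
    rw [hKdef, mem_inter_iff, not_and_or] at hx
    rcases hx with h | h
    · simp [hZ0 x h, hpZ0 _ x h]
    · simp [hc0 x h]

/-- There is no boundary term at the axis. The cutoff error lives on a strip of width `2 / (k + 1)`,
where the derivative of the cutoff is `O(k)`, the volume within the ball is `O(1/k)`, and `V 0`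
tends to `0` uniformly by compactness. -/
theorem integral_divergence (hΩ : IsHalfSpaceDomain Ω) (hx₀ : x₀ ∈ Ω) {V : Fin n → Eu n → ℝ}
    (hV : ∀ i, ContDiffOn ℝ 1 (V i) (offAxis Ω)) {R : ℝ} (hR : R ∈ radii Ω x₀)
    (hVi : ∀ i, IntegrableOn (V i) (halfBall x₀ R))
    (hdiv : IntegrableOn (fun x => ∑ i, pd (V i) i x) (halfBall x₀ R))
    (haxis : ∀ x ∈ Ω, x 0 = 0 → Tendsto (V 0) (𝓝[offAxis Ω] x) (𝓝 0))
    {Z : Eu n → ℝ} (hZ : ContDiff ℝ 1 Z) (hZR : tsupport Z ⊆ Metric.ball x₀ R) :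
    ∫ x in offAxis Ω, (Z x * ∑ i, pd (V i) i x + ∑ i, pd Z i x * V i x) = 0 := by
  have hZc : HasCompactSupport Z :=
    (isCompact_closedBall x₀ R).of_isClosed_subset (isClosed_tsupport Z)
      (hZR.trans Metric.ball_subset_closedBall)
  have hKΩ := closedBall_inter_closedHalf_subset hΩ hx₀ hR
  have hZΩ : tsupport Z ∩ closedHalf n ⊆ Ω := fun x hx =>
    hKΩ ⟨Metric.ball_subset_closedBall (hZR hx.1), hx.2⟩
  have hUo := isOpen_offAxis hΩ
  have hcontZ : ∀ i, Continuous (pd Z i) := fun i =>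
    (hZ.continuous_fderiv one_ne_zero).clm_apply continuous_const
  obtain ⟨CZ, hCZ⟩ := hZc.exists_bound_of_continuous hZ.continuous
  have hpc : ∀ i, HasCompactSupport (pd Z i) := fun i => hZc.fderiv_apply ℝ _
  have hG : IntegrableOn (fun x => Z x * ∑ i, pd (V i) i x + ∑ i, pd Z i x * V i x)
      (offAxis Ω) := by
    have h1 : IntegrableOn (fun x => Z x * ∑ i, pd (V i) i x + ∑ i, pd Z i x * V i x)
        (halfBall x₀ R) := by
      refine Integrable.add (hdiv.bdd_mul (c := CZ) hZ.continuous.aestronglyMeasurable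
        (Eventually.of_forall hCZ)) (integrable_finsetSum _ fun i _ => ?_)
      obtain ⟨C, hC⟩ := (hpc i).exists_bound_of_continuous (hcontZ i)
      exact (hVi i).bdd_mul (c := C) (hcontZ i).aestronglyMeasurable (Eventually.of_forall hC)
    refine h1.of_forall_sdiff_eq_zero hUo.measurableSet fun x hx => ?_
    have hxZ : x ∉ tsupport Z := fun h => hx.2 ⟨hZR h, hx.1.2⟩
    have hp : ∀ i, pd Z i x = 0 := fun i => image_eq_zero_of_notMem_tsupport fun h =>
      hxZ (closure_minimal (fun y hy => by
        by_contra hne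
        refine hy ?_
        have : fderiv ℝ Z y = 0 := by
          by_contra hne'
          exact hne (support_fderiv_subset ℝ hne')
        simp [pd, this]) (isClosed_tsupport Z) h)
    simp [image_eq_zero_of_notMem_tsupport hxZ, hp]
  have hlim1 : Tendsto (fun k : ℕ => ∫ x in offAxis Ω,
      axisCutoff k x * (Z x * ∑ i, pd (V i) i x + ∑ i, pd Z i x * V i x)) atTop
      (𝓝 (∫ x in offAxis Ω, (Z x * ∑ i, pd (V i) i x + ∑ i, pd Z i x * V i x))) := by
    refine tendsto_integral_of_dominated_convergence _ (fun k =>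
      (contDiff_axisCutoff k).continuous.aestronglyMeasurable.mul hG.aestronglyMeasurable)
      hG.norm (fun k => Eventually.of_forall fun x => ?_) ?_
    · rw [norm_mul, axisCutoff, Real.norm_eq_abs, abs_of_nonneg (Real.smoothTransition.nonneg _)]
      exact mul_le_of_le_one_left (norm_nonneg _) (Real.smoothTransition.le_one _)
    · filter_upwards [ae_restrict_mem hUo.measurableSet] with x hx
      simpa using (tendsto_axisCutoff hx.2).mul_const _
  have hlim2 : Tendsto (fun k : ℕ => ∫ x in offAxis Ω, Z x *
      (deriv Real.smoothTransition (((k : ℝ) + 1) * x 0 - 1) * ((k : ℝ) + 1)) * V 0 x) atTop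
      (𝓝 0) := by
    obtain ⟨C, hC⟩ := exists_bound_deriv_smoothTransition
    have hC0 : 0 ≤ C := (abs_nonneg _).trans (hC 0)
    have hCZ0 : 0 ≤ CZ := (norm_nonneg _).trans (hCZ 0)
    obtain ⟨A, hA, hvol⟩ := exists_volume_strip_le x₀ R
    rw [Metric.tendsto_nhds]
    intro ε hε
    -- The error will be at most `CZ · C (k + 1) · ε' · 2A / (k + 1)`, in which `k` cancels. The
    -- added `1` keeps the denominator positive and the final inequality strict even if `CZ` or `C`
    -- is zero.
    set ε' := ε / (2 * CZ * C * A + 1) with hε'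
    have hε'0 : 0 < ε' := by positivity
    obtain ⟨s, hs, hsV⟩ := exists_forall_near_axis
      (isCompact_closedBall_inter_closedHalf x₀ R) hKΩ (p := fun y => |V 0 y| ≤ ε')
      (fun x hx hx0 => by
        have := (haxis x (hKΩ hx) hx0).eventually (Metric.closedBall_mem_nhds 0 hε'0)
        filter_upwards [this] with y hy
        simpa using hy)
    obtain ⟨m, hm⟩ := exists_nat_gt (2 / s)
    filter_upwards [eventually_ge_atTop m] with k hk
    have hk0 : (0 : ℝ) < k + 1 := by positivity
    have hks : 2 / ((k : ℝ) + 1) < s := by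
      rw [div_lt_iff₀ hs] at hm
      rw [div_lt_iff₀ hk0]
      have : (m : ℝ) ≤ k := by exact_mod_cast hk
      nlinarith
    set T : Set (Eu n) := Metric.closedBall x₀ R ∩ {x | x 0 ∈ Ioo 0 (2 / ((k : ℝ) + 1))}
      with hT
    have hTm : MeasurableSet T := Metric.isClosed_closedBall.measurableSet.inter
      ((by fun_prop : Measurable fun x : Eu n => x 0) measurableSet_Ioo)
    have hTU : T ⊆ offAxis Ω := fun x hx => ⟨hKΩ ⟨hx.1, hx.2.1.le⟩, hx.2.1⟩
    have hvolT := hvol (2 / ((k : ℝ) + 1)) (by positivity)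
    rw [dist_zero_right, setIntegral_eq_of_subset_of_forall_sdiff_eq_zero hUo.measurableSet hTU]
    · have hb := norm_setIntegral_le_of_norm_le_const (μ := volume) (s := T)
        (f := fun x => Z x *
          (deriv Real.smoothTransition (((k : ℝ) + 1) * x 0 - 1) * ((k : ℝ) + 1)) * V 0 x)
        (C := CZ * (C * ((k : ℝ) + 1)) * ε')
        (lt_of_le_of_lt hvolT ENNReal.ofReal_lt_top) (fun x hx => by
          have h1 := hCZ x
          have h2 := hC (((k : ℝ) + 1) * x 0 - 1)
          have h3 := hsV x ⟨hx.1, hx.2.1.le⟩ hx.2.1 (hx.2.2.trans hks)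
          rw [norm_mul, norm_mul, norm_mul, Real.norm_eq_abs (deriv _ _), Real.norm_eq_abs (V 0 x),
            Real.norm_of_nonneg hk0.le]
          gcongr)
      refine hb.trans_lt ?_
      have hreal : volume.real T ≤ 2 / ((k : ℝ) + 1) * A :=
        ENNReal.toReal_le_of_le_ofReal (by positivity) hvolT
      calc CZ * (C * ((k : ℝ) + 1)) * ε' * volume.real T
          ≤ CZ * (C * ((k : ℝ) + 1)) * ε' * (2 / ((k : ℝ) + 1) * A) := by gcongr
        _ = (2 * CZ * C * A) * ε' := by field_simp
        _ < (2 * CZ * C * A + 1) * ε' := by gcongr; linarith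
        _ = ε := by rw [hε']; field_simp
    · intro x hx
      by_cases hxZ : x ∈ tsupport Z
      · have hx2 : 2 / ((k : ℝ) + 1) ≤ x 0 := by
          by_contra hlt
          exact hx.2 ⟨Metric.ball_subset_closedBall (hZR hxZ), hx.1.2, not_le.1 hlt⟩
        have : deriv Real.smoothTransition (((k : ℝ) + 1) * x 0 - 1) = 0 := by
          rw [div_le_iff₀ hk0] at hx2
          -- The function attains its maximum `1` at such `t`; this argument includes the endpoint
          -- `t = 1`.
          have hmem : ∀ t : ℝ, 1 ≤ t → deriv Real.smoothTransition t = 0 := fun t ht => by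
            have : IsLocalMax Real.smoothTransition t := by
              refine Eventually.of_forall fun s => ?_
              rw [Real.smoothTransition.one_of_one_le ht]
              exact Real.smoothTransition.le_one s
            exact this.deriv_eq_zero
          exact hmem _ (by linarith)
        simp [this]
      · simp [image_eq_zero_of_notMem_tsupport hxZ]
  have heq := fun k => integral_axisCutoff_mul hΩ hV hZ hZc hZΩ k
  simp only [heq] at hlim1
  have := tendsto_nhds_unique hlim1 hlim2.neg
  simpa using this

end divergence

/-! ### Smooth truncation of the positive part -/

/-- A `C¹` approximation of `t ↦ max t 0` that vanishes for `t ≤ 1 / (k + 1)`. -/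
def trunc (k : ℕ) (t : ℝ) : ℝ := ∫ s in (0 : ℝ)..t, Real.smoothTransition (((k : ℝ) + 1) * s - 1)

/-- The derivative of `trunc k`. -/
def truncDeriv (k : ℕ) (t : ℝ) : ℝ := Real.smoothTransition (((k : ℝ) + 1) * t - 1)

theorem continuous_truncDeriv (k : ℕ) : Continuous (truncDeriv k) :=
  Real.smoothTransition.continuous.comp (by fun_prop)

theorem hasDerivAt_trunc (k : ℕ) (t : ℝ) : HasDerivAt (trunc k) (truncDeriv k t) t :=
  intervalIntegral.integral_hasDerivAt_right ((continuous_truncDeriv k).intervalIntegrable _ _)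
    (continuous_truncDeriv k).stronglyMeasurable.stronglyMeasurableAtFilter
    (continuous_truncDeriv k).continuousAt

theorem contDiff_trunc (k : ℕ) : ContDiff ℝ 1 (trunc k) := by
  rw [contDiff_one_iff_deriv]
  refine ⟨fun t => (hasDerivAt_trunc k t).differentiableAt, ?_⟩
  rw [funext fun t => (hasDerivAt_trunc k t).deriv]
  exact continuous_truncDeriv k

theorem truncDeriv_nonneg (k : ℕ) (t : ℝ) : 0 ≤ truncDeriv k t := Real.smoothTransition.nonneg _

theorem truncDeriv_le_one (k : ℕ) (t : ℝ) : truncDeriv k t ≤ 1 := Real.smoothTransition.le_one _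

theorem truncDeriv_eq_zero {k : ℕ} {t : ℝ} (ht : t ≤ 1 / ((k : ℝ) + 1)) : truncDeriv k t = 0 := by
  refine Real.smoothTransition.zero_of_nonpos ?_
  rw [le_div_iff₀ (by positivity)] at ht
  linarith

theorem truncDeriv_eq_one {k : ℕ} {t : ℝ} (ht : 2 / ((k : ℝ) + 1) ≤ t) : truncDeriv k t = 1 := by
  refine Real.smoothTransition.one_of_one_le ?_
  rw [div_le_iff₀ (by positivity)] at ht
  linarith

theorem trunc_eq_zero {k : ℕ} {t : ℝ} (ht : t ≤ 1 / ((k : ℝ) + 1)) : trunc k t = 0 := by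
  have h0 : (0 : ℝ) ≤ 1 / ((k : ℝ) + 1) := by positivity
  rw [trunc, intervalIntegral.integral_congr (g := fun _ => 0), intervalIntegral.integral_zero]
  intro s hs
  refine truncDeriv_eq_zero ?_
  rw [mem_uIcc] at hs
  rcases hs with hs | hs <;> linarith [hs.1, hs.2]

theorem trunc_eq_zero_of_nonpos {k : ℕ} {t : ℝ} (ht : t ≤ 0) : trunc k t = 0 :=
  trunc_eq_zero (ht.trans (by positivity))

theorem trunc_nonneg (k : ℕ) (t : ℝ) : 0 ≤ trunc k t := by
  rcases le_total t 0 with h | h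
  · rw [trunc_eq_zero_of_nonpos h]
  · exact intervalIntegral.integral_nonneg h fun s _ => truncDeriv_nonneg k s

theorem trunc_le (k : ℕ) (t : ℝ) : trunc k t ≤ max t 0 := by
  rcases le_total t 0 with h | h
  · rw [trunc_eq_zero_of_nonpos h]; exact le_max_right _ _
  · rw [max_eq_left h]
    have := intervalIntegral.integral_mono_on (μ := volume) h
      ((continuous_truncDeriv k).intervalIntegrable _ _)
      (continuous_const (y := (1 : ℝ)).intervalIntegrable _ _)
      (fun s _ => truncDeriv_le_one k s)
    simpa [trunc, truncDeriv] using this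

theorem sub_le_trunc (k : ℕ) (t : ℝ) : t - 2 / ((k : ℝ) + 1) ≤ trunc k t := by
  set a : ℝ := 2 / ((k : ℝ) + 1) with ha
  rcases le_total t a with h | h
  · linarith [trunc_nonneg k t]
  · have hi := fun a b => (continuous_truncDeriv k).intervalIntegrable (μ := volume) a b
    have h1 : trunc k t = trunc k a + ∫ s in a..t, truncDeriv k s :=
      (intervalIntegral.integral_add_adjacent_intervals (hi 0 a) (hi a t)).symm
    have h2 : ∫ s in a..t, truncDeriv k s = t - a := by
      rw [intervalIntegral.integral_congr (g := fun _ => 1), intervalIntegral.integral_const]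
      · simp
      · intro s hs
        rw [uIcc_of_le h] at hs
        exact truncDeriv_eq_one hs.1
    rw [h1, h2]
    linarith [trunc_nonneg k a]

theorem tendsto_div_nat_add_one (c : ℝ) :
    Tendsto (fun k : ℕ => c / ((k : ℝ) + 1)) atTop (𝓝 0) := by
  simpa [div_eq_mul_inv] using
    (tendsto_one_div_add_atTop_nhds_zero_nat (𝕜 := ℝ)).const_mul c

theorem tendsto_trunc (t : ℝ) : Tendsto (fun k => trunc k t) atTop (𝓝 (max t 0)) := by
  refine tendsto_of_tendsto_of_tendsto_of_le_of_le (g := fun k : ℕ => max t 0 - 2 / ((k : ℝ) + 1))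
    ?_ tendsto_const_nhds (fun k => ?_) (fun k => trunc_le k t)
  · simpa using tendsto_const_nhds.sub (tendsto_div_nat_add_one 2)
  · have : (0 : ℝ) ≤ 2 / ((k : ℝ) + 1) := by positivity
    rcases le_total t 0 with h | h
    · simp only [max_eq_right h]; linarith [trunc_nonneg k t]
    · simp only [max_eq_left h]; exact sub_le_trunc k t

theorem tendsto_truncDeriv {t : ℝ} (ht : 0 < t) :
    Tendsto (fun k => truncDeriv k t) atTop (𝓝 1) := by
  refine tendsto_const_nhds.congr' ?_
  filter_upwards [(tendsto_div_nat_add_one 2).eventually (ge_mem_nhds ht)] with k hk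
  exact (truncDeriv_eq_one hk).symm

/-! ### The gradient of the positive part -/

/-- The classical gradient of `v` on `{v > 0}`, extended by zero. -/
def posGrad (v : Eu n → ℝ) (x : Eu n) : Eu n :=
  {x | 0 < v x}.indicator (fun x => WithLp.toLp 2 fun i => pd v i x) x

theorem posGrad_apply_of_pos {v : Eu n → ℝ} {x : Eu n} (h : 0 < v x) (i : Fin n) :
    posGrad v x i = pd v i x := by
  simp [posGrad, indicator, h]

theorem posGrad_of_nonpos {v : Eu n → ℝ} {x : Eu n} (h : v x ≤ 0) : posGrad v x = 0 := by
  simp [posGrad, indicator, not_lt.2 h]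

theorem isOpen_posSet {U : Set (Eu n)} (hU : IsOpen U) {v : Eu n → ℝ} (hv : ContinuousOn v U) :
    IsOpen (U ∩ {x | 0 < v x}) :=
  hv.isOpen_inter_preimage hU isOpen_Ioi

/-- A product of a truncation of `v` with a function that is `C¹` on `{v > 0}` is `C¹`. -/
theorem contDiffOn_mul_of_trunc {U : Set (Eu n)} (hU : IsOpen U) {v : Eu n → ℝ}
    (hv : ContinuousOn v U) {F : ℝ → ℝ} (hF : ContDiff ℝ 1 F) {ε : ℝ} (hε : 0 < ε)
    (hF0 : ∀ t ≤ ε, F t = 0) (hv1 : ContDiffOn ℝ 1 v (U ∩ {x | 0 < v x})) {G : Eu n → ℝ}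
    (hG : ContDiffOn ℝ 1 G (U ∩ {x | 0 < v x})) :
    ContDiffOn ℝ 1 (fun x => F (v x) * G x) U := by
  intro x hx
  refine ContDiffAt.contDiffWithinAt ?_
  rcases lt_or_ge 0 (v x) with h | h
  · have hm : U ∩ {x | 0 < v x} ∈ 𝓝 x := (isOpen_posSet hU hv).mem_nhds ⟨hx, h⟩
    exact (hF.contDiffAt.comp x (hv1.contDiffAt hm)).mul (hG.contDiffAt hm)
  · have : (fun x => F (v x) * G x) =ᶠ[𝓝 x] fun _ => 0 := by
      filter_upwards [(hv.continuousAt (hU.mem_nhds hx)).eventually_lt continuousAt_const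
        (lt_of_le_of_lt h hε)] with y hy
      rw [hF0 _ hy.le, zero_mul]
    exact contDiffAt_const.congr_of_eventuallyEq this

theorem contDiffOn_trunc_comp {U : Set (Eu n)} (hU : IsOpen U) {v : Eu n → ℝ}
    (hv : ContinuousOn v U) (hv1 : ContDiffOn ℝ 1 v (U ∩ {x | 0 < v x})) (k : ℕ) :
    ContDiffOn ℝ 1 (fun x => trunc k (v x)) U := by
  simpa using contDiffOn_mul_of_trunc hU hv (contDiff_trunc k)
    (show (0 : ℝ) < 1 / ((k : ℝ) + 1) by positivity) (fun t ht => trunc_eq_zero ht) hv1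
    (contDiffOn_const (c := (1 : ℝ)))

/-- At points with `v ≤ 0`, continuity keeps `v` below the truncation threshold nearby, so the
composition is locally zero. No differentiability of `v` at the free boundary is involved. -/
theorem pd_trunc_comp {U : Set (Eu n)} (hU : IsOpen U) {v : Eu n → ℝ}
    (hv : ContinuousOn v U) (hv1 : ContDiffOn ℝ 1 v (U ∩ {x | 0 < v x})) (k : ℕ) (i : Fin n)
    {x : Eu n} (hx : x ∈ U) :
    pd (fun x => trunc k (v x)) i x = truncDeriv k (v x) * posGrad v x i := by
  rcases lt_or_ge 0 (v x) with h | h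
  · have hd : DifferentiableAt ℝ v x :=
      (hv1.contDiffAt ((isOpen_posSet hU hv).mem_nhds ⟨hx, h⟩)).differentiableAt one_ne_zero
    have h1 := (hasDerivAt_trunc k (v x)).comp_hasFDerivAt x hd.hasFDerivAt
    have h2 : fderiv ℝ (fun x => trunc k (v x)) x = truncDeriv k (v x) • fderiv ℝ v x := h1.fderiv
    rw [pd, h2, posGrad_apply_of_pos h]
    rfl
  · have : (fun x => trunc k (v x)) =ᶠ[𝓝 x] fun _ => 0 := by
      filter_upwards [(hv.continuousAt (hU.mem_nhds hx)).eventually_lt continuousAt_const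
        (lt_of_le_of_lt h (show (0 : ℝ) < 1 / ((k : ℝ) + 1) by positivity))] with y hy
      exact trunc_eq_zero hy.le
    rw [pd, this.fderiv_eq, posGrad_of_nonpos h]
    simp

theorem continuousOn_pos {U : Set (Eu n)} {v : Eu n → ℝ} (hv : ContinuousOn v U) :
    ContinuousOn (pos v) U := hv.sup continuousOn_const

/-- The truncations of `v` are `C¹` on all of `U`, so they can be integrated by parts classically.
Dominated convergence then applies: `truncDeriv k v` tends to `1` on `{v > 0}`, and `posGrad v`
vanishes elsewhere. -/
theorem hasWeakGrad_posGrad {U : Set (Eu n)} (hU : IsOpen U) {v : Eu n → ℝ}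
    (hv : ContinuousOn v U) (hv1 : ContDiffOn ℝ 1 v (U ∩ {x | 0 < v x}))
    (hloc : LocallyIntegrableOn (posGrad v) U) : HasWeakGrad U (pos v) (posGrad v) := by
  refine ⟨(continuousOn_pos hv).locallyIntegrableOn hU.measurableSet, hloc,
    fun ψ hψ hψc hψU i => ?_⟩
  have hψ1 : ContDiff ℝ 1 ψ := hψ.of_le (mod_cast le_top)
  have hK : IsCompact (tsupport ψ) := hψc.isCompact
  have hψ0 : ∀ x, x ∉ tsupport ψ → ψ x = 0 := fun x hx => image_eq_zero_of_notMem_tsupport hx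
  have hpψ0 : ∀ x, x ∉ tsupport ψ → pd ψ i x = 0 := fun x hx => by
    have : fderiv ℝ ψ x = 0 := by
      by_contra hne
      exact hx (support_fderiv_subset ℝ hne)
    simp [pd, this]
  have hpc : Continuous (pd ψ i) :=
    (hψ1.continuous_fderiv one_ne_zero).clm_apply continuous_const
  have hparts : ∀ k, ∫ x in U, trunc k (v x) * pd ψ i x =
      - ∫ x in U, truncDeriv k (v x) * (posGrad v x i * ψ x) := fun k => by
    have h := integral_mul_fderiv_of_compact hU hK hψU (contDiffOn_trunc_comp hU hv hv1 k) hψ1 hψ0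
      (EuclideanSpace.single i 1)
    rw [setIntegral_eq_integral_of_forall_compl_eq_zero
      (fun x hx => by rw [hpψ0 x (fun h => hx (hψU h)), mul_zero]), h,
      ← setIntegral_eq_integral_of_forall_compl_eq_zero (s := U)
      (fun x hx => by rw [hψ0 x (fun h => hx (hψU h)), mul_zero])]
    congr 1
    refine setIntegral_congr_fun hU.measurableSet fun x hx => ?_
    have := pd_trunc_comp hU hv hv1 k i hx
    simp only [pd] at this
    simp only [this, mul_assoc]
  have hi1 : IntegrableOn (fun x => pos v x * pd ψ i x) U :=
    (integrable_of_continuousOn_of_support hK hψU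
      ((continuousOn_pos hv).mul hpc.continuousOn)
      (fun x hx => by rw [Pi.mul_apply, hpψ0 x hx, mul_zero])).integrableOn
  have hi2 : IntegrableOn (fun x => posGrad v x i * ψ x) U := by
    have h1 : IntegrableOn (posGrad v) (tsupport ψ) :=
      hloc.integrableOn_compact_subset hψU hK
    have h2 : IntegrableOn (fun x => posGrad v x i) (tsupport ψ) :=
      (EuclideanSpace.proj (𝕜 := ℝ) i : Eu n →L[ℝ] ℝ).integrable_comp h1
    obtain ⟨C, hC⟩ := hψc.exists_bound_of_continuous hψ1.continuous
    have h3 : IntegrableOn (fun x => posGrad v x i * ψ x) (tsupport ψ) :=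
      h2.mul_bdd (c := C) hψ1.continuous.aestronglyMeasurable (Eventually.of_forall hC)
    exact ((integrableOn_iff_integrable_of_support_subset fun x hx => by
      by_contra hne
      exact hx (by simp [hψ0 x hne])).1 h3).integrableOn
  have hmt : ∀ k, AEStronglyMeasurable (fun x => trunc k (v x)) (volume.restrict U) := fun k =>
    ((contDiff_trunc k).continuous.comp_continuousOn hv).aestronglyMeasurable hU.measurableSet
  have hmd : ∀ k, AEStronglyMeasurable (fun x => truncDeriv k (v x)) (volume.restrict U) :=
    fun k => ((continuous_truncDeriv k).comp_continuousOn hv).aestronglyMeasurable hU.measurableSet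
  have hl1 : Tendsto (fun k => ∫ x in U, trunc k (v x) * pd ψ i x) atTop
      (𝓝 (∫ x in U, pos v x * pd ψ i x)) := by
    refine tendsto_integral_of_dominated_convergence _ (fun k =>
      (hmt k).mul hpc.aestronglyMeasurable) hi1.norm (fun k => Eventually.of_forall fun x => ?_)
      (Eventually.of_forall fun x => (tendsto_trunc (v x)).mul_const _)
    rw [norm_mul, norm_mul, Real.norm_of_nonneg (trunc_nonneg _ _),
      Real.norm_of_nonneg (show 0 ≤ pos v x from le_max_right _ _)]
    exact mul_le_mul_of_nonneg_right (trunc_le _ _) (norm_nonneg _)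
  have hl2 : Tendsto (fun k => ∫ x in U, truncDeriv k (v x) * (posGrad v x i * ψ x)) atTop
      (𝓝 (∫ x in U, posGrad v x i * ψ x)) := by
    refine tendsto_integral_of_dominated_convergence _ (fun k =>
      (hmd k).mul hi2.aestronglyMeasurable) hi2.norm (fun k => Eventually.of_forall fun x => ?_)
      (Eventually.of_forall fun x => ?_)
    · rw [norm_mul, Real.norm_of_nonneg (truncDeriv_nonneg _ _)]
      exact mul_le_of_le_one_left (norm_nonneg _) (truncDeriv_le_one _ _)
    · rcases lt_or_ge 0 (v x) with h | h
      · simpa using (tendsto_truncDeriv h).mul_const (posGrad v x i * ψ x)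
      · simp [posGrad_of_nonpos h]
  simp only [hparts] at hl1
  exact tendsto_nhds_unique hl1 hl2.neg

/-! ### Uniqueness of weak gradients -/

theorem HasWeakGrad.ae_eq {U : Set (Eu n)} (hU : IsOpen U) {v : Eu n → ℝ} {G G' : Eu n → Eu n}
    (h : HasWeakGrad U v G) (h' : HasWeakGrad U v G') : G =ᵐ[volume.restrict U] G' := by
  have hi : ∀ i : Fin n, ∀ᵐ x, x ∈ U → G x i - G' x i = 0 := fun i => by
    have hl : ∀ {H : Eu n → Eu n}, LocallyIntegrableOn H U →
        LocallyIntegrableOn (fun x => H x i) U := fun {H} hH x hx => by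
      obtain ⟨t, ht, hti⟩ := hH x hx
      exact ⟨t, ht, (EuclideanSpace.proj (𝕜 := ℝ) i : Eu n →L[ℝ] ℝ).integrable_comp hti⟩
    refine hU.ae_eq_zero_of_integral_contDiff_smul_eq_zero
      ((hl h.locInt_grad).sub (hl h'.locInt_grad)) fun ψ hψ hψc hψU => ?_
    have hint : ∀ {H : Eu n → Eu n}, LocallyIntegrableOn H U →
        Integrable (fun x => H x i * ψ x) (volume.restrict U) := fun {H} hH => by
      have h2 := (hl hH).integrableOn_compact_subset hψU hψc.isCompact
      obtain ⟨C, hC⟩ := hψc.exists_bound_of_continuous hψ.continuous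
      have h3 : IntegrableOn (fun x => H x i * ψ x) (tsupport ψ) :=
        h2.mul_bdd (c := C) hψ.continuous.aestronglyMeasurable (Eventually.of_forall hC)
      exact ((integrableOn_iff_integrable_of_support_subset fun x hx =>
        subset_tsupport ψ (right_ne_zero_of_mul hx)).1 h3).integrableOn
    rw [← setIntegral_eq_integral_of_forall_compl_eq_zero (s := U) (fun x hx => by
      rw [image_eq_zero_of_notMem_tsupport (fun hh => hx (hψU hh)), zero_smul])]
    have e1 := h.integral_eq ψ hψ hψc hψU i
    have e2 := h'.integral_eq ψ hψ hψc hψU i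
    have : ∀ x, ψ x • (G x i - G' x i) = G x i * ψ x - G' x i * ψ x := fun x => by
      rw [smul_eq_mul]; ring
    simp only [this]
    rw [integral_sub (hint h.locInt_grad) (hint h'.locInt_grad)]
    linarith
  rw [Filter.EventuallyEq, ae_restrict_iff' hU.measurableSet]
  filter_upwards [ae_all_iff.2 hi] with x hx hxU
  ext i
  linarith [hx i hxU]

theorem HasWeakGrad.mono {U D : Set (Eu n)} (hU : MeasurableSet U) (hDU : D ⊆ U) {v : Eu n → ℝ}
    {G : Eu n → Eu n} (h : HasWeakGrad U v G) : HasWeakGrad D v G := by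
  refine ⟨h.locInt.mono_set hDU, h.locInt_grad.mono_set hDU, fun ψ hψ hψc hψD i => ?_⟩
  have := h.integral_eq ψ hψ hψc (hψD.trans hDU) i
  have h0 : ∀ x, x ∉ D → ψ x = 0 := fun x hx =>
    image_eq_zero_of_notMem_tsupport fun hh => hx (hψD hh)
  have hp0 : ∀ x, x ∉ D → fderiv ℝ ψ x (EuclideanSpace.single i 1) = 0 := fun x hx => by
    have : fderiv ℝ ψ x = 0 := by
      by_contra hne
      exact hx (hψD (support_fderiv_subset ℝ hne))
    simp [this]
  rw [← setIntegral_eq_of_subset_of_forall_sdiff_eq_zero hU hDU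
    (fun x hx => by rw [hp0 x hx.2, mul_zero]),
    ← setIntegral_eq_of_subset_of_forall_sdiff_eq_zero hU hDU
    (fun x hx => by rw [h0 x hx.2, mul_zero])]
  exact this

theorem HasWeakGrad.neg {U : Set (Eu n)} {v : Eu n → ℝ} {G : Eu n → Eu n}
    (h : HasWeakGrad U v G) : HasWeakGrad U (fun x => - v x) (fun x => - G x) := by
  refine ⟨h.locInt.neg, h.locInt_grad.neg, fun ψ hψ hψc hψU i => ?_⟩
  have := h.integral_eq ψ hψ hψc hψU i
  simp only [neg_mul, integral_neg, PiLp.neg_apply]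
  rw [this]

theorem hasWeakGrad_of_contDiffOn {D : Set (Eu n)} (hD : IsOpen D) {v : Eu n → ℝ}
    (hv : ContDiffOn ℝ 1 v D) : HasWeakGrad D v (fun x => WithLp.toLp 2 fun i => pd v i x) := by
  have hc : ∀ i, ContinuousOn (pd v i) D := fun i =>
    (hv.continuousOn_fderiv_of_isOpen hD le_rfl).clm_apply continuousOn_const
  refine ⟨hv.continuousOn.locallyIntegrableOn hD.measurableSet,
    ContinuousOn.locallyIntegrableOn ?_ hD.measurableSet, fun ψ hψ hψc hψD i => ?_⟩
  · exact (PiLp.continuous_toLp 2 _).comp_continuousOn (continuousOn_pi.2 hc)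
  · have h := integral_mul_fderiv_of_compact hD hψc.isCompact hψD hv
      (hψ.of_le (mod_cast le_top)) (fun x hx => image_eq_zero_of_notMem_tsupport hx)
      (EuclideanSpace.single i 1)
    rw [setIntegral_eq_integral_of_forall_compl_eq_zero,
      setIntegral_eq_integral_of_forall_compl_eq_zero, h]
    · intro x hx
      rw [image_eq_zero_of_notMem_tsupport (fun hh => hx (hψD hh)), mul_zero]
    · intro x hx
      have : fderiv ℝ ψ x = 0 := by
        by_contra hne
        exact hx (hψD (support_fderiv_subset ℝ hne))
      simp [this]

/-- The weak gradient of `v` itself supplies local integrability: by uniqueness it agrees a.e. with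
the classical gradient on the open set `{v > 0}`. -/
theorem hasWeakGrad_pos {U : Set (Eu n)} (hU : IsOpen U) {v : Eu n → ℝ} (hv : ContinuousOn v U)
    (hv1 : ContDiffOn ℝ 1 v (U ∩ {x | 0 < v x})) (h : ∃ G, HasWeakGrad U v G) :
    HasWeakGrad U (pos v) (posGrad v) := by
  obtain ⟨G, hG⟩ := h
  have hD := isOpen_posSet hU hv
  have hae : G =ᵐ[volume.restrict (U ∩ {x | 0 < v x})] _ :=
    (hG.mono hU.measurableSet inter_subset_left).ae_eq hD (hasWeakGrad_of_contDiffOn hD hv1)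
  refine hasWeakGrad_posGrad hU hv hv1 fun x hx => ?_
  obtain ⟨t, ht, hti⟩ := hG.locInt_grad x hx
  have htU : IntegrableOn G (t ∩ U) := hti.mono_set inter_subset_left
  refine ⟨t ∩ U, inter_mem ht self_mem_nhdsWithin, (htU.indicator hD.measurableSet).congr ?_⟩
  have hae' : ∀ᵐ x, x ∈ U ∩ {x | 0 < v x} → G x = _ :=
    (ae_restrict_iff' hD.measurableSet).1 hae
  have hU' : ∀ᵐ x ∂(volume.restrict (t ∩ U)), x ∈ U :=
    ae_mono (Measure.restrict_mono inter_subset_right le_rfl) (ae_restrict_mem hU.measurableSet)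
  filter_upwards [ae_restrict_of_ae hae', hU'] with y hy hyU
  by_cases hp : 0 < v y
  · have hm : y ∈ U ∩ {x | 0 < v x} := ⟨hyU, hp⟩
    rw [indicator_of_mem hm, hy hm, posGrad, indicator_of_mem (show y ∈ {x | 0 < v x} from hp)]
  · rw [indicator_of_notMem (fun h => hp h.2), posGrad_of_nonpos (not_lt.1 hp)]

/-! ### The equation in the phases -/

theorem pd_sum {ι : Type*} (s : Finset ι) {f : ι → Eu n → ℝ} {x : Eu n}
    (hf : ∀ j ∈ s, DifferentiableAt ℝ (f j) x) (i : Fin n) :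
    pd (fun x => ∑ j ∈ s, f j x) i x = ∑ j ∈ s, pd (f j) i x := by
  rw [pd, fderiv_fun_sum hf]
  simp

theorem contDiffOn_pd {D : Set (Eu n)} (hD : IsOpen D) {v : Eu n → ℝ}
    (hv : ContDiffOn ℝ 2 v D) (i : Fin n) : ContDiffOn ℝ 1 (pd v i) D :=
  (hv.fderiv_of_isOpen hD (by norm_num)).clm_apply contDiffOn_const

theorem pd_pd_comm {D : Set (Eu n)} (hD : IsOpen D) {v : Eu n → ℝ}
    (hv : ContDiffOn ℝ 2 v D) (i j : Fin n) {x : Eu n} (hx : x ∈ D) :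
    pd (pd v i) j x = pd (pd v j) i x := by
  have hc : ContDiffAt ℝ 2 v x := hv.contDiffAt (hD.mem_nhds hx)
  have hs := hc.isSymmSndFDerivAt (by simp)
  have hd : DifferentiableAt ℝ (fderiv ℝ v) x :=
    ((hv.fderiv_of_isOpen hD (m := 1) (by norm_num)).contDiffAt (hD.mem_nhds hx)).differentiableAt
      one_ne_zero
  have h : ∀ i j : Fin n, pd (pd v i) j x =
      fderiv ℝ (fderiv ℝ v) x (EuclideanSpace.single j 1) (EuclideanSpace.single i 1) :=
    fun i j => by
      have := (hd.hasFDerivAt.clm_apply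
        (hasFDerivAt_const (EuclideanSpace.single i (1 : ℝ) : Eu n) x)).fderiv
      rw [pd]
      unfold pd
      rw [this]
      simp
  rw [h, h, hs]

section weight

variable [NeZero n]

/-- The weight `x₁^σ`. -/
def wt (σ : ℤ) (x : Eu n) : ℝ := x 0 ^ σ

theorem wt_pos (σ : ℤ) {x : Eu n} (hx : 0 < x 0) : 0 < wt σ x := zpow_pos hx σ

theorem contDiffOn_wt (σ : ℤ) : ContDiffOn ℝ 1 (wt σ : Eu n → ℝ) (openHalf n) := by
  intro x hx
  have h0 : x 0 ≠ 0 := ne_of_gt hx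
  have hc : ContDiffAt ℝ 1 (fun x : Eu n => x 0) x := (contDiff_piLp_apply (p := 2)).contDiffAt
  refine ContDiffAt.contDiffWithinAt ?_
  unfold wt
  cases σ with
  | ofNat k => simpa using hc.pow k
  | negSucc k =>
    simp only [zpow_negSucc]
    exact (hc.pow (k + 1)).inv (pow_ne_zero _ h0)

theorem pd_wt (σ : ℤ) {x : Eu n} (hx : 0 < x 0) (i : Fin n) :
    pd (wt σ) i x = if i = 0 then σ * x 0 ^ (σ - 1) else 0 := by
  have h := (hasDerivAt_zpow (𝕜 := ℝ) σ (x 0) (Or.inl hx.ne')).comp_hasFDerivAt x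
    (hasFDerivAt_coord (0 : Fin n) x)
  have h' : fderiv ℝ (wt σ) x = _ := h.fderiv
  rw [pd, h']
  simp [eq_comm]

/-- The contribution to the first domain variation of a phase with weight `x₁^σ` and
gradient `P`. -/
def phaseVar (σ : ℤ) (P : Eu n → Eu n) (φ : Eu n → Eu n) (x : Eu n) : ℝ :=
  wt σ x * ‖P x‖ ^ 2 * diverg φ x - 2 * wt σ x * ⟪P x, fderiv ℝ φ x (P x)⟫
    + σ * x 0 ^ (σ - 1) * ‖P x‖ ^ 2 * φ x 0

theorem variationIntegrand_eq (P N φ : Eu n → Eu n) (x : Eu n) :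
    variationIntegrand P N φ x = phaseVar 1 P φ x + phaseVar (-1) N φ x := by
  simp only [variationIntegrand, phaseVar, wt]
  norm_num [zpow_neg]
  ring

theorem phaseVar_neg (σ : ℤ) (P φ : Eu n → Eu n) (x : Eu n) :
    phaseVar σ (fun x => - P x) φ x = phaseVar σ P φ x := by
  simp [phaseVar]

omit [NeZero n] in
theorem inner_eq_sum (a b : Eu n) : ⟪a, b⟫ = ∑ i, a i * b i := by
  rw [PiLp.inner_apply]
  exact Finset.sum_congr rfl fun i _ => by simp [mul_comm]

omit [NeZero n] in
theorem fderiv_apply_eq_sum (f : Eu n → ℝ) (x h : Eu n) :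
    fderiv ℝ f x h = ∑ i, h i * pd f i x := by
  have : h = ∑ i, h i • EuclideanSpace.single i (1 : ℝ) := by
    ext j
    simp [Finset.sum_apply, Pi.single_apply]
  conv_lhs => rw [this]
  simp [map_sum]

omit [NeZero n] in
theorem fderiv_smul_single {ψ : Eu n → ℝ} (hψ : Differentiable ℝ ψ) (i : Fin n) (x h : Eu n) :
    fderiv ℝ (fun x => ψ x • (EuclideanSpace.single i (1 : ℝ) : Eu n)) x h =
      fderiv ℝ ψ x h • (EuclideanSpace.single i (1 : ℝ) : Eu n) := by
  rw [((hψ x).hasFDerivAt.smul_const (EuclideanSpace.single i (1 : ℝ) : Eu n)).fderiv]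
  rfl

theorem phaseVar_smul_single {ψ : Eu n → ℝ} (hψ : Differentiable ℝ ψ) (σ : ℤ) (P : Eu n → Eu n)
    (i : Fin n) (x : Eu n) :
    phaseVar σ P (fun x => ψ x • (EuclideanSpace.single i (1 : ℝ) : Eu n)) x =
      wt σ x * (∑ j, P x j ^ 2) * pd ψ i x - 2 * ∑ j, wt σ x * P x i * P x j * pd ψ j x
        + (if i = 0 then (σ : ℝ) * x 0 ^ (σ - 1) else 0) * (∑ j, P x j ^ 2) * ψ x := by
  have hdiv : diverg (fun x => ψ x • (EuclideanSpace.single i (1 : ℝ) : Eu n)) x = pd ψ i x := by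
    simp only [diverg, fderiv_smul_single hψ]
    simp
  have hn : ‖P x‖ ^ 2 = ∑ j, P x j ^ 2 := EuclideanSpace.real_norm_sq_eq _
  rw [phaseVar, hdiv, fderiv_smul_single hψ, hn, inner_smul_right, fderiv_apply_eq_sum]
  have : ⟪P x, (EuclideanSpace.single i (1 : ℝ) : Eu n)⟫ = P x i := by
    rw [inner_eq_sum]; simp
  rw [this]
  have h2 : 2 * wt σ x * ((∑ j, P x j * pd ψ j x) * P x i) =
      2 * ∑ j, wt σ x * P x i * P x j * pd ψ j x := by
    rw [Finset.sum_mul, Finset.mul_sum, Finset.mul_sum]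
    exact Finset.sum_congr rfl fun j _ => by ring
  rw [h2]
  by_cases hi : i = 0
  · subst hi; simp
  · have : (0 : Fin n) ≠ i := fun h => hi h.symm
    simp [hi, this]

/-- The weighted Laplacian `div (x₁^σ ∇v)`. -/
def wlap (σ : ℤ) (v : Eu n → ℝ) (x : Eu n) : ℝ := ∑ j, pd (fun x => wt σ x * pd v j x) j x

/-- Integrating the variation along `ψ eᵢ` by parts shows that `∂ᵢv · div (x₁^σ ∇v)` vanishes for
every `i`. If the divergence were nonzero at a point, it would be nonzero nearby by continuity, so
`∇v` would vanish on a neighbourhood and the divergence with it. -/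
theorem wlap_eq_zero_of_stationary {D : Set (Eu n)} (hD : IsOpen D) (hDh : D ⊆ openHalf n)
    {v : Eu n → ℝ} (hv : ContDiffOn ℝ 2 v D) (σ : ℤ)
    (hst : ∀ ψ : Eu n → ℝ, ContDiff ℝ ∞ ψ → HasCompactSupport ψ → tsupport ψ ⊆ D → ∀ i : Fin n,
      ∫ x, phaseVar σ (fun x => WithLp.toLp 2 fun i => pd v i x)
        (fun x => ψ x • (EuclideanSpace.single i (1 : ℝ) : Eu n)) x = 0) :
    ∀ x ∈ D, wlap σ v x = 0 := by
  have hw : ContDiffOn ℝ 1 (wt σ : Eu n → ℝ) D := (contDiffOn_wt σ).mono hDh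
  have hp := contDiffOn_pd hD hv
  have hwp : ∀ j, ContDiffOn ℝ 1 (fun x => wt σ x * pd v j x) D := fun j => hw.mul (hp j)
  have hcpd : ∀ {f : Eu n → ℝ}, ContDiffOn ℝ 1 f D → ∀ i, ContinuousOn (pd f i) D :=
    fun hf i => (hf.continuousOn_fderiv_of_isOpen hD le_rfl).clm_apply continuousOn_const
  have hQ : ContinuousOn (wlap σ v) D := continuousOn_finsetSum _ fun j _ => hcpd (hwp j) j
  have hda : ∀ {f : Eu n → ℝ}, ContDiffOn ℝ 1 f D → ∀ x ∈ D, DifferentiableAt ℝ f x :=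
    fun hf x hx => (hf.contDiffAt (hD.mem_nhds hx)).differentiableAt one_ne_zero
  have hsq : ContDiffOn ℝ 1 (fun x => ∑ j, pd v j x ^ 2) D :=
    ContDiffOn.sum fun j _ => (hp j).pow 2
  have hE : ContDiffOn ℝ 1 (fun x => wt σ x * ∑ j, pd v j x ^ 2) D := hw.mul hsq
  have hT : ∀ i j, ContDiffOn ℝ 1 (fun x => wt σ x * pd v j x * pd v i x) D := fun i j =>
    (hwp j).mul (hp i)
  have hzero : ∀ i, ∀ x ∈ D, pd v i x * wlap σ v x = 0 := by
    intro i
    have hae : ∀ᵐ x, x ∈ D → pd v i x * wlap σ v x = 0 := by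
      refine hD.ae_eq_zero_of_integral_contDiff_smul_eq_zero
        (((hcpd (hv.of_le (by norm_num)) i).mul hQ).locallyIntegrableOn hD.measurableSet)
        fun ψ hψ hψc hψD => ?_
      have hψ1 : ContDiff ℝ 1 ψ := hψ.of_le (mod_cast le_top)
      have hK := hψc.isCompact
      have hψ0 : ∀ x, x ∉ tsupport ψ → ψ x = 0 := fun x hx =>
        image_eq_zero_of_notMem_tsupport hx
      have hpψ0 : ∀ j x, x ∉ tsupport ψ → pd ψ j x = 0 := fun j x hx => by
        have : fderiv ℝ ψ x = 0 := by
          by_contra hne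
          exact hx (support_fderiv_subset ℝ hne)
        simp [pd, this]
      have hpc : ∀ j, Continuous (pd ψ j) := fun j =>
        (hψ1.continuous_fderiv one_ne_zero).clm_apply continuous_const
      have hint : ∀ {f g : Eu n → ℝ}, ContinuousOn f D → Continuous g →
          (∀ x, x ∉ tsupport ψ → g x = 0) → Integrable fun x => f x * g x := fun hf hg h0 =>
        integrable_of_continuousOn_of_support hK hψD (hf.mul hg.continuousOn)
          fun x hx => by rw [h0 x hx, mul_zero]
      have e1 := integral_mul_fderiv_of_compact hD hK hψD hE hψ1 hψ0 (EuclideanSpace.single i 1)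
      have e2 := fun j => integral_mul_fderiv_of_compact hD hK hψD (hT i j) hψ1 hψ0
        (EuclideanSpace.single j 1)
      have hst' := hst ψ hψ hψc hψD i
      simp only [phaseVar_smul_single (hψ1.differentiable one_ne_zero)] at hst'
      have i1 := hint hE.continuousOn (hpc i) (hpψ0 i)
      have i2 := fun j => hint (hT i j).continuousOn (hpc j) (hpψ0 j)
      have i1' := hint (hcpd hE i) hψ1.continuous hψ0
      have i2' := fun j => hint (hcpd (hT i j) j) hψ1.continuous hψ0
      have hc3 : ContinuousOn (fun x => (if i = 0 then (σ : ℝ) * x 0 ^ (σ - 1) else 0) *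
          (∑ j, pd v j x ^ 2)) D := by
        have : ContinuousOn (fun x => pd (wt σ) i x * ∑ j, pd v j x ^ 2) D :=
          (hcpd hw i).mul hsq.continuousOn
        refine this.congr fun x hx => ?_
        simp only [pd_wt σ (hDh hx)]
      have i3 := hint hc3 hψ1.continuous hψ0
      have i2s : Integrable fun x => ∑ j, wt σ x * pd v j x * pd v i x * pd ψ j x :=
        integrable_finsetSum _ fun j _ => i2 j
      have hst2 : ∫ x, ((wt σ x * ∑ j, pd v j x ^ 2) * pd ψ i x
          - 2 * ∑ j, wt σ x * pd v j x * pd v i x * pd ψ j x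
          + (if i = 0 then (σ : ℝ) * x 0 ^ (σ - 1) else 0) * (∑ j, pd v j x ^ 2) * ψ x) = 0 := by
        refine Eq.trans (integral_congr_ae (Eventually.of_forall fun x => ?_)) hst'
        simp only
        congr 3
        exact Finset.sum_congr rfl fun j _ => by ring
      have i4 : Integrable fun x => (wt σ x * ∑ j, pd v j x ^ 2) * pd ψ i x
          - 2 * ∑ j, wt σ x * pd v j x * pd v i x * pd ψ j x := i1.sub (i2s.const_mul 2)
      rw [integral_add i4 i3, integral_sub i1 (i2s.const_mul 2),
        integral_const_mul, integral_finsetSum _ fun j _ => i2 j, e1,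
        Finset.sum_congr rfl fun j _ => e2 j, Finset.sum_neg_distrib,
        ← integral_finsetSum _ fun j _ => i2' j] at hst2
      -- Pointwise divergence of the stress tensor: the terms `x₁^σ ∂ⱼv ∂ᵢⱼv` cancel by symmetry of
      -- second derivatives, and the derivative of the weight cancels against the explicit weight
      -- term of the variation.
      have hfin : ∫ x, (2 * (ψ x • (pd v i x * wlap σ v x))) =
          ∫ x, (-(pd (fun x => wt σ x * ∑ j, pd v j x ^ 2) i x * ψ x)
            + 2 * (∑ j, pd (fun x => wt σ x * pd v j x * pd v i x) j x * ψ x)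
            + (if i = 0 then (σ : ℝ) * x 0 ^ (σ - 1) else 0) * (∑ j, pd v j x ^ 2) * ψ x) := by
        refine integral_congr_ae (Eventually.of_forall fun x => ?_)
        simp only
        by_cases hx : x ∈ tsupport ψ
        · have hxD := hψD hx
          have hwx := hda hw x hxD
          have hpx := fun j => hda (hp j) x hxD
          have a1 : pd (fun x => wt σ x * ∑ j, pd v j x ^ 2) i x =
              wt σ x * (2 * ∑ j, pd v j x * pd (pd v j) i x) + (∑ j, pd v j x ^ 2) *
                (if i = 0 then (σ : ℝ) * x 0 ^ (σ - 1) else 0) := by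
            rw [pd_mul hwx (hda hsq x hxD), pd_wt σ (hDh hxD),
              pd_sum (f := fun j x => pd v j x ^ 2) _ fun j _ => (hpx j).pow 2]
            congr 2
            rw [Finset.mul_sum]
            refine Finset.sum_congr rfl fun j _ => ?_
            have : pd (fun x => pd v j x ^ 2) i x = pd (fun x => pd v j x * pd v j x) i x := by
              congr 1; funext y; ring
            rw [this, pd_mul (hpx j) (hpx j)]
            ring
          have a2 : ∀ j, pd (fun x => wt σ x * pd v j x * pd v i x) j x =
              wt σ x * (pd v j x * pd (pd v j) i x) +
                pd v i x * pd (fun x => wt σ x * pd v j x) j x := fun j => by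
            rw [pd_mul (f := fun x => wt σ x * pd v j x) (hda (hwp j) x hxD) (hpx i),
              pd_pd_comm hD hv i j hxD]
            ring
          rw [a1, ← Finset.sum_mul, Finset.sum_congr rfl fun j _ => a2 j, Finset.sum_add_distrib,
            ← Finset.mul_sum, ← Finset.mul_sum, wlap, smul_eq_mul]
          ring
        · simp [hψ0 x hx]
      have i2s' : Integrable fun x =>
          ∑ j, pd (fun x => wt σ x * pd v j x * pd v i x) j x * ψ x :=
        integrable_finsetSum _ fun j _ => i2' j
      have i5 : Integrable fun x => -(pd (fun x => wt σ x * ∑ j, pd v j x ^ 2) i x * ψ x) :=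
        i1'.neg
      have i6 : Integrable fun x => -(pd (fun x => wt σ x * ∑ j, pd v j x ^ 2) i x * ψ x)
            + 2 * (∑ j, pd (fun x => wt σ x * pd v j x * pd v i x) j x * ψ x) :=
        i5.add (i2s'.const_mul 2)
      rw [integral_const_mul, integral_add i6 i3, integral_add i5 (i2s'.const_mul 2), integral_neg, integral_const_mul] at hfin
      linarith
    have := Measure.eqOn_open_of_ae_eq (μ := volume) (f := fun x => pd v i x * wlap σ v x)
      (g := fun _ => 0) ((ae_restrict_iff' hD.measurableSet).2 hae) hD
      ((hcpd (hv.of_le (by norm_num)) i).mul hQ) continuousOn_const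
    exact this
  intro x hx
  by_contra hne
  have hev : ∀ᶠ y in 𝓝 x, wlap σ v y ≠ 0 ∧ y ∈ D :=
    ((hQ.continuousAt (hD.mem_nhds hx)).eventually_ne hne).and (hD.mem_nhds hx)
  refine hne (Finset.sum_eq_zero fun j _ => ?_)
  have : (fun x => wt σ x * pd v j x) =ᶠ[𝓝 x] fun _ => 0 := by
    filter_upwards [hev] with y hy
    rw [(mul_eq_zero.1 (hzero j y hy.2)).resolve_right hy.1, mul_zero]
  rw [pd, this.fderiv_eq]
  simp

end weight

/-! ### A single phase -/

section phase

variable [NeZero n]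

/-- The positive part of `v` is one phase of a solution, with weight `x₁^σ`. -/
structure IsPhase (Ω : Set (Eu n)) (σ : ℤ) (v : Eu n → ℝ) : Prop where
  continuousOn : ContinuousOn v (offAxis Ω)
  contDiffOn : ContDiffOn ℝ 2 v (offAxis Ω ∩ {x | 0 < v x})
  aestronglyMeasurable : AEStronglyMeasurable (posGrad v) (volume.restrict (offAxis Ω))
  integrable_grad : IntegrableOn (fun x => wt σ x * ‖posGrad v x‖ ^ 2) (offAxis Ω)
  integrable : IntegrableOn (fun x => wt σ x * pos v x ^ 2) (offAxis Ω)
  axis : ∀ x ∈ Ω, x 0 = 0 →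
    Tendsto (fun x => wt σ x * pos v x * posGrad v x 0) (𝓝[offAxis Ω] x) (𝓝 0)
  bounded : ∀ x ∈ Ω, x 0 = 0 → ∃ C, ∀ᶠ y in 𝓝[offAxis Ω] x, wt σ y * pos v y ^ 2 ≤ C
  equation : ∀ x ∈ offAxis Ω ∩ {x | 0 < v x}, wlap σ v x = 0

variable {Ω : Set (Eu n)} {x₀ : Eu n} {σ : ℤ} {v : Eu n → ℝ}

omit [NeZero n] in
theorem pos_nonneg (v : Eu n → ℝ) (x : Eu n) : 0 ≤ pos v x := le_max_right _ _

theorem IsPhase.aesm_wt (hΩ : IsHalfSpaceDomain Ω) (σ : ℤ) :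
    AEStronglyMeasurable (wt σ : Eu n → ℝ) (volume.restrict (offAxis Ω)) :=
  ((contDiffOn_wt σ).continuousOn.mono inter_subset_right).aestronglyMeasurable
    (isOpen_offAxis hΩ).measurableSet

theorem IsPhase.aesm_pos (hΩ : IsHalfSpaceDomain Ω) (hv : IsPhase Ω σ v) :
    AEStronglyMeasurable (pos v) (volume.restrict (offAxis Ω)) :=
  (continuousOn_pos hv.continuousOn).aestronglyMeasurable (isOpen_offAxis hΩ).measurableSet

theorem IsPhase.aesm_grad (hv : IsPhase Ω σ v) (i : Fin n) :
    AEStronglyMeasurable (fun x => posGrad v x i) (volume.restrict (offAxis Ω)) :=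
  (EuclideanSpace.proj (𝕜 := ℝ) i : Eu n →L[ℝ] ℝ).continuous.comp_aestronglyMeasurable
    hv.aestronglyMeasurable

theorem IsPhase.integrable_mixed (hΩ : IsHalfSpaceDomain Ω) (hv : IsPhase Ω σ v) (i : Fin n) :
    IntegrableOn (fun x => wt σ x * pos v x * posGrad v x i) (offAxis Ω) := by
  refine Integrable.mono (hv.integrable.add hv.integrable_grad)
    (((IsPhase.aesm_wt hΩ σ).mul (hv.aesm_pos hΩ)).mul (hv.aesm_grad i)) ?_
  filter_upwards [ae_restrict_mem (isOpen_offAxis hΩ).measurableSet] with x hx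
  have hw := wt_pos σ hx.2
  have h1 := abs_apply_le_norm (posGrad v x) i
  have h2 := pos_nonneg v x
  rw [norm_mul, norm_mul, Real.norm_of_nonneg hw.le, Real.norm_of_nonneg h2, Pi.add_apply,
    Real.norm_eq_abs, ← mul_add, mul_assoc]
  refine (mul_le_mul_of_nonneg_left ?_ hw.le).trans (le_abs_self _)
  nlinarith [sq_nonneg (pos v x - ‖posGrad v x‖), norm_nonneg (posGrad v x),
    mul_le_mul_of_nonneg_left h1 h2]

omit [NeZero n] in
theorem integral_mul_tendsto {U : Set (Eu n)} (hU : MeasurableSet U) {a : Eu n → ℝ}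
    (ha : Continuous a) (hac : HasCompactSupport a) {f : ℕ → Eu n → ℝ} {h : Eu n → ℝ}
    (hh : IntegrableOn h U) (hm : ∀ k, AEStronglyMeasurable (f k) (volume.restrict U))
    (hb : ∀ k, ∀ x ∈ U, |f k x| ≤ |h x|)
    (ht : ∀ x ∈ U, Tendsto (fun k => f k x) atTop (𝓝 (h x))) :
    (∀ k, IntegrableOn (fun x => a x * f k x) U) ∧ IntegrableOn (fun x => a x * h x) U ∧
    Tendsto (fun k => ∫ x in U, a x * f k x) atTop (𝓝 (∫ x in U, a x * h x)) := by
  obtain ⟨C, hC⟩ := hac.exists_bound_of_continuous ha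
  have hah : IntegrableOn (fun x => a x * h x) U :=
    hh.bdd_mul (c := C) ha.aestronglyMeasurable (Eventually.of_forall hC)
  have hle : ∀ k, ∀ᵐ x ∂(volume.restrict U), ‖a x * f k x‖ ≤ ‖a x * h x‖ := fun k => by
    filter_upwards [ae_restrict_mem hU] with x hx
    rw [norm_mul, norm_mul]
    exact mul_le_mul_of_nonneg_left (hb k x hx) (norm_nonneg _)
  refine ⟨fun k => Integrable.mono hah (ha.aestronglyMeasurable.mul (hm k)) (hle k), hah,
    tendsto_integral_of_dominated_convergence _ (fun k => ha.aestronglyMeasurable.mul (hm k))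
      hah.norm hle ?_⟩
  filter_upwards [ae_restrict_mem hU] with x hx
  exact (ht x hx).const_mul _

omit [NeZero n] in
theorem hasCompactSupport_of_tsupport_subset_ball {Z : Eu n → ℝ} {R : ℝ}
    (hZR : tsupport Z ⊆ Metric.ball x₀ R) : HasCompactSupport Z :=
  (isCompact_closedBall x₀ R).of_isClosed_subset (isClosed_tsupport Z)
    (hZR.trans Metric.ball_subset_closedBall)

theorem abs_le_abs_of_factor {c h : ℝ} (h0 : 0 ≤ c) (h1 : c ≤ 1) : |c * h| ≤ |h| := by
  rw [abs_mul, abs_of_nonneg h0]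
  exact mul_le_of_le_one_left (abs_nonneg _) h1

theorem IsPhase.contDiffOn_one (hv : IsPhase Ω σ v) :
    ContDiffOn ℝ 1 v (offAxis Ω ∩ {x | 0 < v x}) := hv.contDiffOn.of_le (by norm_num)

omit [NeZero n] in
theorem trunc_mul_posGrad_abs_le (k : ℕ) (x : Eu n) (c : ℝ) :
    |trunc k (v x) * c| ≤ |pos v x * c| := by
  rw [abs_mul, abs_mul, abs_of_nonneg (trunc_nonneg _ _), abs_of_nonneg (pos_nonneg v x)]
  exact mul_le_mul_of_nonneg_right (trunc_le _ _) (abs_nonneg _)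

omit [NeZero n] in
theorem trunc_mul_pd (k : ℕ) (x : Eu n) (i : Fin n) (c : ℝ) :
    trunc k (v x) * (c * pd v i x) = trunc k (v x) * (c * posGrad v x i) := by
  rcases lt_or_ge 0 (v x) with h | h
  · rw [posGrad_apply_of_pos h]
  · rw [trunc_eq_zero_of_nonpos h, zero_mul, zero_mul]

/-- The divergence theorem is applied to `trunc k v · x₁^σ ∇v`, which is `C¹` across the free
boundary. By the equation its divergence is `truncDeriv k v · x₁^σ |∇v|²`, and its first component
is dominated by the quantity that the axis condition sends to `0`. Then `k → ∞`. -/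
theorem IsPhase.energy_test (hΩ : IsHalfSpaceDomain Ω) (hx₀ : x₀ ∈ Ω) (hv : IsPhase Ω σ v)
    {R : ℝ} (hR : R ∈ radii Ω x₀) {Z : Eu n → ℝ} (hZ : ContDiff ℝ 1 Z)
    (hZR : tsupport Z ⊆ Metric.ball x₀ R) :
    ∫ x in offAxis Ω, (Z x * (wt σ x * ‖posGrad v x‖ ^ 2) +
      ∑ i, pd Z i x * (wt σ x * pos v x * posGrad v x i)) = 0 := by
  have hUo := isOpen_offAxis hΩ
  have hUm := hUo.measurableSet
  have hZc := hasCompactSupport_of_tsupport_subset_ball hZR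
  have hsub := halfBall_subset_offAxis hΩ hx₀ hR
  have hD := isOpen_posSet hUo hv.continuousOn
  have hDh : offAxis Ω ∩ {x | 0 < v x} ⊆ openHalf n := fun x hx => hx.1.2
  have hwp : ∀ i, ContDiffOn ℝ 1 (fun x => wt σ x * pd v i x) (offAxis Ω ∩ {x | 0 < v x}) :=
    fun i => ((contDiffOn_wt σ).mono hDh).mul (contDiffOn_pd hD hv.contDiffOn i)
  set V : ℕ → Fin n → Eu n → ℝ := fun k i x => trunc k (v x) * (wt σ x * pd v i x) with hVdef
  have hV : ∀ k i, ContDiffOn ℝ 1 (V k i) (offAxis Ω) := fun k i =>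
    contDiffOn_mul_of_trunc hUo hv.continuousOn (contDiff_trunc k)
      (show (0 : ℝ) < 1 / ((k : ℝ) + 1) by positivity) (fun t ht => trunc_eq_zero ht)
      hv.contDiffOn_one (hwp i)
  have hVeq : ∀ k i x, V k i x = trunc k (v x) * (wt σ x * posGrad v x i) := fun k i x =>
    trunc_mul_pd k x i _
  have hVle : ∀ k i x, |V k i x| ≤ |wt σ x * pos v x * posGrad v x i| := fun k i x => by
    rw [hVeq]
    refine (trunc_mul_posGrad_abs_le k x _).trans (le_of_eq ?_)
    congr 1
    ring
  have hdiv : ∀ k, ∀ x ∈ offAxis Ω, ∑ i, pd (V k i) i x =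
      truncDeriv k (v x) * (wt σ x * ‖posGrad v x‖ ^ 2) := fun k x hx => by
    rcases lt_or_ge 0 (v x) with h | h
    · have hxD : x ∈ offAxis Ω ∩ {x | 0 < v x} := ⟨hx, h⟩
      have h1 : DifferentiableAt ℝ (fun x => trunc k (v x)) x :=
        ((contDiffOn_trunc_comp hUo hv.continuousOn hv.contDiffOn_one k).contDiffAt
          (hUo.mem_nhds hx)).differentiableAt one_ne_zero
      have h2 : ∀ i, pd (V k i) i x = trunc k (v x) * pd (fun x => wt σ x * pd v i x) i x +
          truncDeriv k (v x) * wt σ x * posGrad v x i ^ 2 := fun i => by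
        rw [hVdef]
        simp only
        rw [pd_mul h1 (((hwp i).contDiffAt (hD.mem_nhds hxD)).differentiableAt one_ne_zero),
          pd_trunc_comp hUo hv.continuousOn hv.contDiffOn_one k i hx, posGrad_apply_of_pos h]
        ring
      have h3 := hv.equation x hxD
      rw [wlap] at h3
      rw [Finset.sum_congr rfl fun i _ => h2 i, Finset.sum_add_distrib, ← Finset.mul_sum, h3,
        ← Finset.mul_sum, EuclideanSpace.real_norm_sq_eq]
      ring
    · rw [posGrad_of_nonpos h]
      have : ∀ i, V k i =ᶠ[𝓝 x] fun _ => 0 := fun i => by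
        filter_upwards [(hv.continuousOn.continuousAt (hUo.mem_nhds hx)).eventually_lt
          continuousAt_const (lt_of_le_of_lt h (show (0 : ℝ) < 1 / ((k : ℝ) + 1) by positivity))]
          with y hy
        simp only [hVdef, trunc_eq_zero hy.le, zero_mul]
      simp [pd, (this _).fderiv_eq]
  have hmV : ∀ k i, AEStronglyMeasurable (V k i) (volume.restrict (offAxis Ω)) := fun k i =>
    (hV k i).continuousOn.aestronglyMeasurable hUm
  have hmd : ∀ k, AEStronglyMeasurable (fun x => truncDeriv k (v x) *
      (wt σ x * ‖posGrad v x‖ ^ 2)) (volume.restrict (offAxis Ω)) := fun k =>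
    (((continuous_truncDeriv k).comp_continuousOn hv.continuousOn).aestronglyMeasurable hUm).mul
      hv.integrable_grad.aestronglyMeasurable
  have hid : ∀ k, IntegrableOn (fun x => truncDeriv k (v x) * (wt σ x * ‖posGrad v x‖ ^ 2))
      (offAxis Ω) := fun k =>
    Integrable.mono hv.integrable_grad (hmd k) (Eventually.of_forall fun x =>
      abs_le_abs_of_factor (truncDeriv_nonneg _ _) (truncDeriv_le_one _ _))
  have htest : ∀ k, ∫ x in offAxis Ω, (Z x * (truncDeriv k (v x) *
      (wt σ x * ‖posGrad v x‖ ^ 2)) + ∑ i, pd Z i x * V k i x) = 0 := fun k => by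
    refine Eq.trans (setIntegral_congr_fun hUm fun x hx => ?_)
      (integral_divergence hΩ hx₀ (hV k) hR (fun i => ?_) ?_ ?_ hZ hZR)
    · simp only [hdiv k x hx]
    · exact IntegrableOn.mono_set (Integrable.mono (hv.integrable_mixed hΩ i) (hmV k i)
        (Eventually.of_forall fun x => hVle k i x)) hsub
    · exact ((hid k).mono_set hsub).congr_fun (fun x hx => (hdiv k x (hsub hx)).symm)
        (measurableSet_halfBall x₀ R)
    · intro x hx hx0
      have := (hv.axis x hx hx0).abs
      rw [abs_zero] at this
      exact squeeze_zero_norm (fun y => hVle k 0 y) this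
  have hcontZ : ∀ i, Continuous (pd Z i) := fun i =>
    (hZ.continuous_fderiv one_ne_zero).clm_apply continuous_const
  have hpc : ∀ i, HasCompactSupport (pd Z i) := fun i => hZc.fderiv_apply ℝ _
  obtain ⟨A1, A2, A3⟩ := integral_mul_tendsto hUm hZ.continuous hZc hv.integrable_grad hmd
    (fun k x _ => abs_le_abs_of_factor (truncDeriv_nonneg _ _) (truncDeriv_le_one _ _))
    (fun x _ => by
      rcases lt_or_ge 0 (v x) with h | h
      · simpa using (tendsto_truncDeriv h).mul_const (wt σ x * ‖posGrad v x‖ ^ 2)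
      · simp [posGrad_of_nonpos h])
  have hB := fun i => integral_mul_tendsto hUm (hcontZ i) (hpc i) (hv.integrable_mixed hΩ i)
    (fun k => hmV k i) (fun k x _ => hVle k i x) (fun x _ => by
      have := (tendsto_trunc (v x)).mul_const (wt σ x * posGrad v x i)
      simp only [hVeq]
      convert this using 2
      rw [pos]
      ring)
  have hlim : Tendsto (fun k => ∫ x in offAxis Ω, (Z x * (truncDeriv k (v x) *
      (wt σ x * ‖posGrad v x‖ ^ 2)) + ∑ i, pd Z i x * V k i x)) atTop
      (𝓝 (∫ x in offAxis Ω, (Z x * (wt σ x * ‖posGrad v x‖ ^ 2) +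
      ∑ i, pd Z i x * (wt σ x * pos v x * posGrad v x i)))) := by
    rw [integral_add A2 (integrable_finsetSum _ fun i _ => (hB i).2.1),
      integral_finsetSum _ fun i _ => (hB i).2.1]
    refine (A3.add (tendsto_finsetSum _ fun i _ => (hB i).2.2)).congr fun k => ?_
    rw [integral_add (A1 k) (integrable_finsetSum _ fun i _ => (hB i).1 k),
      integral_finsetSum _ fun i _ => (hB i).1 k]
  simp only [htest] at hlim
  exact (tendsto_nhds_unique hlim tendsto_const_nhds)

end phase

/-! ### The field `x₁^σ v² (x - x₀)` and its weak divergence identity -/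

section phase

variable [NeZero n] {Ω : Set (Eu n)} {x₀ : Eu n} {σ : ℤ} {v : Eu n → ℝ}

omit [NeZero n] in
theorem contDiff_sub_coord (x₀ : Eu n) (i : Fin n) : ContDiff ℝ 1 (fun x : Eu n => x i - x₀ i) :=
  (contDiff_piLp_apply (p := 2)).sub contDiff_const

omit [NeZero n] in
theorem pd_sub_coord (x₀ : Eu n) (i j : Fin n) (x : Eu n) :
    pd (fun x : Eu n => x i - x₀ i) j x = if i = j then 1 else 0 := by
  rw [pd, ((hasFDerivAt_coord i x).sub_const (x₀ i)).fderiv, ← (hasFDerivAt_coord i x).fderiv]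
  exact pd_coord i j x

/-- Euler's identity for the weight: `div (x₁^σ (x - x₀)) = (n + σ) x₁^σ` for `x₀` on the axis. -/
theorem sum_pd_wt_mul_sub (hx₀ : x₀ 0 = 0) (σ : ℤ) {x : Eu n} (hx : 0 < x 0) :
    ∑ i, pd (fun x => wt σ x * (x i - x₀ i)) i x = ((n : ℝ) + σ) * wt σ x := by
  have hw : DifferentiableAt ℝ (wt σ) x :=
    ((contDiffOn_wt σ).contDiffAt (isOpen_openHalf.mem_nhds hx)).differentiableAt one_ne_zero
  have h : ∀ i, pd (fun x => wt σ x * (x i - x₀ i)) i x =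
      wt σ x + if i = 0 then σ * wt σ x else 0 := fun i => by
    rw [pd_mul hw ((contDiff_sub_coord x₀ i).differentiable one_ne_zero x), pd_sub_coord,
      pd_wt σ hx]
    by_cases hi : i = 0
    · subst hi
      have : wt σ x = x 0 * x 0 ^ (σ - 1) := by
        rw [wt, ← zpow_one_add₀ hx.ne']; congr 1; ring
      simp [hx₀, this]
      ring
    · simp [hi]
  rw [Finset.sum_congr rfl fun i _ => h i, Finset.sum_add_distrib]
  simp
  ring

/-- The divergence theorem for `trunc k v ² · x₁^σ (x - x₀)`, followed by `k → ∞`. That `x₀` lies on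
the axis is used twice: in Euler's identity for the weight, and to make the first component at most
`x₁ · (x₁^σ v²)`, which tends to `0` at the axis because the second factor is bounded. -/
theorem IsPhase.boundary_test (hΩ : IsHalfSpaceDomain Ω) (hx₀ : x₀ ∈ Ω) (hx₀' : x₀ 0 = 0)
    (hv : IsPhase Ω σ v) {R : ℝ} (hR : R ∈ radii Ω x₀) {Z : Eu n → ℝ} (hZ : ContDiff ℝ 1 Z)
    (hZR : tsupport Z ⊆ Metric.ball x₀ R) :
    ∫ x in offAxis Ω, (Z x * (((n : ℝ) + σ) * (wt σ x * pos v x ^ 2) +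
        2 * ∑ i, (wt σ x * pos v x * posGrad v x i) * (x i - x₀ i)) +
      ∑ i, pd Z i x * ((wt σ x * pos v x ^ 2) * (x i - x₀ i))) = 0 := by
  have hUo := isOpen_offAxis hΩ
  have hUm := hUo.measurableSet
  have hZc := hasCompactSupport_of_tsupport_subset_ball hZR
  have hsub := halfBall_subset_offAxis hΩ hx₀ hR
  set f : ℕ → Eu n → ℝ := fun k x => wt σ x * trunc k (v x) ^ 2 with hf
  set g : ℕ → Fin n → Eu n → ℝ := fun k i x =>
    truncDeriv k (v x) * (trunc k (v x) * (wt σ x * posGrad v x i)) with hg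
  set V : ℕ → Fin n → Eu n → ℝ := fun k i x =>
    trunc k (v x) * trunc k (v x) * (wt σ x * (x i - x₀ i)) with hVdef
  have hT : ∀ k, ContDiffOn ℝ 1 (fun x => trunc k (v x)) (offAxis Ω) := fun k =>
    contDiffOn_trunc_comp hUo hv.continuousOn hv.contDiffOn_one k
  have hwy : ∀ i, ContDiffOn ℝ 1 (fun x => wt σ x * (x i - x₀ i)) (offAxis Ω) := fun i =>
    ((contDiffOn_wt σ).mono inter_subset_right).mul (contDiff_sub_coord x₀ i).contDiffOn
  have hV : ∀ k i, ContDiffOn ℝ 1 (V k i) (offAxis Ω) := fun k i =>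
    ((hT k).mul (hT k)).mul (hwy i)
  have hVf : ∀ k i x, V k i x = (x i - x₀ i) * f k x := fun k i x => by
    simp only [hVdef, hf]; ring
  have hmf : ∀ k, AEStronglyMeasurable (f k) (volume.restrict (offAxis Ω)) := fun k =>
    (IsPhase.aesm_wt hΩ σ).mul (((hT k).continuousOn.pow 2).aestronglyMeasurable hUm)
  have hmg : ∀ k i, AEStronglyMeasurable (g k i) (volume.restrict (offAxis Ω)) := fun k i =>
    (((continuous_truncDeriv k).comp_continuousOn hv.continuousOn).aestronglyMeasurable hUm).mul
      (((hT k).continuousOn.aestronglyMeasurable hUm).mul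
        ((IsPhase.aesm_wt hΩ σ).mul (hv.aesm_grad i)))
  have hfle : ∀ k, ∀ x ∈ offAxis Ω, |f k x| ≤ |wt σ x * pos v x ^ 2| := fun k x hx => by
    have hw := wt_pos σ hx.2
    rw [abs_mul, abs_mul, abs_pow, abs_pow, abs_of_nonneg (trunc_nonneg _ _),
      abs_of_nonneg (pos_nonneg v x)]
    exact mul_le_mul_of_nonneg_left (pow_le_pow_left₀ (trunc_nonneg _ _) (trunc_le _ _) 2)
      (abs_nonneg _)
  have hgle : ∀ k i, ∀ x ∈ offAxis Ω, |g k i x| ≤ |wt σ x * pos v x * posGrad v x i| :=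
    fun k i x _ => by
      refine (abs_le_abs_of_factor (truncDeriv_nonneg _ _) (truncDeriv_le_one _ _)).trans
        ((trunc_mul_posGrad_abs_le k x _).trans (le_of_eq ?_))
      congr 1
      ring
  have hflim : ∀ x ∈ offAxis Ω, Tendsto (fun k => f k x) atTop (𝓝 (wt σ x * pos v x ^ 2)) :=
    fun x _ => ((tendsto_trunc (v x)).pow 2).const_mul _
  have hglim : ∀ i, ∀ x ∈ offAxis Ω, Tendsto (fun k => g k i x) atTop
      (𝓝 (wt σ x * pos v x * posGrad v x i)) := fun i x _ => by
    rcases lt_or_ge 0 (v x) with h | h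
    · have := (tendsto_truncDeriv h).mul ((tendsto_trunc (v x)).mul_const (wt σ x * posGrad v x i))
      convert this using 2
      rw [pos]
      ring
    · simp [hg, posGrad_of_nonpos h]
  have hdiv : ∀ k, ∀ x ∈ offAxis Ω, ∑ i, pd (V k i) i x =
      ((n : ℝ) + σ) * f k x + 2 * ∑ i, g k i x * (x i - x₀ i) := fun k x hx => by
    have hda : ∀ {f : Eu n → ℝ}, ContDiffOn ℝ 1 f (offAxis Ω) → DifferentiableAt ℝ f x :=
      fun hf => (hf.contDiffAt (hUo.mem_nhds hx)).differentiableAt one_ne_zero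
    have h1 : ∀ i, pd (V k i) i x = trunc k (v x) ^ 2 * pd (fun x => wt σ x * (x i - x₀ i)) i x +
        2 * (g k i x * (x i - x₀ i)) := fun i => by
      have h2 : pd (fun x => trunc k (v x) * trunc k (v x)) i x =
          2 * trunc k (v x) * (truncDeriv k (v x) * posGrad v x i) := by
        rw [pd_mul (hda (hT k)) (hda (hT k)),
          pd_trunc_comp hUo hv.continuousOn hv.contDiffOn_one k i hx]
        ring
      rw [hVdef]
      simp only
      rw [pd_mul (f := fun x => trunc k (v x) * trunc k (v x)) (hda ((hT k).mul (hT k)))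
        (hda (hwy i)), h2, hg]
      ring
    rw [Finset.sum_congr rfl fun i _ => h1 i, Finset.sum_add_distrib, ← Finset.mul_sum,
      ← Finset.mul_sum, sum_pd_wt_mul_sub hx₀' σ hx.2, hf]
    ring
  have hfi : ∀ k, IntegrableOn (f k) (halfBall x₀ R) := fun k =>
    IntegrableOn.mono_set (Integrable.mono hv.integrable (hmf k) (by
      filter_upwards [ae_restrict_mem hUm] with x hx using hfle k x hx)) hsub
  have hgi : ∀ k i, IntegrableOn (g k i) (halfBall x₀ R) := fun k i =>
    IntegrableOn.mono_set (Integrable.mono (hv.integrable_mixed hΩ i) (hmg k i) (by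
      filter_upwards [ae_restrict_mem hUm] with x hx using hgle k i x hx)) hsub
  have hyb : ∀ i, ∀ᵐ x ∂(volume.restrict (halfBall x₀ R)), ‖x i - x₀ i‖ ≤ R := fun i => by
    filter_upwards [ae_restrict_mem (measurableSet_halfBall x₀ R)] with x hx
    have h1 : ‖x - x₀‖ < R := by simpa [dist_eq_norm] using hx.1
    exact (abs_apply_le_norm (x - x₀) i).trans h1.le
  have hym : ∀ i, AEStronglyMeasurable (fun x : Eu n => x i - x₀ i)
      (volume.restrict (halfBall x₀ R)) := fun i =>
    (contDiff_sub_coord x₀ i).continuous.aestronglyMeasurable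
  have htest : ∀ k, ∫ x in offAxis Ω, (Z x * (((n : ℝ) + σ) * f k x +
      2 * ∑ i, g k i x * (x i - x₀ i)) + ∑ i, pd Z i x * V k i x) = 0 := fun k => by
    refine Eq.trans (setIntegral_congr_fun hUm fun x hx => ?_)
      (integral_divergence hΩ hx₀ (hV k) hR (fun i => ?_) ?_ ?_ hZ hZR)
    · simp only [hdiv k x hx]
    · exact ((hfi k).bdd_mul (c := R) (hym i) (hyb i)).congr
        (Eventually.of_forall fun x => (hVf k i x).symm)
    · have : IntegrableOn (fun x => ((n : ℝ) + σ) * f k x + 2 * ∑ i, g k i x * (x i - x₀ i))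
          (halfBall x₀ R) :=
        ((hfi k).const_mul _).add ((integrable_finsetSum _ fun i _ =>
          (hgi k i).mul_bdd (c := R) (hym i) (hyb i)).const_mul 2)
      exact this.congr_fun (fun x hx => (hdiv k x (hsub hx)).symm) (measurableSet_halfBall x₀ R)
    · intro x hx hx0
      obtain ⟨C, hC⟩ := hv.bounded x hx hx0
      have hl : Tendsto (fun y : Eu n => y 0 * C) (𝓝[offAxis Ω] x) (𝓝 0) := by
        have : Continuous fun y : Eu n => y 0 * C := by fun_prop
        simpa [hx0] using (this.tendsto x).mono_left nhdsWithin_le_nhds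
      refine squeeze_zero_norm' ?_ hl
      filter_upwards [hC, self_mem_nhdsWithin] with y hy hyU
      have hw := wt_pos σ hyU.2
      have hy0 : 0 < y 0 := hyU.2
      rw [hVf, hx₀', sub_zero, norm_mul, Real.norm_of_nonneg hy0.le]
      refine mul_le_mul_of_nonneg_left ((hfle k y hyU).trans ?_) hy0.le
      rwa [abs_of_nonneg (by positivity)]
  have hcontZ : ∀ i, Continuous (pd Z i) := fun i =>
    (hZ.continuous_fderiv one_ne_zero).clm_apply continuous_const
  have hpc : ∀ i, HasCompactSupport (pd Z i) := fun i => hZc.fderiv_apply ℝ _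
  have hcy : ∀ i, Continuous fun x : Eu n => x i - x₀ i := fun i =>
    (contDiff_sub_coord x₀ i).continuous
  obtain ⟨A1, A2, A3⟩ := integral_mul_tendsto hUm hZ.continuous hZc hv.integrable hmf hfle hflim
  have hB := fun i => integral_mul_tendsto hUm (hZ.continuous.mul (hcy i)) hZc.mul_right
    (hv.integrable_mixed hΩ i) (fun k => hmg k i) (fun k => hgle k i) (hglim i)
  have hC := fun i => integral_mul_tendsto hUm ((hcontZ i).mul (hcy i)) (hpc i).mul_right
    hv.integrable hmf hfle hflim
  have hexp : ∀ (F : Eu n → ℝ) (G : Fin n → Eu n → ℝ),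
      IntegrableOn (fun x => Z x * F x) (offAxis Ω) →
      (∀ i, IntegrableOn (fun x => (Z * fun x : Eu n => x i - x₀ i) x * G i x) (offAxis Ω)) →
      (∀ i, IntegrableOn (fun x => (pd Z i * fun x : Eu n => x i - x₀ i) x * F x) (offAxis Ω)) →
      ∫ x in offAxis Ω, (Z x * (((n : ℝ) + σ) * F x + 2 * ∑ i, G i x * (x i - x₀ i)) +
        ∑ i, pd Z i x * (F x * (x i - x₀ i))) =
      ((n : ℝ) + σ) * (∫ x in offAxis Ω, Z x * F x) +
        2 * (∑ i, ∫ x in offAxis Ω, (Z * fun x : Eu n => x i - x₀ i) x * G i x) +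
        ∑ i, ∫ x in offAxis Ω, (pd Z i * fun x : Eu n => x i - x₀ i) x * F x := by
    intro F G h1 h2 h3
    have h4 : IntegrableOn (fun a => ((n : ℝ) + σ) * (Z a * F a) +
        2 * ∑ i, (Z * fun x : Eu n => x i - x₀ i) a * G i a) (offAxis Ω) :=
      (h1.const_mul _).add ((integrable_finsetSum _ fun i _ => h2 i).const_mul 2)
    rw [← integral_finsetSum _ fun i _ => h2 i, ← integral_finsetSum _ fun i _ => h3 i,
      ← integral_const_mul, ← integral_const_mul, ← integral_add (h1.const_mul _)
        ((integrable_finsetSum _ fun i _ => h2 i).const_mul 2), ← integral_add h4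
        (integrable_finsetSum _ fun i _ => h3 i)]
    refine integral_congr_ae (Eventually.of_forall fun x => ?_)
    simp only [Pi.mul_apply, mul_add, Finset.mul_sum]
    congr 1
    · congr 1
      · ring
      · exact Finset.sum_congr rfl fun i _ => by ring
    · exact Finset.sum_congr rfl fun i _ => by ring
  have hlim : Tendsto (fun k => ∫ x in offAxis Ω, (Z x * (((n : ℝ) + σ) * f k x +
      2 * ∑ i, g k i x * (x i - x₀ i)) + ∑ i, pd Z i x * (f k x * (x i - x₀ i)))) atTop
      (𝓝 (∫ x in offAxis Ω, (Z x * (((n : ℝ) + σ) * (wt σ x * pos v x ^ 2) +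
        2 * ∑ i, (wt σ x * pos v x * posGrad v x i) * (x i - x₀ i)) +
      ∑ i, pd Z i x * ((wt σ x * pos v x ^ 2) * (x i - x₀ i))))) := by
    rw [hexp _ _ A2 (fun i => (hB i).2.1) (fun i => (hC i).2.1)]
    refine Tendsto.congr (fun k => (hexp _ _ (A1 k) (fun i => (hB i).1 k)
      (fun i => (hC i).1 k)).symm) ?_
    exact ((A3.const_mul _).add ((tendsto_finsetSum _ fun i _ => (hB i).2.2).const_mul 2)).add
      (tendsto_finsetSum _ fun i _ => (hC i).2.2)
  have hV' : ∀ k i x, f k x * (x i - x₀ i) = V k i x := fun k i x => by rw [hVf]; ring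
  simp only [hV', htest] at hlim
  exact tendsto_nhds_unique hlim tendsto_const_nhds

end phase

/-! ### Bounds near the axis -/

section axis

variable [NeZero n] {Ω : Set (Eu n)} {v : Eu n → ℝ}

/-- The point `x` with its first coordinate replaced by `t`. -/
def lift (x : Eu n) (t : ℝ) : Eu n := x + (t - x 0) • EuclideanSpace.single 0 (1 : ℝ)

theorem lift_zero (x : Eu n) (t : ℝ) : lift x t 0 = t := by simp [lift]

theorem lift_of_ne (x : Eu n) (t : ℝ) {i : Fin n} (hi : i ≠ 0) : lift x t i = x i := by
  simp [lift, hi]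

theorem lift_self (x : Eu n) : lift x (x 0) = x := by simp [lift]

theorem lift_lift (x : Eu n) (s t : ℝ) : lift (lift x s) t = lift x t := by
  ext i
  by_cases hi : i = 0
  · subst hi; simp [lift_zero]
  · simp [lift_of_ne _ _ hi]

theorem norm_lift_sub_le (x z : Eu n) (t : ℝ) : ‖lift x t - z‖ ≤ ‖x - z‖ + |t - x 0| := by
  have : lift x t - z = (x - z) + (t - x 0) • EuclideanSpace.single 0 (1 : ℝ) := by
    rw [lift]; abel
  rw [this]
  refine (norm_add_le _ _).trans ?_
  rw [norm_smul]
  simp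

theorem exists_closedBall_subset (hΩ : IsHalfSpaceDomain Ω) {x : Eu n} (hx : x ∈ Ω) :
    ∃ ρ > 0, Metric.closedBall x ρ ∩ closedHalf n ⊆ Ω := by
  obtain ⟨O, hO, rfl⟩ := hΩ.relOpen
  obtain ⟨ρ, hρ, h⟩ := Metric.nhds_basis_closedBall.mem_iff.1 (hO.mem_nhds hx.1)
  exact ⟨ρ, hρ, inter_subset_inter_left _ h⟩

theorem hasDerivAt_trunc_sq_lift (hΩ : IsHalfSpaceDomain Ω) (hv : ContinuousOn v (offAxis Ω))
    (hv1 : ContDiffOn ℝ 1 v (offAxis Ω ∩ {x | 0 < v x})) (k : ℕ) (x : Eu n) {t : ℝ}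
    (ht : lift x t ∈ offAxis Ω) :
    HasDerivAt (fun t => trunc k (v (lift x t)) ^ 2)
      (2 * trunc k (v (lift x t)) * (truncDeriv k (v (lift x t)) * posGrad v (lift x t) 0)) t := by
  have hUo := isOpen_offAxis hΩ
  have h1 : HasDerivAt (fun t => lift x t) (EuclideanSpace.single 0 (1 : ℝ) : Eu n) t := by
    have := (((hasDerivAt_id t).sub_const (x 0)).smul_const
      (EuclideanSpace.single 0 (1 : ℝ) : Eu n)).const_add x
    simpa [lift] using this
  have h2 : DifferentiableAt ℝ (fun x => trunc k (v x)) (lift x t) :=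
    ((contDiffOn_trunc_comp hUo hv hv1 k).contDiffAt (hUo.mem_nhds ht)).differentiableAt
      one_ne_zero
  have h3 := h2.hasFDerivAt.comp_hasDerivAt t h1
  have h4 := pd_trunc_comp hUo hv hv1 k 0 ht
  rw [pd] at h4
  rw [h4] at h3
  refine (HasDerivAt.pow (f := fun t => trunc k (v (lift x t))) h3 2).congr_deriv ?_
  simp

omit [NeZero n] in
theorem tendsto_trunc_sq (v : Eu n → ℝ) (x : Eu n) :
    Tendsto (fun k => trunc k (v x) ^ 2) atTop (𝓝 (pos v x ^ 2)) := (tendsto_trunc (v x)).pow 2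

theorem abs_trunc_mul_le (k : ℕ) (x : Eu n) {c C : ℝ} (hc : 0 ≤ c)
    (h : |c * pos v x * posGrad v x 0| ≤ C) :
    c * |trunc k (v x) * (truncDeriv k (v x) * posGrad v x 0)| ≤ C := by
  refine le_trans ?_ h
  rw [abs_mul, abs_mul, abs_mul, abs_mul, abs_of_nonneg hc, abs_of_nonneg (trunc_nonneg _ _),
    abs_of_nonneg (truncDeriv_nonneg _ _), abs_of_nonneg (pos_nonneg v x), mul_assoc]
  refine mul_le_mul_of_nonneg_left ?_ hc
  refine mul_le_mul (trunc_le _ _) ?_ ?_ (pos_nonneg v x)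
  · exact mul_le_of_le_one_left (abs_nonneg _) (truncDeriv_le_one _ _)
  · exact mul_nonneg (truncDeriv_nonneg _ _) (abs_nonneg _)

theorem exists_ball_axis (hΩ : IsHalfSpaceDomain Ω) {x : Eu n} (hx : x ∈ Ω) {Q : Eu n → ℝ}
    (hQ : Tendsto Q (𝓝[offAxis Ω] x) (𝓝 0)) {ε : ℝ} (hε : 0 < ε) :
    ∃ ρ > 0, Metric.closedBall x ρ ∩ closedHalf n ⊆ Ω ∧
      ∀ y ∈ Metric.ball x ρ, 0 < y 0 → |Q y| ≤ ε := by
  obtain ⟨ρ₁, h1, h2⟩ := exists_closedBall_subset hΩ hx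
  have h3 := hQ.eventually (Metric.closedBall_mem_nhds 0 hε)
  obtain ⟨ρ₂, h4, h5⟩ := Metric.mem_nhdsWithin_iff.1 h3
  refine ⟨min ρ₁ ρ₂, lt_min h1 h4, ?_, fun y hy hy0 => ?_⟩
  · exact (inter_subset_inter_left _ (Metric.closedBall_subset_closedBall (min_le_left _ _))).trans h2
  · have hyU : y ∈ offAxis Ω := ⟨h2 ⟨Metric.ball_subset_closedBall
      (Metric.ball_subset_ball (min_le_left _ _) hy), hy0.le⟩, hy0⟩
    have := h5 ⟨Metric.ball_subset_ball (min_le_right _ _) hy, hyU⟩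
    simpa using this

/-- Near the axis `|x₁ v ∂₁v| ≤ 1`, so along a line in direction `e₁` the function `t v² + 2t` has
derivative `v² + t ∂₁(v²) + 2 ≥ 0`. Its value is therefore controlled by that on a compact slice
`{x₁ = b}` off the axis. The truncations of `v` make this differentiation legitimate. -/
theorem bounded_near_axis_one (hΩ : IsHalfSpaceDomain Ω) (hv : ContinuousOn v (offAxis Ω))
    (hv1 : ContDiffOn ℝ 1 v (offAxis Ω ∩ {x | 0 < v x})) {x : Eu n} (hx : x ∈ Ω) (hx0 : x 0 = 0)
    (hax : Tendsto (fun x => x 0 * pos v x * posGrad v x 0) (𝓝[offAxis Ω] x) (𝓝 0)) :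
    ∃ C, ∀ᶠ y in 𝓝[offAxis Ω] x, y 0 * pos v y ^ 2 ≤ C := by
  obtain ⟨ρ, hρ, hsub, hQ⟩ := exists_ball_axis hΩ hx hax one_pos
  set b := ρ / 2 with hb
  have hb0 : 0 < b := half_pos hρ
  set K : Set (Eu n) := Metric.closedBall x ρ ∩ {y | y 0 = b} with hK
  have hKc : IsCompact K :=
    (isCompact_closedBall x ρ).inter_right (isClosed_eq (by fun_prop) continuous_const)
  have hKU : K ⊆ offAxis Ω := fun y hy => by
    have h0 : 0 < y 0 := hy.2.symm ▸ hb0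
    exact ⟨hsub ⟨hy.1, h0.le⟩, h0⟩
  obtain ⟨C, hC⟩ := hKc.exists_bound_of_continuousOn
    (((continuousOn_pos hv).pow 2).mono hKU)
  -- The value of the monotone function at `t = b`, with `v²` bounded by `C` on the slice.
  refine ⟨b * C + 2 * b, ?_⟩
  filter_upwards [mem_nhdsWithin_of_mem_nhds (Metric.ball_mem_nhds x hb0), self_mem_nhdsWithin]
    with y hy hyU
  rw [mem_ball_iff_norm] at hy
  have hy0 : 0 < y 0 := hyU.2
  have hyb : y 0 ≤ b := by
    have := abs_apply_le_norm (y - x) 0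
    rw [PiLp.sub_apply, hx0, sub_zero] at this
    linarith [le_abs_self (y 0)]
  have hL : ∀ t ∈ Icc (y 0) b, lift y t ∈ Metric.ball x ρ := fun t ht => by
    rw [mem_ball_iff_norm]
    have h1 := norm_lift_sub_le y x t
    rw [abs_of_nonneg (by linarith [ht.1])] at h1
    linarith [ht.2]
  have hLU : ∀ t ∈ Icc (y 0) b, lift y t ∈ offAxis Ω := fun t ht => by
    have h0 : 0 < lift y t 0 := by rw [lift_zero]; linarith [ht.1]
    exact ⟨hsub ⟨Metric.ball_subset_closedBall (hL t ht), h0.le⟩, h0⟩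
  have hk : ∀ k, y 0 * trunc k (v y) ^ 2 ≤ b * C + 2 * b := fun k => by
    have hd : ∀ t ∈ Icc (y 0) b, HasDerivAt (fun t => t * trunc k (v (lift y t)) ^ 2 + 2 * t) _ t :=
      fun t ht => ((hasDerivAt_id t).mul (hasDerivAt_trunc_sq_lift hΩ hv hv1 k y (hLU t ht))).add
        ((hasDerivAt_id t).const_mul 2)
    have hmono : MonotoneOn (fun t => t * trunc k (v (lift y t)) ^ 2 + 2 * t) (Icc (y 0) b) := by
      refine monotoneOn_of_hasDerivWithinAt_nonneg (convex_Icc _ _)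
        (fun t ht => (hd t ht).continuousAt.continuousWithinAt)
        (fun t ht => (hd t (interior_subset ht)).hasDerivWithinAt) fun t ht => ?_
      have ht' := interior_subset ht
      have ht0 : 0 ≤ t := hy0.le.trans ht'.1
      have h1 := hQ _ (hL t ht') (by rw [lift_zero]; exact hy0.trans_le ht'.1)
      rw [lift_zero] at h1
      have h2 := abs_trunc_mul_le k (lift y t) ht0 h1
      have h3 := mul_le_mul_of_nonneg_left (neg_abs_le (trunc k (v (lift y t)) *
        (truncDeriv k (v (lift y t)) * posGrad v (lift y t) 0))) ht0
      simp only [id_eq, one_mul]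
      nlinarith [sq_nonneg (trunc k (v (lift y t)))]
    have h1 := hmono (left_mem_Icc.2 hyb) (right_mem_Icc.2 hyb) hyb
    simp only [lift_self] at h1
    have h2 : trunc k (v (lift y b)) ^ 2 ≤ C := by
      have hmem : lift y b ∈ K :=
        ⟨Metric.ball_subset_closedBall (hL b (right_mem_Icc.2 hyb)), lift_zero y b⟩
      have := hC _ hmem
      change ‖pos v (lift y b) ^ 2‖ ≤ C at this
      rw [Real.norm_of_nonneg (sq_nonneg _)] at this
      exact (pow_le_pow_left₀ (trunc_nonneg _ _) (trunc_le _ _) 2).trans this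
    nlinarith
  exact le_of_tendsto ((tendsto_trunc_sq v y).const_mul (y 0)) (Eventually.of_forall hk)

omit [NeZero n] in
theorem norm_le_sum_abs (x : Eu n) : ‖x‖ ≤ ∑ i, |x i| := by
  have h : x = ∑ i, x i • EuclideanSpace.single i (1 : ℝ) := by
    ext j
    simp [Finset.sum_apply, Pi.single_apply]
  conv_lhs => rw [h]
  refine (norm_sum_le _ _).trans (Finset.sum_le_sum fun i _ => ?_)
  simp [norm_smul]

/-- For the weight `1/x₁` the axis condition bounds `|∂₁(v²)|` by `x₁`, so `v²` varies by at most
`z₁²/2` between a point `z` and the axis. If `v² > z₁²` at `z`, then `v² ≥ z₁²/2` on a whole tube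
reaching the axis, and `∫ v²/x₁` would diverge there. -/
theorem sq_le_sq_near_axis (hΩ : IsHalfSpaceDomain Ω) (hv : ContinuousOn v (offAxis Ω))
    (hv1 : ContDiffOn ℝ 1 v (offAxis Ω ∩ {x | 0 < v x}))
    (hint : IntegrableOn (fun x => (x 0)⁻¹ * pos v x ^ 2) (offAxis Ω))
    {x : Eu n} (hx : x ∈ Ω) (hx0 : x 0 = 0)
    (hax : Tendsto (fun x => (x 0)⁻¹ * pos v x * posGrad v x 0) (𝓝[offAxis Ω] x) (𝓝 0)) :
    ∀ᶠ y in 𝓝[offAxis Ω] x, pos v y ^ 2 ≤ y 0 ^ 2 := by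
  obtain ⟨ρ, hρ, hsub, hQ⟩ := exists_ball_axis hΩ hx hax (show (0 : ℝ) < 1 / 2 by norm_num)
  have hb0 : 0 < ρ / 2 := half_pos hρ
  have hUo := isOpen_offAxis hΩ
  -- Moving down the line from `y`, `s²/2 - v²` is nondecreasing in `s`; dropping `t²/2` leaves the
  -- stated loss.
  have hlow : ∀ y ∈ Metric.ball x (ρ / 2), 0 < y 0 → ∀ t, 0 < t → t ≤ y 0 →
      lift y t ∈ offAxis Ω ∧ pos v y ^ 2 - y 0 ^ 2 / 2 ≤ pos v (lift y t) ^ 2 := by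
    intro y hy hy0 t ht hty
    rw [mem_ball_iff_norm] at hy
    have hyb : y 0 ≤ ρ / 2 := by
      have := abs_apply_le_norm (y - x) 0
      rw [PiLp.sub_apply, hx0, sub_zero] at this
      linarith [le_abs_self (y 0)]
    have hL : ∀ s ∈ Icc t (y 0), lift y s ∈ Metric.ball x ρ := fun s hs => by
      rw [mem_ball_iff_norm]
      have h1 := norm_lift_sub_le y x s
      rw [abs_of_nonpos (by linarith [hs.2])] at h1
      linarith [hs.1]
    have hLU : ∀ s ∈ Icc t (y 0), lift y s ∈ offAxis Ω := fun s hs => by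
      have h0 : 0 < lift y s 0 := by rw [lift_zero]; linarith [hs.1]
      exact ⟨hsub ⟨Metric.ball_subset_closedBall (hL s hs), h0.le⟩, h0⟩
    refine ⟨hLU t (left_mem_Icc.2 hty), ?_⟩
    have hk : ∀ k, trunc k (v y) ^ 2 - y 0 ^ 2 / 2 ≤ trunc k (v (lift y t)) ^ 2 := fun k => by
      have hd : ∀ s ∈ Icc t (y 0), HasDerivAt (fun s => s ^ 2 / 2 - trunc k (v (lift y s)) ^ 2)
          _ s := fun s hs => ((hasDerivAt_pow 2 s).div_const 2).sub
            (hasDerivAt_trunc_sq_lift hΩ hv hv1 k y (hLU s hs))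
      have hmono : MonotoneOn (fun s => s ^ 2 / 2 - trunc k (v (lift y s)) ^ 2) (Icc t (y 0)) := by
        refine monotoneOn_of_hasDerivWithinAt_nonneg (convex_Icc _ _)
          (fun s hs => (hd s hs).continuousAt.continuousWithinAt)
          (fun s hs => (hd s (interior_subset hs)).hasDerivWithinAt) fun s hs => ?_
        have hs' := interior_subset hs
        have hs0 : 0 < s := ht.trans_le hs'.1
        have h1 := hQ _ (hL s hs') (by rw [lift_zero]; exact hs0)
        rw [lift_zero] at h1
        have h2 := abs_trunc_mul_le k (lift y s) (inv_nonneg.2 hs0.le) h1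
        rw [inv_mul_le_iff₀ hs0] at h2
        have h3 := le_abs_self (trunc k (v (lift y s)) *
          (truncDeriv k (v (lift y s)) * posGrad v (lift y s) 0))
        norm_num
        nlinarith
      have h1 := hmono (left_mem_Icc.2 hty) (right_mem_Icc.2 hty) hty
      simp only [lift_self] at h1
      nlinarith [sq_nonneg t]
    exact le_of_tendsto_of_tendsto' ((tendsto_trunc_sq v y).sub_const _)
      (tendsto_trunc_sq v (lift y t)) hk
  filter_upwards [mem_nhdsWithin_of_mem_nhds (Metric.ball_mem_nhds x hb0), self_mem_nhdsWithin]
    with z hz hzU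
  by_contra! hlt
  have hz0 : 0 < z 0 := hzU.2
  have hev : ∀ᶠ y in 𝓝 z, z 0 ^ 2 < pos v y ^ 2 ∧ y ∈ Metric.ball x (ρ / 2) :=
    ((((continuousOn_pos hv).pow 2).continuousAt (hUo.mem_nhds hzU)).eventually
      (lt_mem_nhds hlt)).and (Metric.isOpen_ball.mem_nhds hz)
  obtain ⟨η, hη, hball⟩ := Metric.eventually_nhds_iff_ball.1 hev
  -- The norm is bounded by the sum of coordinates, so a box of half-width `η'` projects into the
  -- ball of radius `η`, since `n η' < η`.
  set η' := η / (n + 1) with hη'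
  have hη'0 : 0 < η' := by positivity
  obtain ⟨A, hA, hvol⟩ := exists_volume_axisBox z hη'0
  set s : ℕ → ℝ := fun k => z 0 / ((k : ℝ) + 1) with hs
  have hs0 : ∀ k, 0 < s k := fun k => by positivity
  have hsz : ∀ k, s k ≤ z 0 := fun k => div_le_self hz0.le (by linarith [(k.cast_nonneg : (0:ℝ) ≤ k)])
  -- Slices of the tube at height between `s/2` and `s`: the volume is proportional to `s` and the
  -- integrand is at least `z₁²/(2s)`, so each integral is at least `z₁² A / 4` although the volumes
  -- tend to `0`. This contradicts absolute continuity of the integral.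
  set T : ℕ → Set (Eu n) := fun k => axisBox z η' (s k / 2) (s k) with hT
  have hTm : ∀ k, MeasurableSet (T k) := fun k => by
    have : T k = (fun x : Eu n => x 0) ⁻¹' Ioo (s k / 2) (s k) ∩
        ⋂ i : Fin n, ⋂ _ : i ≠ 0, {x : Eu n | |x i - z i| < η'} := by
      ext w; simp [hT, axisBox]
    rw [this]
    refine ((by fun_prop : Measurable fun x : Eu n => x 0) measurableSet_Ioo).inter
      (MeasurableSet.iInter fun i => MeasurableSet.iInter fun _ => ?_)
    exact measurableSet_lt (by fun_prop) measurable_const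
  have hTlow : ∀ k, ∀ w ∈ T k, w ∈ offAxis Ω ∧ z 0 ^ 2 / 2 / s k ≤ (w 0)⁻¹ * pos v w ^ 2 := by
    intro k w hw
    have hw0 : 0 < w 0 := (half_pos (hs0 k)).trans hw.1.1
    have hy : lift w (z 0) ∈ Metric.ball z η := by
      rw [mem_ball_iff_norm]
      calc ‖lift w (z 0) - z‖ ≤ ∑ i, |(lift w (z 0) - z) i| := norm_le_sum_abs _
        _ ≤ ∑ _i : Fin n, η' := Finset.sum_le_sum fun i _ => by
            rw [PiLp.sub_apply]
            by_cases hi : i = 0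
            · subst hi; rw [lift_zero]; simpa using hη'0.le
            · rw [lift_of_ne _ _ hi]; exact (hw.2 i hi).le
        _ = n * η' := by simp
        _ < η := by
            rw [hη', mul_div_assoc', div_lt_iff₀ (by positivity)]
            nlinarith
    obtain ⟨h1, h2⟩ := hball _ hy
    have h3 := hlow _ h2 (by rw [lift_zero]; exact hz0) (w 0) hw0
      (by rw [lift_zero]; exact hw.1.2.le.trans (hsz k))
    rw [lift_lift, lift_self, lift_zero] at h3
    refine ⟨h3.1, ?_⟩
    rw [div_eq_inv_mul]
    refine mul_le_mul (inv_anti₀ hw0 hw.1.2.le) (by linarith [h3.2]) (by positivity) (by positivity)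
  have hvolT : ∀ k, volume (T k) = ENNReal.ofReal (s k / 2 * A) := fun k => by
    rw [hT]
    simp only
    rw [hvol _ _ (by linarith [hs0 k])]
    congr 1
    ring
  have hTU : ∀ k, T k ⊆ offAxis Ω := fun k w hw => (hTlow k w hw).1
  have hlim : Tendsto (fun k => ∫ w in T k, (w 0)⁻¹ * pos v w ^ 2 ∂(volume.restrict (offAxis Ω)))
      atTop (𝓝 0) := by
    refine hint.tendsto_setIntegral_nhds_zero ?_
    have h1 : Tendsto (fun k => ENNReal.ofReal (s k / 2 * A)) atTop (𝓝 0) := by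
      have : Tendsto (fun k => s k / 2 * A) atTop (𝓝 0) := by
        simpa using ((tendsto_div_nat_add_one (z 0)).div_const 2).mul_const A
      simpa using ENNReal.tendsto_ofReal this
    refine h1.congr fun k => ?_
    simp only [Function.comp]
    rw [Measure.restrict_apply (hTm k), inter_eq_left.2 (hTU k), hvolT]
  have hge : ∀ k, z 0 ^ 2 / 4 * A ≤
      ∫ w in T k, (w 0)⁻¹ * pos v w ^ 2 ∂(volume.restrict (offAxis Ω)) := fun k => by
    rw [Measure.restrict_restrict (hTm k), inter_eq_left.2 (hTU k)]
    have h1 : ∫ _w in T k, z 0 ^ 2 / 2 / s k = z 0 ^ 2 / 4 * A := by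
      rw [setIntegral_const, measureReal_def, hvolT,
        ENNReal.toReal_ofReal (by have := hs0 k; positivity), smul_eq_mul]
      have := (hs0 k).ne'
      field_simp
      ring
    rw [← h1]
    refine setIntegral_mono_on ?_ (hint.mono_set (hTU k)) (hTm k) fun w hw => (hTlow k w hw).2
    exact integrableOn_const (by rw [hvolT]; exact ENNReal.ofReal_ne_top)
  have := ge_of_tendsto' hlim hge
  have hpos : 0 < z 0 ^ 2 / 4 * A := by positivity
  linarith

end axis

/-! ### Radial identities for a single phase -/

section phase

variable [NeZero n]

/-- The component of the field `P` in the direction away from `x₀`. -/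
def radPart (x₀ : Eu n) (P : Eu n → Eu n) (x : Eu n) : ℝ := ⟪P x, x - x₀⟫ / ‖x - x₀‖

/-- The density `x₁^σ v²` of the boundary terms. -/
def massDen (σ : ℤ) (v : Eu n → ℝ) (x : Eu n) : ℝ := wt σ x * pos v x ^ 2

/-- The density `x₁^σ |P|²` of the energy. -/
def gradDen (σ : ℤ) (P : Eu n → Eu n) (x : Eu n) : ℝ := wt σ x * ‖P x‖ ^ 2

/-- The density `x₁^σ v ⟨P, ν⟩`. -/
def mixDen (σ : ℤ) (x₀ : Eu n) (v : Eu n → ℝ) (P : Eu n → Eu n) (x : Eu n) : ℝ :=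
  wt σ x * pos v x * radPart x₀ P x

/-- The density `x₁^σ ⟨P, ν⟩²`. -/
def radDen (σ : ℤ) (x₀ : Eu n) (P : Eu n → Eu n) (x : Eu n) : ℝ := wt σ x * radPart x₀ P x ^ 2

/-- The density whose integral over `B⁺_r(x₀)` is `r` times the boundary integral of `massDen`. -/
def massFlux (σ : ℤ) (x₀ : Eu n) (v : Eu n → ℝ) (P : Eu n → Eu n) (x : Eu n) : ℝ :=
  ((n : ℝ) + σ) * massDen σ v x + 2 * (‖x - x₀‖ * mixDen σ x₀ v P x)

variable {Ω : Set (Eu n)} {x₀ : Eu n} {σ : ℤ} {v : Eu n → ℝ} {P : Eu n → Eu n}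

omit [NeZero n] in
theorem abs_radPart_le (x₀ : Eu n) (P : Eu n → Eu n) (x : Eu n) : |radPart x₀ P x| ≤ ‖P x‖ := by
  rw [radPart, abs_div, abs_norm]
  exact div_le_of_le_mul₀ (norm_nonneg _) (norm_nonneg _) (abs_real_inner_le_norm _ _)

omit [NeZero n] in
theorem aestronglyMeasurable_radPart {μ : Measure (Eu n)} (hP : AEStronglyMeasurable P μ) :
    AEStronglyMeasurable (radPart x₀ P) μ := by
  have h1 : AEStronglyMeasurable (fun x : Eu n => x - x₀) μ :=
    (continuous_id.sub continuous_const).aestronglyMeasurable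
  exact (hP.inner h1).mul (by
    have := h1.aemeasurable.norm.inv.aestronglyMeasurable
    exact this)

/-! ### Integrability of the energy and radial densities -/

section integrability

variable (hΩ : IsHalfSpaceDomain Ω) (hv : IsPhase Ω σ v)
  (hP : P =ᵐ[volume.restrict (offAxis Ω)] posGrad v)
include hΩ hv hP

omit hΩ in
theorem IsPhase.integrableOn_gradDen : IntegrableOn (gradDen σ P) (offAxis Ω) := by
  refine Integrable.congr hv.integrable_grad ?_
  filter_upwards [hP] with x hx
  rw [gradDen, hx]

theorem IsPhase.integrableOn_mixDen (x₀ : Eu n) :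
    IntegrableOn (mixDen σ x₀ v P) (offAxis Ω) := by
  have hPm : AEStronglyMeasurable P (volume.restrict (offAxis Ω)) :=
    hv.aestronglyMeasurable.congr hP.symm
  refine Integrable.mono (hv.integrable.add (hv.integrableOn_gradDen hP))
    (((IsPhase.aesm_wt hΩ σ).mul (hv.aesm_pos hΩ)).mul (aestronglyMeasurable_radPart hPm)) ?_
  filter_upwards [ae_restrict_mem (isOpen_offAxis hΩ).measurableSet] with x hx
  have hw := wt_pos σ hx.2
  have h1 := abs_radPart_le x₀ P x
  have h2 := pos_nonneg v x
  rw [mixDen, norm_mul, norm_mul, Real.norm_of_nonneg hw.le, Real.norm_of_nonneg h2, Pi.add_apply,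
    Real.norm_eq_abs, Real.norm_eq_abs, gradDen, ← mul_add, mul_assoc]
  refine (mul_le_mul_of_nonneg_left ?_ hw.le).trans (le_abs_self _)
  nlinarith [sq_nonneg (pos v x - ‖P x‖), norm_nonneg (P x), mul_le_mul_of_nonneg_left h1 h2]

theorem IsPhase.integrableOn_radDen (x₀ : Eu n) :
    IntegrableOn (radDen σ x₀ P) (offAxis Ω) := by
  have hPm : AEStronglyMeasurable P (volume.restrict (offAxis Ω)) :=
    hv.aestronglyMeasurable.congr hP.symm
  refine Integrable.mono (hv.integrableOn_gradDen hP)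
    ((IsPhase.aesm_wt hΩ σ).mul ((aestronglyMeasurable_radPart hPm).pow 2)) ?_
  filter_upwards [ae_restrict_mem (isOpen_offAxis hΩ).measurableSet] with x hx
  have hw := wt_pos σ hx.2
  rw [radDen, gradDen, Real.norm_of_nonneg (by positivity), Real.norm_of_nonneg (by positivity)]
  refine mul_le_mul_of_nonneg_left ?_ hw.le
  exact sq_le_sq' (abs_le.1 (abs_radPart_le x₀ P x)).1 (abs_le.1 (abs_radPart_le x₀ P x)).2

end integrability

omit [NeZero n] in
theorem pd_tail_norm {g : ℝ → ℝ} (hg : Continuous g) (hgc : HasCompactSupport g)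
    (h0 : 0 ∉ tsupport g) (i : Fin n) (x : Eu n) :
    pd (fun x : Eu n => tail g ‖x - x₀‖) i x = g ‖x - x₀‖ / ‖x - x₀‖ * (x i - x₀ i) := by
  rw [pd, (hasFDerivAt_tail_norm hg hgc h0 x).fderiv]
  simp [EuclideanSpace.inner_single_right]

theorem zero_notMem_tsupport {g : ℝ → ℝ} (hg : tsupport g ⊆ radii Ω x₀) : 0 ∉ tsupport g :=
  fun h => lt_irrefl _ (hg h).1

theorem integrableOn_norm_sub_mul {f : Eu n → ℝ} {r : ℝ} (hf : IntegrableOn f (halfBall x₀ r)) :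
    IntegrableOn (fun x => ‖x - x₀‖ * f x) (halfBall x₀ r) := by
  refine Integrable.bdd_mul (c := r) hf
    ((continuous_id.sub continuous_const).norm.aestronglyMeasurable) ?_
  filter_upwards [ae_restrict_mem (measurableSet_halfBall x₀ r)] with x hx
  rw [norm_norm]
  exact (mem_ball_iff_norm.1 hx.1).le

variable (hΩ : IsHalfSpaceDomain Ω) (hx₀ : x₀ ∈ Ω) (hv : IsPhase Ω σ v)
  (hP : P =ᵐ[volume.restrict (offAxis Ω)] posGrad v)
include hΩ hx₀ hv

include hP in
-- `energy_test` with a radial test function, whose gradient is `g(|x - x₀|)` times the radial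
-- direction.
theorem IsPhase.ae_bulk_gradDen :
    ∀ᵐ r : ℝ, r ∈ radii Ω x₀ → bulk x₀ (gradDen σ P) r = surf x₀ (mixDen σ x₀ v P) r := by
  refine ae_bulk_eq_surf hΩ hx₀
    (fun R hR => (hv.integrableOn_gradDen hP).mono_set (halfBall_subset_offAxis hΩ hx₀ hR))
    (fun R hR => (hv.integrableOn_mixDen hΩ hP x₀).mono_set (halfBall_subset_offAxis hΩ hx₀ hR))
    fun g hg hgc hgs R hR hZR => ?_
  have h0 := zero_notMem_tsupport hgs
  rw [← hv.energy_test hΩ hx₀ hR (contDiff_tail_norm hg.continuous hgc h0) hZR]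
  refine integral_congr_ae ?_
  filter_upwards [hP] with x hx
  simp only [pd_tail_norm hg.continuous hgc h0, gradDen, mixDen, radPart, hx, inner_eq_sum,
    PiLp.sub_apply, Finset.sum_div, Finset.mul_sum]
  congr 1
  exact Finset.sum_congr rfl fun i _ => by ring

include hP in
theorem IsPhase.integrableOn_massFlux (R : ℝ) (hR : R ∈ radii Ω x₀) :
    IntegrableOn (massFlux σ x₀ v P) (halfBall x₀ R) := by
  have hsub := halfBall_subset_offAxis hΩ hx₀ hR
  exact ((hv.integrable.mono_set hsub).const_mul _).add
    ((integrableOn_norm_sub_mul ((hv.integrableOn_mixDen hΩ hP x₀).mono_set hsub)).const_mul 2)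

include hP in
-- `boundary_test` with a radial test function. Its gradient paired with `x - x₀` produces the
-- factor `|x - x₀|`, which is `r` on the sphere.
theorem IsPhase.ae_bulk_massDen (hx₀' : x₀ 0 = 0) : ∀ᵐ r : ℝ, r ∈ radii Ω x₀ →
    bulk x₀ (massFlux σ x₀ v P) r = r * surf x₀ (massDen σ v) r := by
  have key := ae_bulk_eq_surf hΩ hx₀ (hv.integrableOn_massFlux hΩ hx₀ hP)
    (H := fun x => ‖x - x₀‖ * massDen σ v x)
    (fun R hR => integrableOn_norm_sub_mul
      (hv.integrable.mono_set (halfBall_subset_offAxis hΩ hx₀ hR)))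
    fun g hg hgc hgs R hR hZR => ?_
  · filter_upwards [key] with r hr hrr
    rw [hr hrr]
    exact surf_radial_mul _ (fun t => t) hrr.1
  have h0 := zero_notMem_tsupport hgs
  rw [← hv.boundary_test hΩ hx₀ hx₀' hR (contDiff_tail_norm hg.continuous hgc h0) hZR]
  refine integral_congr_ae ?_
  filter_upwards [hP] with x hx
  simp only [pd_tail_norm hg.continuous hgc h0, massFlux, massDen, mixDen, radPart, hx, inner_eq_sum,
    PiLp.sub_apply]
  have hs : ∑ i, (x i - x₀ i) * (x i - x₀ i) = ‖x - x₀‖ ^ 2 := by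
    rw [EuclideanSpace.real_norm_sq_eq]
    exact Finset.sum_congr rfl fun i _ => by rw [PiLp.sub_apply]; ring
  have h1 : ∑ i, g ‖x - x₀‖ / ‖x - x₀‖ * (x i - x₀ i) *
      (wt σ x * pos v x ^ 2 * (x i - x₀ i)) =
      g ‖x - x₀‖ / ‖x - x₀‖ * (wt σ x * pos v x ^ 2) * ‖x - x₀‖ ^ 2 := by
    rw [← hs, Finset.mul_sum]
    exact Finset.sum_congr rfl fun i _ => by ring
  have h2 : ∑ i, wt σ x * pos v x * posGrad v x i * (x i - x₀ i) =
      wt σ x * pos v x * ∑ i, posGrad v x i * (x i - x₀ i) := by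
    rw [Finset.mul_sum]
    exact Finset.sum_congr rfl fun i _ => by ring
  rw [h1, h2]
  rcases eq_or_ne ‖x - x₀‖ 0 with hz | hz
  · have : x = x₀ := sub_eq_zero.1 (norm_eq_zero.1 hz)
    subst this
    simp
  · field_simp

omit hΩ hx₀ in
-- Local bounds patch together by compactness: continuity gives them off the axis, `IsPhase.bounded`
-- on it.
theorem IsPhase.exists_bound_massDen {K : Set (Eu n)} (hK : IsCompact K) (hKΩ : K ⊆ Ω)
    (hKh : K ⊆ closedHalf n) : ∃ C, ∀ x ∈ K, x ∈ offAxis Ω → massDen σ v x ≤ C := by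
  refine hK.induction_on (p := fun S => ∃ C, ∀ x ∈ S, x ∈ offAxis Ω → massDen σ v x ≤ C)
    ⟨0, fun x hx => hx.elim⟩ (fun S T hST ⟨C, hC⟩ => ⟨C, fun x hx => hC x (hST hx)⟩)
    (fun S T ⟨C, hC⟩ ⟨D, hD⟩ => ⟨max C D, fun x hx hxU => ?_⟩) fun x hx => ?_
  · exact hx.elim (fun h => (hC x h hxU).trans (le_max_left _ _))
      fun h => (hD x h hxU).trans (le_max_right _ _)
  · have : ∃ C, ∀ᶠ y in 𝓝[offAxis Ω] x, massDen σ v y ≤ C := by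
      rcases (show 0 ≤ x 0 from hKh hx).eq_or_lt with h | h
      · exact hv.bounded x (hKΩ hx) h.symm
      · have hxU : x ∈ offAxis Ω := ⟨hKΩ hx, h⟩
        have hc : ContinuousOn (massDen σ v) (offAxis Ω) :=
          ((contDiffOn_wt σ).continuousOn.mono inter_subset_right).mul
            ((continuousOn_pos hv.continuousOn).pow 2)
        refine ⟨massDen σ v x + 1, ?_⟩
        filter_upwards [(hc x hxU).eventually (gt_mem_nhds (lt_add_one _))] with y hy using hy.le
    obtain ⟨C, hC⟩ := this
    refine ⟨{y | y ∈ offAxis Ω → massDen σ v y ≤ C}, ?_, C, fun y hy => hy⟩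
    exact mem_nhdsWithin_of_mem_nhds (eventually_nhdsWithin_iff.1 hC)

/-- This involves `v` but not its gradient, so it holds at every radius. The density is bounded up
to the axis, and after rescaling to the unit sphere continuity in `r` is dominated convergence. As
`x₀` is on the axis, a direction `y` with `y₁ > 0` stays off the axis for all radii, where the
density is continuous; every other direction contributes `0` for all radii. -/
theorem IsPhase.massDen_sphere (hx₀' : x₀ 0 = 0) : (∀ r ∈ radii Ω x₀,
    IntegrableOn (massDen σ v) (openHalf n) (sphereMeasure x₀ r)) ∧
    ContinuousOn (surf x₀ (massDen σ v)) (radii Ω x₀) := by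
  have hUo := isOpen_offAxis hΩ
  set j : Eu n → ℝ := (offAxis Ω).indicator (massDen σ v) with hj
  have hc : ContinuousOn (massDen σ v) (offAxis Ω) :=
    ((contDiffOn_wt σ).continuousOn.mono inter_subset_right).mul
      ((continuousOn_pos hv.continuousOn).pow 2)
  have hjm : Measurable j := by
    classical
    have := hc.measurable_piecewise (g := fun _ => (0 : ℝ)) continuousOn_const hUo.measurableSet
    rwa [show (fun _ : Eu n => (0 : ℝ)) = 0 from rfl, piecewise_eq_indicator] at this
  have hj0 : ∀ x, 0 ≤ j x := fun x => indicator_nonneg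
    (fun x hx => mul_nonneg (wt_pos σ hx.2).le (sq_nonneg _)) x
  have hmem : ∀ R ∈ radii Ω x₀, ∀ x, ‖x - x₀‖ ≤ R → 0 ≤ x 0 → x ∈ Ω := fun R hR x hx hx0 =>
    closedBall_inter_closedHalf_subset hΩ hx₀ hR ⟨mem_closedBall_iff_norm.2 hx, hx0⟩
  have hbd : ∀ R ∈ radii Ω x₀, ∃ C, ∀ x, ‖x - x₀‖ ≤ R → ‖j x‖ ≤ C := fun R hR => by
    obtain ⟨C, hC⟩ := hv.exists_bound_massDen (isCompact_closedBall_inter_closedHalf x₀ R)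
      (closedBall_inter_closedHalf_subset hΩ hx₀ hR) inter_subset_right
    refine ⟨max C 0, fun x hx => ?_⟩
    rw [Real.norm_of_nonneg (hj0 x)]
    by_cases hxU : x ∈ offAxis Ω
    · rw [hj, indicator_of_mem hxU]
      exact (hC x ⟨mem_closedBall_iff_norm.2 hx, (show 0 < x 0 from hxU.2).le⟩ hxU).trans
        (le_max_left _ _)
    · rw [hj, indicator_of_notMem hxU]
      exact le_max_right _ _
  have hind : ∀ r ∈ radii Ω x₀, (openHalf n).indicator (massDen σ v) =ᵐ[sphereMeasure x₀ r] j :=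
    fun r hr => by
      filter_upwards [ae_norm_eq_sphereMeasure x₀ hr.1] with x hx
      by_cases h : x ∈ openHalf n
      · rw [indicator_of_mem h, hj,
          indicator_of_mem (show x ∈ offAxis Ω from
            ⟨hmem r hr x hx.le (show 0 < x 0 from h).le, h⟩)]
      · rw [indicator_of_notMem h, hj, indicator_of_notMem fun hU : x ∈ offAxis Ω => h hU.2]
  have hnorm : ∀ {r : ℝ}, 0 < r → ∀ y : Metric.sphere (0 : Eu n) 1,
      ‖x₀ + r • (y : Eu n) - x₀‖ = r := fun hr y => by
    simp [norm_smul, abs_of_pos hr]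
  have hm : ∀ r : ℝ, Measurable fun y : Metric.sphere (0 : Eu n) 1 => j (x₀ + r • (y : Eu n)) :=
    fun r => hjm.comp (by fun_prop)
  constructor
  · intro r hr
    rw [← integrable_indicator_iff measurableSet_openHalf, integrable_congr (hind r hr),
      integrable_sphereMeasure_iff x₀ hr.1]
    obtain ⟨C, hC⟩ := hbd r hr
    exact Integrable.of_bound (hm r).aestronglyMeasurable C
      (Eventually.of_forall fun y => hC _ (hnorm hr.1 y).le)
  · have heq : ∀ r ∈ radii Ω x₀, surf x₀ (massDen σ v) r = r ^ (n - 1) *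
        ∫ y : Metric.sphere (0 : Eu n) 1, j (x₀ + r • (y : Eu n))
          ∂(volume : Measure (Eu n)).toSphere := fun r hr => by
      rw [surf, ← integral_indicator measurableSet_openHalf, integral_congr_ae (hind r hr),
        integral_sphereMeasure x₀ hr.1]
    refine ContinuousOn.congr (fun r hr => ?_) heq
    refine ((continuous_pow _).continuousAt.mul ?_).continuousWithinAt
    obtain ⟨R, hR, hlt⟩ := exists_radii_gt hr
    obtain ⟨C, hC⟩ := hbd R hR
    refine continuousAt_of_dominated (bound := fun _ => C)
      (Eventually.of_forall fun r => (hm r).aestronglyMeasurable) ?_ (integrable_const C) ?_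
    · filter_upwards [Ioo_mem_nhds hr.1 hlt] with s hs
      exact Eventually.of_forall fun y => hC _ ((hnorm hs.1 y).le.trans hs.2.le)
    · refine Eventually.of_forall fun y => ?_
      by_cases hy : 0 < (y : Eu n) 0
      · have h0 : 0 < (x₀ + r • (y : Eu n)) 0 := by
          simpa [hx₀'] using mul_pos hr.1 hy
        have hU : x₀ + r • (y : Eu n) ∈ offAxis Ω := ⟨hmem r hr _ (hnorm hr.1 y).le h0.le, h0⟩
        have hjc : ContinuousAt j (x₀ + r • (y : Eu n)) :=
          (hc.continuousAt (hUo.mem_nhds hU)).congr (by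
            filter_upwards [hUo.mem_nhds hU] with x hx
            rw [hj, indicator_of_mem hx])
        exact ContinuousAt.comp (f := fun r : ℝ => x₀ + r • (y : Eu n)) hjc (by fun_prop)
      · refine (continuousAt_const (y := (0 : ℝ))).congr ?_
        filter_upwards [lt_mem_nhds hr.1] with s hs
        refine (indicator_of_notMem (fun hU : _ ∈ offAxis Ω => ?_) _).symm
        have : 0 < (x₀ + s • (y : Eu n)) 0 := hU.2
        rw [PiLp.add_apply, PiLp.smul_apply, hx₀', zero_add, smul_eq_mul] at this
        exact hy (pos_of_mul_pos_right this (le_of_lt hs))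

include hP in
-- Both sides are continuous in `r`, so the a.e. identity holds everywhere. Thus `r J(r)` is itself
-- a bulk integral, which makes `J` differentiable a.e. and locally absolutely continuous.
theorem IsPhase.bulk_massDen (hx₀' : x₀ 0 = 0) {r : ℝ} (hr : r ∈ radii Ω x₀) :
    bulk x₀ (massFlux σ x₀ v P) r = r * surf x₀ (massDen σ v) r := by
  have h := hv.ae_bulk_massDen hΩ hx₀ hP hx₀'
  have h1 := continuousOn_bulk (hv.integrableOn_massFlux hΩ hx₀ hP)
  have h2 : ContinuousOn (fun r => r * surf x₀ (massDen σ v) r) (radii Ω x₀) :=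
    continuousOn_id.mul (hv.massDen_sphere hΩ hx₀ hx₀').2
  exact Measure.eqOn_open_of_ae_eq
    ((ae_restrict_iff' isOpen_radii.measurableSet).2 h) isOpen_radii h1 h2 hr

end phase

/-! ### The two phases of a variational solution -/

section solution

variable [NeZero n] {Ω : Set (Eu n)} {x₀ : Eu n} {σ : ℤ} {u v : Eu n → ℝ} {P : Eu n → Eu n}

theorem phaseVar_eq_zero_of_notMem_tsupport (σ : ℤ) (P : Eu n → Eu n) {φ : Eu n → Eu n} {x : Eu n}
    (hx : x ∉ tsupport φ) : phaseVar σ P φ x = 0 := by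
  have h1 : fderiv ℝ φ x = 0 := by
    by_contra hne
    exact hx (support_fderiv_subset ℝ hne)
  simp [phaseVar, diverg, h1, image_eq_zero_of_notMem_tsupport hx]

theorem phaseVar_congr (σ : ℤ) {P Q : Eu n → Eu n} (φ : Eu n → Eu n) {x : Eu n} (h : P x = Q x) :
    phaseVar σ P φ x = phaseVar σ Q φ x := by
  simp only [phaseVar, h]

theorem phaseVar_of_eq_zero (σ : ℤ) {P : Eu n → Eu n} (φ : Eu n → Eu n) {x : Eu n} (h : P x = 0) :
    phaseVar σ P φ x = 0 := by
  simp [phaseVar, h]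

omit [NeZero n] in
theorem neg_eq_neg_pos (u : Eu n → ℝ) : neg u = fun x => - pos (fun x => - u x) x := by
  funext x
  simp only [neg, pos]
  rw [← neg_zero (G := ℝ), max_neg_neg, neg_neg, neg_zero]

omit [NeZero n] in
theorem posGrad_neg_of_pos {x : Eu n} (h : 0 < u x) : posGrad (fun x => - u x) x = 0 :=
  posGrad_of_nonpos (by linarith)

omit [NeZero n] in
theorem HasWeakGrad.aestronglyMeasurable {U : Set (Eu n)} {G : Eu n → Eu n}
    (h : HasWeakGrad U v G) : AEStronglyMeasurable G (volume.restrict U) :=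
  h.locInt_grad.aestronglyMeasurable

theorem tendsto_zero_of_subset {X : Type*} [TopologicalSpace X] {U A : Set X} {f g : X → ℝ} {x : X}
    (h : Tendsto g (𝓝[U ∩ A] x) (𝓝 0)) (h1 : ∀ y ∈ U ∩ A, f y = g y)
    (h2 : ∀ y ∈ U, y ∉ A → f y = 0) : Tendsto f (𝓝[U] x) (𝓝 0) := by
  rw [Metric.tendsto_nhds] at h ⊢
  intro ε hε
  have := h ε hε
  rw [eventually_nhdsWithin_iff] at this ⊢
  filter_upwards [this] with y hy hyU
  by_cases hA : y ∈ A
  · rw [h1 y ⟨hyU, hA⟩]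
    exact hy ⟨hyU, hA⟩
  · rw [h2 y hyU hA, dist_self]
    exact hε

variable (hΩ : IsHalfSpaceDomain Ω) (hu : IsVariationalSolution Ω u)
include hΩ hu

namespace IsVariationalSolution

omit hΩ in
theorem contDiffOn_pos : ContDiffOn ℝ 2 u (offAxis Ω ∩ {x | 0 < u x}) :=
  hu.contDiffOn.mono fun _ hx => ⟨hx.1, ne_of_gt hx.2⟩

omit hΩ in
theorem contDiffOn_neg :
    ContDiffOn ℝ 2 (fun x => - u x) (offAxis Ω ∩ {x | 0 < - u x}) :=
  (hu.contDiffOn.mono fun _ hx => ⟨hx.1, ne_of_lt (neg_pos.1 hx.2)⟩).neg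

theorem hasWeakGrad_posGrad : HasWeakGrad (offAxis Ω) (pos u) (posGrad u) := by
  obtain ⟨G, hG, -⟩ := hu.memV12.memW12.2
  exact hasWeakGrad_pos (isOpen_offAxis hΩ) hu.continuousOn
    (hu.contDiffOn_pos.of_le one_le_two) ⟨G, hG⟩

theorem hasWeakGrad_posGrad_neg :
    HasWeakGrad (offAxis Ω) (pos fun x => - u x) (posGrad fun x => - u x) := by
  obtain ⟨G, hG, -⟩ := hu.memV12.memW12.2
  exact hasWeakGrad_pos (isOpen_offAxis hΩ) hu.continuousOn.neg
    (hu.contDiffOn_neg.of_le one_le_two) ⟨_, hG.neg⟩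

theorem weakGrad_pos_ae :
    weakGrad (offAxis Ω) (pos u) =ᵐ[volume.restrict (offAxis Ω)] posGrad u :=
  (weakGrad_spec ⟨_, hu.hasWeakGrad_posGrad hΩ⟩).ae_eq (isOpen_offAxis hΩ)
    (hu.hasWeakGrad_posGrad hΩ)

theorem neg_weakGrad_neg_ae : (fun x => - weakGrad (offAxis Ω) (neg u) x)
    =ᵐ[volume.restrict (offAxis Ω)] posGrad fun x => - u x := by
  have h1 : HasWeakGrad (offAxis Ω) (neg u) (fun x => - posGrad (fun x => - u x) x) := by
    rw [neg_eq_neg_pos]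
    exact (hu.hasWeakGrad_posGrad_neg hΩ).neg
  filter_upwards [(weakGrad_spec ⟨_, h1⟩).ae_eq (isOpen_offAxis hΩ) h1] with x hx
  rw [hx, neg_neg]

theorem integrable_pos :
    IntegrableOn (fun x => wt 1 x * ‖posGrad u x‖ ^ 2) (offAxis Ω) ∧
    IntegrableOn (fun x => wt 1 x * pos u x ^ 2) (offAxis Ω) := by
  have hm := (isOpen_offAxis hΩ).measurableSet
  constructor
  · refine Integrable.mono hu.memV12.grad_integrable ((IsPhase.aesm_wt hΩ 1).mul
      ((hu.hasWeakGrad_posGrad hΩ).aestronglyMeasurable.norm.pow 2)) ?_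
    filter_upwards [ae_restrict_mem hm, hu.weakGrad_pos_ae hΩ] with x hx h
    have h0 : 0 < x 0 := hx.2
    rw [Real.norm_of_nonneg (by have := wt_pos 1 h0; positivity), wt, zpow_one, h,
      Real.norm_of_nonneg (by positivity)]
    exact le_add_of_nonneg_right (by positivity)
  · refine Integrable.mono hu.memV12.integrable ((IsPhase.aesm_wt hΩ 1).mul
      (((continuousOn_pos hu.continuousOn).aestronglyMeasurable hm).pow 2)) ?_
    filter_upwards [ae_restrict_mem hm] with x hx
    have h0 : 0 < x 0 := hx.2
    rw [Real.norm_of_nonneg (by have := wt_pos 1 h0; positivity), wt, zpow_one,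
      Real.norm_of_nonneg (by positivity)]
    exact le_add_of_nonneg_right (by positivity)

theorem integrable_neg :
    IntegrableOn (fun x => wt (-1) x * ‖posGrad (fun x => - u x) x‖ ^ 2) (offAxis Ω) ∧
    IntegrableOn (fun x => wt (-1) x * pos (fun x => - u x) x ^ 2) (offAxis Ω) := by
  have hm := (isOpen_offAxis hΩ).measurableSet
  constructor
  · refine Integrable.mono hu.memV12.grad_integrable ((IsPhase.aesm_wt hΩ (-1)).mul
      ((hu.hasWeakGrad_posGrad_neg hΩ).aestronglyMeasurable.norm.pow 2)) ?_
    filter_upwards [ae_restrict_mem hm, hu.neg_weakGrad_neg_ae hΩ] with x hx h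
    have h0 : 0 < x 0 := hx.2
    rw [← h, norm_neg, Real.norm_of_nonneg (by have := wt_pos (-1) h0; positivity), wt,
      zpow_neg_one, ← one_div, Real.norm_of_nonneg (by positivity)]
    exact le_add_of_nonneg_left (by positivity)
  · refine Integrable.mono hu.memV12.integrable ((IsPhase.aesm_wt hΩ (-1)).mul
      (((continuousOn_pos hu.continuousOn.neg).aestronglyMeasurable hm).pow 2)) ?_
    filter_upwards [ae_restrict_mem hm] with x hx
    have h0 : 0 < x 0 := hx.2
    have h1 : neg u x ^ 2 = pos (fun x => - u x) x ^ 2 := by rw [neg_eq_neg_pos]; ring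
    rw [Real.norm_of_nonneg (by have := wt_pos (-1) h0; positivity), wt,
      zpow_neg_one, ← one_div, Real.norm_of_nonneg (by positivity), h1]
    exact le_add_of_nonneg_left (by positivity)

omit hΩ in
theorem stationary_single {ψ : Eu n → ℝ} (hψ : ContDiff ℝ ∞ ψ) (hψc : HasCompactSupport ψ)
    (hψU : tsupport ψ ⊆ offAxis Ω) (i : Fin n) :
    ∫ x in offAxis Ω, variationIntegrand (weakGrad (offAxis Ω) (pos u))
      (weakGrad (offAxis Ω) (neg u))
      (fun x => ψ x • (EuclideanSpace.single i (1 : ℝ) : Eu n)) x = 0 := by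
  refine hu.stationary _ ⟨(hψ.of_le (mod_cast le_top)).smul contDiff_const, hψc.smul_right,
    fun x hx => (hψU (tsupport_smul_subset_left ψ _ hx.1)).1, fun x hx => ?_⟩
  have : ψ x = 0 := by
    refine image_eq_zero_of_notMem_tsupport fun h => ?_
    have h1 : 0 < x 0 := (hψU h).2
    exact h1.ne' hx
  simp [this]

/-- A variation supported in `{u > 0}` does not see the other phase, whose gradient vanishes a.e.
there, so stationarity decouples. -/
theorem wlap_pos : ∀ x ∈ offAxis Ω ∩ {x | 0 < u x}, wlap 1 u x = 0 := by
  have hUo := isOpen_offAxis hΩ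
  refine wlap_eq_zero_of_stationary (isOpen_posSet hUo hu.continuousOn) (fun x hx => hx.1.2)
    hu.contDiffOn_pos 1 fun ψ hψ hψc hψD i => ?_
  have hsupp : tsupport (fun x => ψ x • (EuclideanSpace.single i (1 : ℝ) : Eu n)) ⊆ tsupport ψ :=
    tsupport_smul_subset_left ψ _
  rw [← setIntegral_eq_integral_of_forall_compl_eq_zero (s := offAxis Ω) fun x hx =>
    phaseVar_eq_zero_of_notMem_tsupport _ _ fun h => hx (hψD (hsupp h)).1]
  refine Eq.trans (integral_congr_ae ?_)
    (hu.stationary_single hψ hψc (fun x hx => (hψD hx).1) i)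
  filter_upwards [hu.weakGrad_pos_ae hΩ, hu.neg_weakGrad_neg_ae hΩ] with x h1 h2
  rw [variationIntegrand_eq]
  by_cases hx : x ∈ tsupport ψ
  · have hx0 : 0 < u x := (hψD hx).2
    rw [posGrad_neg_of_pos hx0, neg_eq_zero] at h2
    rw [phaseVar_of_eq_zero (-1) _ h2, add_zero]
    refine phaseVar_congr 1 _ ?_
    rw [h1, posGrad, indicator_of_mem (show x ∈ {x | 0 < u x} from hx0)]
  · have hx' := fun h => hx (hsupp h)
    simp only [phaseVar_eq_zero_of_notMem_tsupport _ _ hx', add_zero]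

theorem wlap_neg : ∀ x ∈ offAxis Ω ∩ {x | 0 < - u x}, wlap (-1) (fun x => - u x) x = 0 := by
  have hUo := isOpen_offAxis hΩ
  refine wlap_eq_zero_of_stationary (isOpen_posSet hUo hu.continuousOn.neg) (fun x hx => hx.1.2)
    hu.contDiffOn_neg (-1) fun ψ hψ hψc hψD i => ?_
  have hsupp : tsupport (fun x => ψ x • (EuclideanSpace.single i (1 : ℝ) : Eu n)) ⊆ tsupport ψ :=
    tsupport_smul_subset_left ψ _
  rw [← setIntegral_eq_integral_of_forall_compl_eq_zero (s := offAxis Ω) fun x hx =>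
    phaseVar_eq_zero_of_notMem_tsupport _ _ fun h => hx (hψD (hsupp h)).1]
  refine Eq.trans (integral_congr_ae ?_)
    (hu.stationary_single hψ hψc (fun x hx => (hψD hx).1) i)
  filter_upwards [hu.weakGrad_pos_ae hΩ, hu.neg_weakGrad_neg_ae hΩ] with x h1 h2
  rw [variationIntegrand_eq]
  by_cases hx : x ∈ tsupport ψ
  · have hx0 : 0 < - u x := (hψD hx).2
    rw [posGrad_of_nonpos (neg_pos.1 hx0).le] at h1
    rw [phaseVar_of_eq_zero 1 _ h1, zero_add, ← phaseVar_neg (-1) (weakGrad (offAxis Ω) (neg u))]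
    refine phaseVar_congr (-1) _ ?_
    rw [h2, posGrad, indicator_of_mem (show x ∈ {x | 0 < - u x} from hx0)]
  · have hx' := fun h => hx (hsupp h)
    simp only [phaseVar_eq_zero_of_notMem_tsupport _ _ hx', add_zero]

theorem isPhase_pos : IsPhase Ω 1 u := by
  have hax : ∀ x ∈ Ω, x 0 = 0 →
      Tendsto (fun x => x 0 * pos u x * posGrad u x 0) (𝓝[offAxis Ω] x) (𝓝 0) := fun x hx hx0 => by
    refine tendsto_zero_of_subset (hu.axis_pos x hx hx0) (fun y hy => ?_) fun y _ hy => ?_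
    · rw [posGrad_apply_of_pos hy.2, pos, max_eq_left (le_of_lt hy.2)]
      rfl
    · rw [posGrad_of_nonpos (not_lt.1 hy)]
      simp
  exact
    { continuousOn := hu.continuousOn
      contDiffOn := hu.contDiffOn_pos
      aestronglyMeasurable := (hu.hasWeakGrad_posGrad hΩ).aestronglyMeasurable
      integrable_grad := (hu.integrable_pos hΩ).1
      integrable := (hu.integrable_pos hΩ).2
      axis := by simpa only [wt, zpow_one] using hax
      bounded := fun x hx hx0 => by
        simpa only [wt, zpow_one] using bounded_near_axis_one hΩ hu.continuousOn
          (hu.contDiffOn_pos.of_le one_le_two) hx hx0 (hax x hx hx0)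
      equation := hu.wlap_pos hΩ }

theorem isPhase_neg : IsPhase Ω (-1) (fun x => - u x) := by
  have hax : ∀ x ∈ Ω, x 0 = 0 → Tendsto (fun x => (x 0)⁻¹ * pos (fun x => - u x) x *
      posGrad (fun x => - u x) x 0) (𝓝[offAxis Ω] x) (𝓝 0) := fun x hx hx0 => by
    refine tendsto_zero_of_subset (hu.axis_neg x hx hx0) (fun y hy => ?_) fun y _ hy => ?_
    · have hy0 : 0 < - u y := neg_pos.2 hy.2
      rw [posGrad_apply_of_pos (v := fun x => - u x) hy0, pos, max_eq_left hy0.le, pd,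
        fderiv_fun_neg, partialOne]
      simp only [neg_apply]
      ring
    · rw [posGrad_of_nonpos (v := fun x => - u x) (by simpa using hy)]
      simp
  exact
    { continuousOn := hu.continuousOn.neg
      contDiffOn := hu.contDiffOn_neg
      aestronglyMeasurable := (hu.hasWeakGrad_posGrad_neg hΩ).aestronglyMeasurable
      integrable_grad := (hu.integrable_neg hΩ).1
      integrable := (hu.integrable_neg hΩ).2
      axis := by simpa only [wt, zpow_neg_one] using hax
      bounded := fun x hx hx0 => by
        -- Near the axis `(u⁻)² ≤ x₁²`, hence `(u⁻)²/x₁ ≤ x₁ < 1`.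
        refine ⟨1, ?_⟩
        have hint := (hu.integrable_neg hΩ).2
        simp only [wt, zpow_neg_one] at hint
        have hlt : ∀ᶠ y : Eu n in 𝓝 x, y 0 < 1 := by
          have hc : Continuous fun y : Eu n => y 0 := by fun_prop
          exact (hc.tendsto x).eventually (gt_mem_nhds (by rw [hx0]; exact one_pos))
        filter_upwards [sq_le_sq_near_axis hΩ hu.continuousOn.neg
          (hu.contDiffOn_neg.of_le one_le_two) hint hx hx0 (hax x hx hx0),
          mem_nhdsWithin_of_mem_nhds hlt, self_mem_nhdsWithin] with y hy hy1 hyU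
        have hy0 : 0 < y 0 := hyU.2
        have hy1 : y 0 < 1 := hy1
        have hy : pos (fun x => - u x) y ^ 2 ≤ y 0 ^ 2 := hy
        rw [wt, zpow_neg_one, inv_mul_le_iff₀ hy0]
        nlinarith
      equation := hu.wlap_neg hΩ }

end IsVariationalSolution

end solution

/-! ### The Rellich identity -/

section rellich

variable [NeZero n] {Ω : Set (Eu n)} {x₀ : Eu n} {u : Eu n → ℝ}

/-- With `Z = tail g |x - x₀|`, the field has derivative `Z · Id + (g/|x - x₀|) (x - x₀) ⊗ (x -
x₀)`. The `Z`-terms contribute `n` from the divergence, `-2` from the quadratic form, and `σ` from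
the weight, because the first component of the field is `Z x₁`. -/
theorem phaseVar_radial {g : ℝ → ℝ} (hg : Continuous g) (hgc : HasCompactSupport g)
    (h0 : 0 ∉ tsupport g) (hx₀ : x₀ 0 = 0) (σ : ℤ) (P : Eu n → Eu n) {x : Eu n} (hx : 0 < x 0) :
    phaseVar σ P (fun x => tail g ‖x - x₀‖ • (x - x₀)) x =
      tail g ‖x - x₀‖ * (((n : ℝ) - 2 + σ) * gradDen σ P x) +
        g ‖x - x₀‖ * (‖x - x₀‖ * (gradDen σ P x - 2 * radDen σ x₀ P x)) := by
  set Z := tail g ‖x - x₀‖ with hZ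
  set c := g ‖x - x₀‖ / ‖x - x₀‖ with hc
  have hcr : c * ‖x - x₀‖ ^ 2 = g ‖x - x₀‖ * ‖x - x₀‖ := by
    rcases eq_or_ne ‖x - x₀‖ 0 with hz | hz
    · simp [hz]
    · rw [hc]; field_simp
  have hrad : c * ⟪P x, x - x₀⟫ ^ 2 = g ‖x - x₀‖ * ‖x - x₀‖ * radPart x₀ P x ^ 2 := by
    rcases eq_or_ne ‖x - x₀‖ 0 with hz | hz
    · simp [hc, hz]
    · rw [hc, radPart]; field_simp
  have hD : ∀ h, fderiv ℝ (fun x : Eu n => tail g ‖x - x₀‖ • (x - x₀)) x h =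
      Z • h + (c * ⟪x - x₀, h⟫) • (x - x₀) := fun h => by
    have h1 := (hasFDerivAt_tail_norm (x₀ := x₀) hg hgc h0 x).fun_smul
      ((hasFDerivAt_id x).sub_const x₀)
    rw [HasFDerivAt.fderiv (f := fun x : Eu n => tail g ‖x - x₀‖ • (x - x₀)) h1]
    simp [hZ, hc, inner_sub_left]
  have hdiv : diverg (fun x : Eu n => tail g ‖x - x₀‖ • (x - x₀)) x =
      n * Z + g ‖x - x₀‖ * ‖x - x₀‖ := by
    rw [← hcr, EuclideanSpace.real_norm_sq_eq, diverg]
    simp only [hD, EuclideanSpace.inner_single_right, PiLp.add_apply, PiLp.smul_apply, smul_eq_mul]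
    rw [Finset.sum_add_distrib, Finset.mul_sum]
    congr 1
    · simp
    · exact Finset.sum_congr rfl fun i _ => by simp; ring
  have hin : ⟪P x, fderiv ℝ (fun x : Eu n => tail g ‖x - x₀‖ • (x - x₀)) x (P x)⟫ =
      Z * ‖P x‖ ^ 2 + g ‖x - x₀‖ * ‖x - x₀‖ * radPart x₀ P x ^ 2 := by
    rw [hD, inner_add_right, inner_smul_right, inner_smul_right, real_inner_self_eq_norm_sq,
      ← hrad, real_inner_comm (P x) (x - x₀)]
    ring
  have hw : wt σ x = x 0 ^ (σ - 1) * x 0 := by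
    rw [wt, ← zpow_add_one₀ hx.ne']
    congr 1
    ring
  rw [phaseVar, hdiv, hin, gradDen, radDen]
  simp only [PiLp.smul_apply, PiLp.sub_apply, hx₀, sub_zero, smul_eq_mul]
  rw [← hZ, hw]
  ring

variable (hΩ : IsHalfSpaceDomain Ω) (hu : IsVariationalSolution Ω u) (hx₀ : x₀ ∈ Ω)
include hΩ hu hx₀

/-- The radial field centred at an axis point is tangential to the axis, hence an admissible
variation. Its support crosses the free boundary, so unlike the other two identities this one is
obtained only for the sum of the phases; the free boundary condition enters here through
stationarity. -/
theorem IsVariationalSolution.ae_rellich (hx₀' : x₀ 0 = 0) {P N : Eu n → Eu n}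
    (hP : P = weakGrad (offAxis Ω) (pos u))
    (hN : N = fun x => - weakGrad (offAxis Ω) (neg u) x) :
    ∀ᵐ r : ℝ, r ∈ radii Ω x₀ →
      bulk x₀ (fun x => ((n : ℝ) - 1) * gradDen 1 P x + ((n : ℝ) - 3) * gradDen (-1) N x) r =
        r * surf x₀ (fun x => (gradDen 1 P x - 2 * radDen 1 x₀ P x) +
          (gradDen (-1) N x - 2 * radDen (-1) x₀ N x)) r := by
  have hPa : P =ᵐ[volume.restrict (offAxis Ω)] posGrad u := hP ▸ hu.weakGrad_pos_ae hΩ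
  have hNa : N =ᵐ[volume.restrict (offAxis Ω)] posGrad fun x => - u x :=
    hN ▸ hu.neg_weakGrad_neg_ae hΩ
  have hp := hu.isPhase_pos hΩ
  have hn := hu.isPhase_neg hΩ
  have hsub := fun R (hR : R ∈ radii Ω x₀) => halfBall_subset_offAxis hΩ hx₀ hR
  have i1 := hp.integrableOn_gradDen hPa
  have i2 := hn.integrableOn_gradDen hNa
  have i3 := hp.integrableOn_radDen hΩ hPa x₀
  have i4 := hn.integrableOn_radDen hΩ hNa x₀
  have key := ae_bulk_eq_surf hΩ hx₀
    (F := fun x => ((n : ℝ) - 1) * gradDen 1 P x + ((n : ℝ) - 3) * gradDen (-1) N x)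
    (H := fun x => ‖x - x₀‖ * ((gradDen 1 P x - 2 * radDen 1 x₀ P x) +
          (gradDen (-1) N x - 2 * radDen (-1) x₀ N x)))
    (fun R hR => ((i1.mono_set (hsub R hR)).const_mul _).add
      ((i2.mono_set (hsub R hR)).const_mul _))
    (fun R hR => integrableOn_norm_sub_mul
      (((i1.mono_set (hsub R hR)).sub ((i3.mono_set (hsub R hR)).const_mul 2)).add
        ((i2.mono_set (hsub R hR)).sub ((i4.mono_set (hsub R hR)).const_mul 2))))
    fun g hg hgc hgs R hR hZR => ?_
  · filter_upwards [key] with r hr hrr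
    rw [hr hrr]
    exact surf_radial_mul _ (fun t => t) hrr.1
  have h0 := zero_notMem_tsupport hgs
  have hts : tsupport (fun x : Eu n => tail g ‖x - x₀‖ • (x - x₀)) ⊆ Metric.ball x₀ R :=
    (tsupport_smul_subset_left _ _).trans hZR
  have hvar : IsVariation Ω fun x : Eu n => tail g ‖x - x₀‖ • (x - x₀) :=
    { contDiff := (contDiff_tail_norm hg.continuous hgc h0).smul (contDiff_id.sub contDiff_const)
      compact := (hasCompactSupport_of_tsupport_subset_ball hZR).smul_right
      supp := fun x hx => closedBall_inter_closedHalf_subset hΩ hx₀ hR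
        ⟨Metric.ball_subset_closedBall (hts hx.1), hx.2⟩
      tangential := fun x hx => by simp [hx, hx₀'] }
  refine Eq.trans (setIntegral_congr_fun (isOpen_offAxis hΩ).measurableSet fun x hx => ?_)
    (hu.stationary _ hvar)
  rw [variationIntegrand_eq, ← phaseVar_neg (-1), ← hP]
  simp only [← congrFun hN]
  rw [phaseVar_radial hg.continuous hgc h0 hx₀' 1 P hx.2,
    phaseVar_radial hg.continuous hgc h0 hx₀' (-1) N hx.2]
  push_cast
  ring

end rellich

/-! ### The monotonicity formula -/

section monotonicity

variable [NeZero n] {Ω : Set (Eu n)} {x₀ : Eu n} {u : Eu n → ℝ}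

theorem ae_integrableOn_sphereMeasure {f : Eu n → ℝ}
    (hf : ∀ R ∈ radii Ω x₀, IntegrableOn f (halfBall x₀ R)) :
    ∀ᵐ r : ℝ, r ∈ radii Ω x₀ → IntegrableOn f (openHalf n) (sphereMeasure x₀ r) :=
  ae_radii_of_forall_Ioo fun R hR => (half_polar_coordinates x₀ (hf R hR)).1

theorem ae_hasDerivAt_bulk_radii {f : Eu n → ℝ}
    (hf : ∀ R ∈ radii Ω x₀, IntegrableOn f (halfBall x₀ R)) :
    ∀ᵐ r : ℝ, r ∈ radii Ω x₀ → HasDerivAt (bulk x₀ f) (surf x₀ f r) r :=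
  ae_radii_of_forall_Ioo fun R hR => ae_hasDerivAt_bulk x₀ (hf R hR)

theorem surf_add {f g : Eu n → ℝ} {r : ℝ} (hf : IntegrableOn f (openHalf n) (sphereMeasure x₀ r))
    (hg : IntegrableOn g (openHalf n) (sphereMeasure x₀ r)) :
    surf x₀ (fun x => f x + g x) r = surf x₀ f r + surf x₀ g r := integral_add hf hg

theorem surf_sub {f g : Eu n → ℝ} {r : ℝ} (hf : IntegrableOn f (openHalf n) (sphereMeasure x₀ r))
    (hg : IntegrableOn g (openHalf n) (sphereMeasure x₀ r)) :
    surf x₀ (fun x => f x - g x) r = surf x₀ f r - surf x₀ g r := integral_sub hf hg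

theorem surf_const_mul (c : ℝ) (f : Eu n → ℝ) (r : ℝ) :
    surf x₀ (fun x => c * f x) r = c * surf x₀ f r := integral_const_mul _ _

theorem surf_massFlux {σ : ℤ} {v : Eu n → ℝ} {P : Eu n → Eu n} {r : ℝ} (hr : 0 < r)
    (h1 : IntegrableOn (massDen σ v) (openHalf n) (sphereMeasure x₀ r))
    (h2 : IntegrableOn (mixDen σ x₀ v P) (openHalf n) (sphereMeasure x₀ r)) :
    surf x₀ (massFlux σ x₀ v P) r =
      ((n : ℝ) + σ) * surf x₀ (massDen σ v) r + 2 * (r * surf x₀ (mixDen σ x₀ v P) r) := by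
  rw [surf_congr (G := fun x => ((n : ℝ) + σ) * massDen σ v x + 2 * r * mixDen σ x₀ v P x) hr
    (fun x hx _ => by rw [massFlux, hx]; ring), surf_add (h1.const_mul _) (h2.const_mul _),
    surf_const_mul, surf_const_mul]
  ring

/-- The weighted square of `⟨P, ν⟩ - b v`. -/
def squareDen (σ : ℤ) (x₀ : Eu n) (v : Eu n → ℝ) (P : Eu n → Eu n) (b : ℝ) (x : Eu n) : ℝ :=
  (radDen σ x₀ P x - 2 * b * mixDen σ x₀ v P x) + b ^ 2 * massDen σ v x

theorem integrableOn_squareDen {σ : ℤ} {v : Eu n → ℝ} {P : Eu n → Eu n} {r : ℝ} (b : ℝ)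
    (h1 : IntegrableOn (massDen σ v) (openHalf n) (sphereMeasure x₀ r))
    (h2 : IntegrableOn (mixDen σ x₀ v P) (openHalf n) (sphereMeasure x₀ r))
    (h3 : IntegrableOn (radDen σ x₀ P) (openHalf n) (sphereMeasure x₀ r)) :
    IntegrableOn (squareDen σ x₀ v P b) (openHalf n) (sphereMeasure x₀ r) :=
  (h3.sub (h2.const_mul _)).add (h1.const_mul _)

theorem surf_squareDen {σ : ℤ} {v : Eu n → ℝ} {P : Eu n → Eu n} {r : ℝ} (b : ℝ)
    (h1 : IntegrableOn (massDen σ v) (openHalf n) (sphereMeasure x₀ r))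
    (h2 : IntegrableOn (mixDen σ x₀ v P) (openHalf n) (sphereMeasure x₀ r))
    (h3 : IntegrableOn (radDen σ x₀ P) (openHalf n) (sphereMeasure x₀ r)) :
    surf x₀ (squareDen σ x₀ v P b) r = surf x₀ (radDen σ x₀ P) r -
      2 * b * surf x₀ (mixDen σ x₀ v P) r + b ^ 2 * surf x₀ (massDen σ v) r := by
  have h4 : IntegrableOn (fun x => radDen σ x₀ P x - 2 * b * mixDen σ x₀ v P x) (openHalf n)
    (sphereMeasure x₀ r) := h3.sub (h2.const_mul _)
  rw [← surf_const_mul (b ^ 2), ← surf_const_mul (2 * b), ← surf_sub h3 (h2.const_mul _),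
    ← surf_add h4 (h1.const_mul _)]
  rfl

/-- The weak gradient of the positive phase. -/
def gradPos (Ω : Set (Eu n)) (u : Eu n → ℝ) : Eu n → Eu n := weakGrad (offAxis Ω) (pos u)

/-- The weak gradient of the positive part of `-u`. -/
def gradNeg (Ω : Set (Eu n)) (u : Eu n → ℝ) (x : Eu n) : Eu n := - weakGrad (offAxis Ω) (neg u) x

/-- The energy density of both phases. -/
def energyDen (Ω : Set (Eu n)) (u : Eu n → ℝ) (x : Eu n) : ℝ :=
  gradDen 1 (gradPos Ω u) x + gradDen (-1) (gradNeg Ω u) x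

omit [NeZero n] in
theorem neg_sq_eq (u : Eu n → ℝ) (x : Eu n) : neg u x ^ 2 = pos (fun x => - u x) x ^ 2 := by
  rw [neg_eq_neg_pos]
  ring

theorem energyI_eq (Ω : Set (Eu n)) (u : Eu n → ℝ) (x₀ : Eu n) :
    energyI Ω u x₀ = bulk x₀ (energyDen Ω u) := by
  funext r
  refine integral_congr_ae (Eventually.of_forall fun x => ?_)
  simp [energyDen, gradDen, gradPos, gradNeg, wt]

theorem massDen_one (u : Eu n → ℝ) : massDen 1 u = fun x => x 0 * pos u x ^ 2 := by
  funext x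
  simp [massDen, wt]

theorem massDen_neg_one (u : Eu n → ℝ) :
    massDen (-1) (fun x => - u x) = fun x => 1 / x 0 * neg u x ^ 2 := by
  funext x
  simp [massDen, wt, neg_sq_eq]

theorem weissIntegrand_eq (Ω : Set (Eu n)) (u : Eu n → ℝ) (β : ℝ) {r : ℝ} {x : Eu n}
    (hx : ‖x - x₀‖ = r) : weissIntegrand Ω u x₀ β r x =
      squareDen 1 x₀ u (gradPos Ω u) (β / r) x +
        squareDen (-1) x₀ (fun x => - u x) (gradNeg Ω u) ((β + 1) / r) x := by
  simp only [weissIntegrand, squareDen, radDen, mixDen, massDen, radPart, gradPos, gradNeg, normal,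
    neg_eq_neg_pos u, inner_smul_right, inner_neg_left, hx, wt, zpow_one, zpow_neg_one]
  ring

variable (hΩ : IsHalfSpaceDomain Ω) (hu : IsVariationalSolution Ω u) (hx₀ : x₀ ∈ Ω)
  (hx₀' : x₀ 0 = 0)
include hΩ hu hx₀

namespace IsVariationalSolution

theorem integrableOn_energyDen {R : ℝ} (hR : R ∈ radii Ω x₀) :
    IntegrableOn (energyDen Ω u) (halfBall x₀ R) :=
  IntegrableOn.mono_set (((hu.isPhase_pos hΩ).integrableOn_gradDen (hu.weakGrad_pos_ae hΩ)).add
    ((hu.isPhase_neg hΩ).integrableOn_gradDen (hu.neg_weakGrad_neg_ae hΩ)))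
    (halfBall_subset_offAxis hΩ hx₀ hR)

include hx₀'

/-- Writing `J` as `r⁻¹` times a bulk integral turns every term of `M` into a power of `r` times a
primitive in `r`, ready for differentiation and for absolute continuity. -/
theorem weissM_eq (β : ℝ) {r : ℝ} (hr : r ∈ radii Ω x₀) :
    weissM Ω u x₀ β r = r ^ (-2 * β - n + 1) * bulk x₀ (energyDen Ω u) r -
      β * (r ^ (-2 * β - n - 1) * bulk x₀ (massFlux 1 x₀ u (gradPos Ω u)) r) -
      (β + 1) * (r ^ (-2 * β - n - 1) *
        bulk x₀ (massFlux (-1) x₀ (fun x => - u x) (gradNeg Ω u)) r) := by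
  have hP : gradPos Ω u =ᵐ[volume.restrict (offAxis Ω)] posGrad u := hu.weakGrad_pos_ae hΩ
  have hN : gradNeg Ω u =ᵐ[volume.restrict (offAxis Ω)] posGrad fun x => - u x :=
    hu.neg_weakGrad_neg_ae hΩ
  rw [(hu.isPhase_pos hΩ).bulk_massDen hΩ hx₀ hP hx₀' hr,
    (hu.isPhase_neg hΩ).bulk_massDen hΩ hx₀ hN hx₀' hr,
    weissM, energyI_eq, Jpos, Jneg, ← massDen_one, ← massDen_neg_one]
  have h : r ^ (-2 * β - (n : ℝ)) = r ^ (-2 * β - (n : ℝ) - 1) * r := by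
    rw [← Real.rpow_add_one hr.1.ne']
    congr 1
    ring
  rw [h]
  simp only [surf]
  ring

theorem ae_hasDerivAt_weissM (β : ℝ) : ∀ᵐ r : ℝ, r ∈ radii Ω x₀ →
    IntegrableOn (weissIntegrand Ω u x₀ β r) (openHalf n) (sphereMeasure x₀ r) ∧
    HasDerivAt (weissM Ω u x₀ β) (2 * r ^ (-2 * β - (n : ℝ) + 1) *
      ∫ x in openHalf n, weissIntegrand Ω u x₀ β r x ∂(sphereMeasure x₀ r)) r := by
  have hp := hu.isPhase_pos hΩ
  have hn := hu.isPhase_neg hΩ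
  have hP : gradPos Ω u =ᵐ[volume.restrict (offAxis Ω)] posGrad u := hu.weakGrad_pos_ae hΩ
  have hN : gradNeg Ω u =ᵐ[volume.restrict (offAxis Ω)] posGrad fun x => - u x :=
    hu.neg_weakGrad_neg_ae hΩ
  have hsub : ∀ {f : Eu n → ℝ}, IntegrableOn f (offAxis Ω) →
      ∀ R ∈ radii Ω x₀, IntegrableOn f (halfBall x₀ R) := fun hf R hR =>
    hf.mono_set (halfBall_subset_offAxis hΩ hx₀ hR)
  filter_upwards [hu.ae_rellich hΩ hx₀ hx₀' rfl rfl, hp.ae_bulk_gradDen hΩ hx₀ hP,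
    hn.ae_bulk_gradDen hΩ hx₀ hN,
    ae_integrableOn_sphereMeasure (hsub (hp.integrableOn_gradDen hP)),
    ae_integrableOn_sphereMeasure (hsub (hn.integrableOn_gradDen hN)),
    ae_integrableOn_sphereMeasure (hsub (hp.integrableOn_mixDen hΩ hP x₀)),
    ae_integrableOn_sphereMeasure (hsub (hn.integrableOn_mixDen hΩ hN x₀)),
    ae_integrableOn_sphereMeasure (hsub (hp.integrableOn_radDen hΩ hP x₀)),
    ae_integrableOn_sphereMeasure (hsub (hn.integrableOn_radDen hΩ hN x₀)),
    ae_hasDerivAt_bulk_radii (fun R hR => hu.integrableOn_energyDen hΩ hx₀ (R := R) hR),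
    ae_hasDerivAt_bulk_radii (hp.integrableOn_massFlux hΩ hx₀ hP),
    ae_hasDerivAt_bulk_radii (hn.integrableOn_massFlux hΩ hx₀ hN)]
    with r rell ep en ge gn mp mn rp rn dE dp dn hr
  have hr0 : 0 < r := hr.1
  have jp := (hp.massDen_sphere hΩ hx₀ hx₀').1 r hr
  have jn := (hn.massDen_sphere hΩ hx₀ hx₀').1 r hr
  replace ep := ep hr
  replace en := en hr
  replace ge := ge hr
  replace gn := gn hr
  replace mp := mp hr
  replace mn := mn hr
  replace rp := rp hr
  replace rn := rn hr
  replace rell := rell hr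
  have hsq : weissIntegrand Ω u x₀ β r =ᵐ[(sphereMeasure x₀ r).restrict (openHalf n)] fun x =>
      squareDen 1 x₀ u (gradPos Ω u) (β / r) x +
        squareDen (-1) x₀ (fun x => - u x) (gradNeg Ω u) ((β + 1) / r) x := by
    filter_upwards [ae_restrict_of_ae (ae_norm_eq_sphereMeasure x₀ hr0)] with x hx
    exact weissIntegrand_eq Ω u β hx
  have sp := integrableOn_squareDen (β / r) jp mp rp
  have sn := integrableOn_squareDen ((β + 1) / r) jn mn rn
  refine ⟨Integrable.congr (sp.add sn) hsq.symm, ?_⟩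
  have hI : ∫ x in openHalf n, weissIntegrand Ω u x₀ β r x ∂(sphereMeasure x₀ r) = _ :=
    (integral_congr_ae hsq).trans (surf_add sp sn)
  rw [hI, surf_squareDen _ jp mp rp, surf_squareDen _ jn mn rn]
  have hsubset := halfBall_subset_offAxis hΩ hx₀ hr
  have ip := (hp.integrableOn_gradDen hP).mono_set hsubset
  have iN := (hn.integrableOn_gradDen hN).mono_set hsubset
  have hbulk : bulk x₀ (energyDen Ω u) r = surf x₀ (mixDen 1 x₀ u (gradPos Ω u)) r +
      surf x₀ (mixDen (-1) x₀ (fun x => - u x) (gradNeg Ω u)) r := by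
    rw [← ep, ← en]
    exact integral_add ip iN
  have hrell : ((n : ℝ) - 1) * surf x₀ (mixDen 1 x₀ u (gradPos Ω u)) r +
      ((n : ℝ) - 3) * surf x₀ (mixDen (-1) x₀ (fun x => - u x) (gradNeg Ω u)) r =
      r * (surf x₀ (energyDen Ω u) r - 2 * surf x₀ (radDen 1 x₀ (gradPos Ω u)) r -
        2 * surf x₀ (radDen (-1) x₀ (gradNeg Ω u)) r) := by
    -- The energy identity replaces the two energies on the left of the Rellich identity by boundary
    -- integrals of `x₁^σ v ∂_ν v`, so that `I'` is expressed by surface terms alone.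
    have h1 : bulk x₀ (fun x => ((n : ℝ) - 1) * gradDen 1 (gradPos Ω u) x +
        ((n : ℝ) - 3) * gradDen (-1) (gradNeg Ω u) x) r =
        ((n : ℝ) - 1) * bulk x₀ (gradDen 1 (gradPos Ω u)) r +
          ((n : ℝ) - 3) * bulk x₀ (gradDen (-1) (gradNeg Ω u)) r := by
      rw [bulk, integral_add (ip.const_mul _) (iN.const_mul _), integral_const_mul,
        integral_const_mul]
      rfl
    rw [← ep, ← en, ← h1]
    refine rell.trans ?_
    have s1 := ge.sub (rp.const_mul 2)
    have s2 := gn.sub (rn.const_mul 2)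
    have h2 : surf x₀ (energyDen Ω u) r = _ := surf_add ge gn
    rw [h2]
    congr 1
    refine (surf_add s1 s2).trans ?_
    have h3 : surf x₀ _ r = _ := surf_sub ge (rp.const_mul 2)
    have h4 : surf x₀ _ r = _ := surf_sub gn (rn.const_mul 2)
    rw [surf_const_mul] at h3 h4
    refine (congrArg₂ (· + ·) h3 h4).trans ?_
    ring
  have hpow : ∀ a : ℝ, HasDerivAt (fun r : ℝ => r ^ a) (a * r ^ (a - 1)) r := fun a =>
    Real.hasDerivAt_rpow_const (Or.inl hr0.ne')
  have hK := (((hpow (-2 * β - n + 1)).fun_mul (dE hr)).fun_sub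
    (((hpow (-2 * β - n - 1)).fun_mul (dp hr)).const_mul β)).fun_sub
    (((hpow (-2 * β - n - 1)).fun_mul (dn hr)).const_mul (β + 1))
  refine (hK.congr_of_eventuallyEq ?_).congr_deriv ?_
  · filter_upwards [isOpen_radii.mem_nhds hr] with s hs
    exact hu.weissM_eq hΩ hx₀ hx₀' β hs
  · rw [surf_massFlux hr0 jp mp, surf_massFlux hr0 jn mn, hp.bulk_massDen hΩ hx₀ hP hx₀' hr,
      hn.bulk_massDen hΩ hx₀ hN hx₀' hr, hbulk]
    have e1 : r ^ (-2 * β - (n : ℝ) + 1) = r ^ (-2 * β - (n : ℝ)) * r :=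
      Real.rpow_add_one hr0.ne' _
    have e2 : r ^ (-2 * β - (n : ℝ) - 1) = r ^ (-2 * β - (n : ℝ)) / r :=
      Real.rpow_sub_one hr0.ne' _
    have e3 : r ^ (-2 * β - (n : ℝ) - 1 - 1) = r ^ (-2 * β - (n : ℝ)) / r / r := by
      rw [Real.rpow_sub_one hr0.ne', e2]
    have e4 : r ^ (-2 * β - (n : ℝ) + 1 - 1) = r ^ (-2 * β - (n : ℝ)) := by
      rw [Real.rpow_sub_one hr0.ne', e1, mul_div_cancel_right₀ _ hr0.ne']
    -- The Rellich identity solved for `I'`. With it, the coefficients of `∫∂ x₁^σ v ∂_ν v` and of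
    -- `J` become `-4b` and `2b²/r` times `r^(-2β-n)`, with `b = β` or `β + 1` by phase: exactly the
    -- expanded squares.
    have hE : surf x₀ (energyDen Ω u) r =
        (((n : ℝ) - 1) * surf x₀ (mixDen 1 x₀ u (gradPos Ω u)) r +
          ((n : ℝ) - 3) * surf x₀ (mixDen (-1) x₀ (fun x => - u x) (gradNeg Ω u)) r) / r +
        2 * surf x₀ (radDen 1 x₀ (gradPos Ω u)) r +
        2 * surf x₀ (radDen (-1) x₀ (gradNeg Ω u)) r := by
      rw [hrell]
      field_simp
      ring
    rw [e1, e2, e3, e4, hE]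
    push_cast
    field_simp
    ring

theorem monotoneOn_weissM (β : ℝ) : MonotoneOn (weissM Ω u x₀ β) (radii Ω x₀) := by
  intro s hs r hr hsr
  have hIcc : uIcc s r ⊆ radii Ω x₀ := fun t ht => by
    rw [uIcc_of_le hsr] at ht
    exact radii_of_le hr (hs.1.trans_le ht.1) ht.2
  have hpow : ∀ a : ℝ, AbsolutelyContinuousOnInterval (fun t : ℝ => t ^ a) s r := fun a =>
    ContDiffOn.absolutelyContinuousOnInterval fun t ht =>
      (Real.contDiffAt_rpow_const_of_ne (hIcc ht).1.ne').contDiffWithinAt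
  have hb : ∀ {f : Eu n → ℝ}, IntegrableOn f (halfBall x₀ r) →
      AbsolutelyContinuousOnInterval (bulk x₀ f) s r := fun hf =>
    absolutelyContinuousOnInterval_bulk x₀ hs.1 hsr hf
  have hac : AbsolutelyContinuousOnInterval (weissM Ω u x₀ β) s r := by
    refine absolutelyContinuousOnInterval_congr
      (((hpow (-2 * β - n + 1)).fun_mul (hb (hu.integrableOn_energyDen hΩ hx₀ hr))).fun_sub
        (((hpow (-2 * β - n - 1)).fun_mul (hb ((hu.isPhase_pos hΩ).integrableOn_massFlux hΩ hx₀
          (hu.weakGrad_pos_ae hΩ) r hr))).const_mul β) |>.fun_sub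
        (((hpow (-2 * β - n - 1)).fun_mul (hb ((hu.isPhase_neg hΩ).integrableOn_massFlux hΩ hx₀
          (hu.neg_weakGrad_neg_ae hΩ) r hr))).const_mul (β + 1)))
      fun t ht => (hu.weissM_eq hΩ hx₀ hx₀' β (hIcc ht)).symm
  -- Absolute continuity lets the increment be recovered from the a.e. derivative, whose sign is
  -- that of the squares.
  rw [← sub_nonneg, ← hac.integral_deriv_eq_sub]
  refine intervalIntegral.integral_nonneg_of_ae_restrict hsr ?_
  rw [EventuallyLE, ae_restrict_iff' measurableSet_Icc]
  filter_upwards [hu.ae_hasDerivAt_weissM hΩ hx₀ hx₀' β] with t h ht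
  have htr := hIcc (by rwa [uIcc_of_le hsr])
  rw [(h htr).2.deriv]
  have ht0 : 0 < t := htr.1
  refine mul_nonneg (by positivity) (setIntegral_nonneg measurableSet_openHalf fun x hx => ?_)
  have hx0 : 0 < x 0 := hx
  rw [weissIntegrand]
  positivity

end IsVariationalSolution

end monotonicity

end AxisFB

end

theorem mainTheorem3 {n : ℕ} [NeZero n] (Ω : Set (AxisFB.Eu n))
    (hΩ : AxisFB.IsHalfSpaceDomain Ω) (u : AxisFB.Eu n → ℝ)
    (hu : AxisFB.IsVariationalSolution Ω u)
    (x₀ : AxisFB.Eu n) (hx₀ : x₀ ∈ Ω) (hx₀_axis : x₀ 0 = 0) (β : ℝ) (hβ : 0 < β) :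
    -- the surface integrals in `M` are finite for every admissible radius
    (∀ r ∈ AxisFB.radii Ω x₀,
      IntegrableOn (fun x => x 0 * AxisFB.pos u x ^ 2) (AxisFB.openHalf n)
          (AxisFB.sphereMeasure x₀ r) ∧
      IntegrableOn (fun x => 1 / x 0 * AxisFB.neg u x ^ 2) (AxisFB.openHalf n)
          (AxisFB.sphereMeasure x₀ r)) ∧
    -- the derivative formula
    (∀ᵐ r : ℝ, r ∈ AxisFB.radii Ω x₀ →
      IntegrableOn (AxisFB.weissIntegrand Ω u x₀ β r) (AxisFB.openHalf n)
          (AxisFB.sphereMeasure x₀ r) ∧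
      HasDerivAt (AxisFB.weissM Ω u x₀ β)
        (2 * r ^ (-2 * β - (n : ℝ) + 1) *
          ∫ x in AxisFB.openHalf n, AxisFB.weissIntegrand Ω u x₀ β r x
            ∂(AxisFB.sphereMeasure x₀ r)) r) ∧
    -- monotonicity
    MonotoneOn (AxisFB.weissM Ω u x₀ β) (AxisFB.radii Ω x₀) := by
  refine ⟨fun r hr => ?_, hu.ae_hasDerivAt_weissM hΩ hx₀ hx₀_axis β,
    hu.monotoneOn_weissM hΩ hx₀ hx₀_axis β⟩
  rw [← AxisFB.massDen_one, ← AxisFB.massDen_neg_one]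
  exact ⟨((hu.isPhase_pos hΩ).massDen_sphere hΩ hx₀ hx₀_axis).1 r hr,
    ((hu.isPhase_neg hΩ).massDen_sphere hΩ hx₀ hx₀_axis).1 r hr⟩
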